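/- **Machines.** A nondeterministic Turing machine (NTM) $T=(Q,\Sigma,\Delta,q_0,F,F_{acc})$ has $t\ge 1$ external and $u\ge 0$ internal memory tapes, all one-sided infinite; the input stands on the first external tape; $\Delta\subseteq (Q\setminus F)\times\Sigma^{t+u}\times Q\times\Sigma^{t+u}\times\{L,N,R\}^{t+u}$, where each transition moves at most one head, $F_{acc}\subseteq F$, and $\square\in\Sigma$ is the blank symbol. A transition that would move a head beyond the left end of its tape is not applicable. A finite run is a sequence of successive configurations that starts with the initial configuration and ends in a configuration without successor; it is accepting if its last state is in $F_{acc}$. $T$ is $(r,s,t)$-bounded if, for every $N$ and every input word $w\in(\Sigma\setminus\{\square\})^N$, there is no infinite run on $w$, and every run $\rho$ on $w$ satisfies $1+\sum_{i\le t}\mathrm{rev}(\rho,i)\le r(N)$ and $\sum_{t<i\le t+u}\mathrm{space}(\rho,i)\le s(N)$, where $\mathrm{rev}(\rho,i)$ is the number of direction changes of head $i$ and $\mathrm{space}(\rho,i)$ the number of cells visited on tape $i$. In each step every possible next configuration is chosen with the same probability; $\Pr(T\text{ accepts }w)$ is the sum of the probabilities of all accepting runs on $w$. $T$ is deterministic if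 $\Delta$ contains at most one transition for each element of $(Q\setminus F)\times\Sigma^{t+u}$. A nondeterministic list machine (NLM) $M=(t,m,I,C,A,a_0,\alpha,B,B_{acc})$ has finite, pairwise disjoint sets $I$ (input numbers), $C\neq\emptyset$ (nondeterministic choices), $A$ (states), with $a_0\in A$, $B_{acc}\subseteq B\subseteq A$, and a transition function $\alpha:(A\setminus B)\times(\mathbb A^*)^t\times C\to A\times(\{-1,+1\}\times\{\mathit{true},\mathit{false}\})^t$, where $\mathbb A=I\cup C\cup A\cup\{\langle,\rangle\}$. A configuration consists of a state, and of a head position $p_i$, a head direction $d_i$ and a list $(x_{i,1},\dots,x_{i,m_i})$ of cells over $\mathbb A^*$ for each $i\le t$. Initially the state is $a_0$, $p_i=1$, $d_i=+1$, the first list is $(\langle v_1\rangle,\dots,\langle v_m\rangle)$ and the other lists are $(\langle\rangle)$. In a step with choice $c$ from state $a\notin B$, $\alpha(a,x_{1,p_1},\dots,x_{t,p_t},c)$ gives the new state and a pair (direction, move) for each list; move is replaced by *false* where the head would leave its list. If no move is *true* and no direction differs from $d_i$, only the state changes. Otherwise, with $y=a\langle x_{1,p_1}\rangle\cdots\langle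 x_{t,p_t}\rangle\langle c\rangle$, in every list $i$: if move is *true*, then $y$ replaces the current cell and the head moves to the next cell in the new direction; if move is *false*, then $y$ is inserted immediately to the left (if $d_i=+1$) or to the right (if $d_i=-1$) of the current cell, and the new head position is $p_i+1$ or $p_i$ if the new direction is $+1$ or $-1$, respectively. Then $d_i$ becomes the new direction. A run on $\vec v\in I^m$ starts with the initial configuration, and a finite run ends with a state in $B$; it is accepting if this state is in $B_{acc}$. $M$ is $(r,t)$-bounded if it has at most $t$ lists, has no infinite run, and every run has at most $r-1$ changes of head directions in total. In each step $c\in C$ is chosen uniformly; $\Pr(M\text{ accepts }\vec v)$ is the sum of the probabilities of all accepting runs on $\vec v$. $M$ is deterministic if $|C|=1$. **Simulation Lemma.** There is a function $d=d(u,|Q|,|\Sigma|)$ such that the following holds. Let $r,s:\mathbb N\to\mathbb N$, $t\ge 1$, and let $T=(Q,\Sigma,\Delta,q_0,F,F_{acc})$ be an $(r,s,t)$-bounded NTM with $t+u$ tapes and with two distinct symbols $\square,\#\in\Sigma$. There is a constant $K$, depending only on $T$, such that for all $m\ge 1$ and $n\ge 0$ with $s(N)\ge 1$, where $N:=m(n+1)$,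 there is an $(r(N),t)$-bounded NLM $M=(t,m,I,C,A,a_0,\alpha,B,B_{acc})$ with $I=(\Sigma\setminus\{\square,\#\})^n$ such that 1. $|C|\le 2^{K\cdot \ell}$ for every upper bound $\ell$ on the length of $T$'s runs on input words of length $N$; 2. $|A|\le 2^{\,d\cdot t^2\cdot r(N)\cdot s(N)+3t\log_2 N}$; 3. for all $\vec v=(v_1,\dots,v_m)\in I^m$: $\Pr(M\text{ accepts }\vec v)=\Pr(T\text{ accepts }v_1\#v_2\#\cdots v_m\#)$; 4. if $T$ is deterministic, then $M$ is deterministic. -/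

import Mathlib

open scoped ENNReal

/-! ## Sequences of configurations -/

/-- The number of adjacent pairs of distinct entries of a list. -/
def changeCount {α : Type*} [DecidableEq α] : List α → ℕ
  | a :: b :: l => (if a ≠ b then 1 else 0) + changeCount (b :: l)
  | _ => 0

/-- The product of `f a b` over all adjacent pairs `a, b` of a list. -/
noncomputable def chainProd {α : Type*} (f : α → α → ℝ≥0∞) : List α → ℝ≥0∞
  | a :: b :: l => f a b * chainProd f (b :: l)
  | _ => 1

/-! ## Nondeterministic multi-tape Turing machines -/

/-- Movements of a Turing machine head: left, none, right. -/
inductive TMMove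
  | L
  | N
  | R
  deriving DecidableEq

/-- The tapes of a machine with `t` external and `u` internal memory tapes. -/
abbrev Tape (t u : ℕ) : Type := Fin t ⊕ Fin u

/-- An element of `Q × Σ^(t+u) × Q × Σ^(t+u) × {L,N,R}^(t+u)`. -/
structure TMTransition (t u : ℕ) (Q S : Type*) where
  src : Q
  read : Tape t u → S
  tgt : Q
  write : Tape t u → S
  move : Tape t u → TMMove

/-- A (normalized) nondeterministic Turing machine with state space `Q`, alphabet `S`,
`t` external memory tapes and `u` internal memory tapes. -/
structure NTM (t u : ℕ) (Q S : Type*) where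
  finite_states : Finite Q
  finite_alphabet : Finite S
  /-- the blank symbol -/
  blank : S
  /-- the transition relation -/
  rel : Set (TMTransition t u Q S)
  /-- the start state -/
  start : Q
  /-- the final states -/
  final : Set Q
  /-- the accepting states -/
  acc : Set Q
  acc_subset : acc ⊆ final
  /-- no transition leaves a final state -/
  src_not_final : ∀ δ ∈ rel, δ.src ∉ final
  /-- in each step at most one head moves to the left or to the right -/
  normalized : ∀ δ ∈ rel, ∀ i j, δ.move i ≠ TMMove.N → δ.move j ≠ TMMove.N → i = j

/-- A configuration. The cells of each one-sided infinite tape are numbered `0, 1, 2, …`;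
an inscription is given on all cells, unused cells carrying the blank symbol. -/
structure TMConfig (t u : ℕ) (Q S : Type*) where
  state : Q
  pos : Tape t u → ℕ
  tape : Tape t u → ℕ → S

namespace NTM

variable {t u : ℕ} {Q S : Type*}

/-- The initial configuration on the word `w`: the input is written on the first external memory
tape, all other cells are blank, and all heads are on the leftmost cell. -/
def init (T : NTM t u Q S) (w : List S) : TMConfig t u Q S where
  state := T.start
  pos := fun _ => 0
  tape := fun i k =>
    match i with
    | Sum.inl j => if j.val = 0 then w.getD k T.blank else T.blank
    | Sum.inr _ => T.blank

/-- The head position after a movement (a left movement is only performed at positions `≠ 0`). -/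
def movePos : TMMove → ℕ → ℕ
  | TMMove.L, p => p - 1
  | TMMove.N, p => p
  | TMMove.R, p => p + 1

/-- `γ'` results from `γ` in one computation step. A transition that would move a head beyond the
left end of its tape is not applicable. -/
def Step (T : NTM t u Q S) (γ γ' : TMConfig t u Q S) : Prop :=
  ∃ δ ∈ T.rel, δ.src = γ.state ∧ (∀ i, δ.read i = γ.tape i (γ.pos i)) ∧
    (∀ i, δ.move i = TMMove.L → γ.pos i ≠ 0) ∧
    γ' = { state := δ.tgt
           pos := fun i => movePos (δ.move i) (γ.pos i)
           tape := fun i => Function.update (γ.tape i) (γ.pos i) (δ.write i) }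

/-- The set of all configurations that can be reached from `γ` in a single step. -/
def next (T : NTM t u Q S) (γ : TMConfig t u Q S) : Set (TMConfig t u Q S) :=
  {γ' | T.Step γ γ'}

/-- Finite runs on the word `w`: sequences of configurations that start with the initial
configuration, proceed by computation steps, and end in a configuration without successor
(in particular, every such sequence that ends in a final configuration is a run). -/
def IsRun (T : NTM t u Q S) (w : List S) (ρ : List (TMConfig t u Q S)) : Prop :=
  ρ.head? = some (T.init w) ∧ ρ.IsChain T.Step ∧ ∃ γ, ρ.getLast? = some γ ∧ T.next γ = ∅

/-- Accepting runs: the last configuration is accepting. -/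
def IsAcceptingRun (T : NTM t u Q S) (w : List S) (ρ : List (TMConfig t u Q S)) : Prop :=
  T.IsRun w ρ ∧ ∃ γ, ρ.getLast? = some γ ∧ γ.state ∈ T.acc

/-- There is an infinite run on the word `w`. -/
def HasInfiniteRun (T : NTM t u Q S) (w : List S) : Prop :=
  ∃ f : ℕ → TMConfig t u Q S, f 0 = T.init w ∧ ∀ k, T.Step (f k) (f (k + 1))

/-- The movements `-1, 1` of the head on tape `i` along a sequence of configurations,
where the steps in which this head does not move are left out. -/
def headMoves (ρ : List (TMConfig t u Q S)) (i : Tape t u) : List ℤ :=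
  (List.zipWith (fun γ γ' => (γ'.pos i : ℤ) - (γ.pos i : ℤ)) ρ ρ.tail).filter (fun z => z ≠ 0)

/-- The number of times the head on tape `i` changes its direction. -/
def rev (ρ : List (TMConfig t u Q S)) (i : Tape t u) : ℕ :=
  changeCount (headMoves ρ i)

/-- The number of cells of tape `i` that are used. -/
def space (ρ : List (TMConfig t u Q S)) (i : Tape t u) : ℕ :=
  (ρ.map (fun γ => γ.pos i)).toFinset.card

/-- Input words: words that do not contain the blank symbol. -/
def IsInput (T : NTM t u Q S) (w : List S) : Prop :=
  T.blank ∉ w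

/-- `(r,s,t)`-bounded Turing machines. -/
def IsBounded (T : NTM t u Q S) (r s : ℕ → ℕ) : Prop :=
  ∀ w, T.IsInput w →
    ¬ T.HasInfiniteRun w ∧
    ∀ ρ, T.IsRun w ρ →
      1 + ∑ j : Fin t, rev ρ (Sum.inl j) ≤ r w.length ∧
      ∑ j : Fin u, space ρ (Sum.inr j) ≤ s w.length

/-- At most one transition is available for each state and each tuple of scanned symbols. -/
def IsDeterministic (T : NTM t u Q S) : Prop :=
  ∀ δ ∈ T.rel, ∀ δ' ∈ T.rel, δ.src = δ'.src → δ.read = δ'.read → δ = δ'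

/-- The probability that `γ` yields `γ'` in one step: each element of `next γ` is chosen with
uniform probability. -/
noncomputable def stepProb (T : NTM t u Q S) (γ γ' : TMConfig t u Q S) : ℝ≥0∞ :=
  (T.next γ).indicator (fun _ => ((T.next γ).ncard : ℝ≥0∞)⁻¹) γ'

/-- The probability that the machine accepts `w`: the sum, over all accepting runs on `w`, of the
probability of the run. -/
noncomputable def acceptProb (T : NTM t u Q S) (w : List S) : ℝ≥0∞ :=
  ∑' ρ : {ρ : List (TMConfig t u Q S) // T.IsAcceptingRun w ρ}, chainProd T.stepProb ρ.1

end NTM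

/-! ## Nondeterministic list machines -/

/-- The alphabet of a list machine: the disjoint union of the input numbers, the nondeterministic
choices, the abstract states, and two special symbols (the opening and the closing bracket). -/
inductive LMSymbol (I C A : Type*)
  | input (v : I)
  | choice (c : C)
  | state (a : A)
  | opening
  | closing

/-- Head directions `-1` (left) and `+1` (right). -/
inductive HeadDir
  | left
  | right
  deriving DecidableEq

/-- Pairs (head-direction, move). -/
abbrev Movement : Type := HeadDir × Bool

/-- A nondeterministic list machine with `t` lists, input length `m`, input numbers `I`,
nondeterministic choices `C` and abstract states `A`. -/
structure NLM (t m : ℕ) (I C A : Type*) where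
  finite_inputs : Finite I
  finite_choices : Finite C
  nonempty_choices : Nonempty C
  finite_states : Finite A
  /-- the initial state -/
  start : A
  /-- the final states -/
  final : Set A
  /-- the accepting states -/
  acc : Set A
  acc_subset : acc ⊆ final
  /-- the transition function -/
  trans : {a : A // a ∉ final} → (Fin t → List (LMSymbol I C A)) → C → A × (Fin t → Movement)

/-- A configuration of a list machine. List positions are numbered `0, 1, 2, …`. -/
structure LMConfig (t : ℕ) (I C A : Type*) where
  state : A
  pos : Fin t → ℕ
  dir : Fin t → HeadDir
  lists : Fin t → List (List (LMSymbol I C A))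

namespace LMConfig

variable {t : ℕ} {I C A : Type*}

/-- The content of the cell of the `i`-th list at the current head position. -/
def cell (γ : LMConfig t I C A) (i : Fin t) : List (LMSymbol I C A) :=
  (γ.lists i).getD (γ.pos i) []

/-- The string `a ⟨x₁⟩ ⋯ ⟨x_t⟩ ⟨c⟩`, where `a` is the current state, and the `xᵢ` are the
contents of the current cells. -/
def written (γ : LMConfig t I C A) (c : C) : List (LMSymbol I C A) :=
  [LMSymbol.state γ.state] ++
    (List.finRange t).flatMap (fun i => [LMSymbol.opening] ++ γ.cell i ++ [LMSymbol.closing]) ++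
    [LMSymbol.opening, LMSymbol.choice c, LMSymbol.closing]

/-- The movement that is actually performed on the `i`-th list: a head does not move beyond the
ends of its list. -/
def adjust (γ : LMConfig t I C A) (i : Fin t) : Movement → Movement
  | (HeadDir.left, true) => if γ.pos i = 0 then (HeadDir.left, false) else (HeadDir.left, true)
  | (HeadDir.right, true) =>
      if γ.pos i + 1 = (γ.lists i).length then (HeadDir.right, false) else (HeadDir.right, true)
  | e => e

/-- The new `i`-th list when `y` is written and the adjusted movement on the list is `e`. -/
def newList (γ : LMConfig t I C A) (y : List (LMSymbol I C A)) (i : Fin t) (e : Movement) :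
    List (List (LMSymbol I C A)) :=
  match e.2, γ.dir i with
  | true, _ => (γ.lists i).take (γ.pos i) ++ [y] ++ (γ.lists i).drop (γ.pos i + 1)
  | false, HeadDir.right => (γ.lists i).take (γ.pos i) ++ [y] ++ (γ.lists i).drop (γ.pos i)
  | false, HeadDir.left => (γ.lists i).take (γ.pos i + 1) ++ [y] ++ (γ.lists i).drop (γ.pos i + 1)

/-- The new head position from the old one and the adjusted movement. -/
def newPos (p : ℕ) : Movement → ℕ
  | (HeadDir.right, true) => p + 1
  | (HeadDir.left, true) => p - 1
  | (HeadDir.right, false) => p + 1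
  | (HeadDir.left, false) => p

end LMConfig

namespace NLM

variable {t m : ℕ} {I C A : Type*}

/-- The initial configuration on input `(v₁, …, v_m)`. -/
def init (M : NLM t m I C A) (v : Fin m → I) : LMConfig t I C A where
  state := M.start
  pos := fun _ => 0
  dir := fun _ => HeadDir.right
  lists := fun i =>
    if i.val = 0 then
      (List.ofFn v).map (fun x => [LMSymbol.opening, LMSymbol.input x, LMSymbol.closing])
    else [[LMSymbol.opening, LMSymbol.closing]]

/-- The `c`-successor of a configuration that is not final. -/
def succ (M : NLM t m I C A) (γ : LMConfig t I C A) (h : γ.state ∉ M.final) (c : C) :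
    LMConfig t I C A :=
  let out := M.trans ⟨γ.state, h⟩ γ.cell c
  let e : Fin t → Movement := fun i => γ.adjust i (out.2 i)
  if ∀ i, (e i).2 = false ∧ (e i).1 = γ.dir i then
    { γ with state := out.1 }
  else
    { state := out.1
      pos := fun i => LMConfig.newPos (γ.pos i) (e i)
      dir := fun i => (e i).1
      lists := fun i => γ.newList (γ.written c) i (e i) }

/-- `γ'` is the `c`-successor of `γ`. -/
def IsSucc (M : NLM t m I C A) (c : C) (γ γ' : LMConfig t I C A) : Prop :=
  ∃ h : γ.state ∉ M.final, γ' = M.succ γ h c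

/-- `γ'` is the `c`-successor of `γ` for some nondeterministic choice `c`. -/
def Step (M : NLM t m I C A) (γ γ' : LMConfig t I C A) : Prop :=
  ∃ c, M.IsSucc c γ γ'

/-- Finite runs on input `v`. -/
def IsRun (M : NLM t m I C A) (v : Fin m → I) (ρ : List (LMConfig t I C A)) : Prop :=
  ρ.head? = some (M.init v) ∧ ρ.IsChain M.Step ∧ ∃ γ, ρ.getLast? = some γ ∧ γ.state ∈ M.final

/-- Accepting runs on input `v`. -/
def IsAcceptingRun (M : NLM t m I C A) (v : Fin m → I) (ρ : List (LMConfig t I C A)) : Prop :=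
  M.IsRun v ρ ∧ ∃ γ, ρ.getLast? = some γ ∧ γ.state ∈ M.acc

/-- There is an infinite run on input `v`. -/
def HasInfiniteRun (M : NLM t m I C A) (v : Fin m → I) : Prop :=
  ∃ f : ℕ → LMConfig t I C A, f 0 = M.init v ∧ ∀ k, M.Step (f k) (f (k + 1))

/-- The number of changes of the direction of the head on the `i`-th list. -/
def rev (ρ : List (LMConfig t I C A)) (i : Fin t) : ℕ :=
  changeCount (ρ.map (fun γ => γ.dir i))

/-- `(r,t')`-bounded list machines. -/
def IsBounded (M : NLM t m I C A) (r t' : ℕ) : Prop :=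
  t ≤ t' ∧ ∀ v, ¬ M.HasInfiniteRun v ∧ ∀ ρ, M.IsRun v ρ → 1 + ∑ i : Fin t, rev ρ i ≤ r

/-- A list machine is deterministic if it has exactly one nondeterministic choice. -/
def IsDeterministic (_M : NLM t m I C A) : Prop :=
  Nat.card C = 1

/-- The probability that `γ` yields `γ'` in one step. -/
noncomputable def stepProb (M : NLM t m I C A) (γ γ' : LMConfig t I C A) : ℝ≥0∞ :=
  ({c : C | M.IsSucc c γ γ'}.ncard : ℝ≥0∞) / (Nat.card C : ℝ≥0∞)

/-- The probability that the machine accepts `v`: the sum, over all accepting runs on `v`, of the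
probability of the run. -/
noncomputable def acceptProb (M : NLM t m I C A) (v : Fin m → I) : ℝ≥0∞ :=
  ∑' ρ : {ρ : List (LMConfig t I C A) // M.IsAcceptingRun v ρ}, chainProd M.stepProb ρ.1

end NLM

/-! ## Inputs -/

/-- The set of all words of length `n` over the alphabet `S` without the symbols `blank` and
`hash`. -/
abbrev InputItem {S : Type*} (blank hash : S) (n : ℕ) : Type _ :=
  Fin n → {a : S // a ≠ blank ∧ a ≠ hash}

/-- The word `v₁ # v₂ # ⋯ v_m #`, where `#` is the symbol `hash`. -/
def inputWord {S : Type*} {blank hash : S} {m n : ℕ} (v : Fin m → InputItem blank hash n) :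
    List S :=
  (List.ofFn v).flatMap (fun x => List.ofFn (fun k => (x k).val) ++ [hash])

/-! The list machine keeps one list per external tape, and each list cell stands for a block of
consecutive tape cells. Its state stores the state and internal tapes of `T` and, for each external
tape, the head direction and position, the tape position `cut` of the gap next to the list head, a
counter `idx` of input items, and sometimes the scanned symbol. One step of the list machine runs
`T` until an external head is about to turn or to leave the block under its list head
(`Simulates.progress`). If some tape head lies outside its current block, a step only advances that
list head (`Simulates.skip`). The string written in a step names the state, all cells read and the
choice, so the inscription of the new block can be recomputed from it: `History.encode_injective`
makes the string decodable and `History.block` evaluates it recursively. List heads turn only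
together with tape heads, which bounds the reversals (`Simulates.rev_le`).

A choice of the list machine is a sequence of `ℓ` numbers below `B`, where `ℓ` is the length of a
longest run and `B` is divisible by every possible number of applicable transitions. Each number
then selects an applicable transition uniformly, and unused numbers average out
(`NTM.sum_simulateValue`). Hence corresponding configurations have the same acceptance probability
(`Simulates.acceptFrom_eq`). With `B` the factorial of the number of transitions, or `B = 1` for
deterministic `T`, there are `B ^ ℓ` choices.

The number of states depends on the range of head positions, hence on `ℓ`. Since `T` has no infinite
runs, its local configuration (state, internal memory, scanned external symbols) cannot recur while
the external heads only rest or move right over blank cells: such a loop could be repeated forever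
(`NTM.not_localEq_of_acc`). So, with `W` local configurations, the time up to the next turn grows at
most by a factor linear in `W`, and `NTM.Reach.potential` yields `ℓ ≤ (N + t + 1) * (2 * W + 3) ^
r`. Position, cut and item counter of each tape contribute one factor `N` each, which gives `N ^ (3
* t)`; everything else is absorbed into `2 ^ (d * t ^ 2 * r * s)`. -/

/-! ## Sums over accepting chains -/

section Chains

variable {X : Type*}

/-- Chains from `x` whose last element satisfies `Z`. -/
def IsAcceptingChain (R : X → X → Prop) (Z : X → Prop) (x : X) (ρ : List X) : Prop :=
  ρ.head? = some x ∧ ρ.IsChain R ∧ ∃ y, ρ.getLast? = some y ∧ Z y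

/-- The total weight of all accepting chains from `x`. -/
noncomputable def chainSum (R : X → X → Prop) (f : X → X → ℝ≥0∞) (Z : X → Prop) (x : X) : ℝ≥0∞ :=
  ∑' ρ : {ρ : List X // IsAcceptingChain R Z x ρ}, chainProd f ρ.1

theorem chainSum_eq_one {R : X → X → Prop} {f : X → X → ℝ≥0∞} {Z : X → Prop} {x : X}
    (hZ : Z x) (hR : ∀ y, ¬ R x y) : chainSum R f Z x = 1 := by
  have h : ∀ ρ, IsAcceptingChain R Z x ρ → ρ = [x] := by
    rintro (_ | ⟨a, _ | ⟨b, l⟩⟩) ⟨h1, h2, -⟩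
    · simp at h1
    · simpa using h1
    · simp only [List.head?_cons, Option.some.injEq] at h1
      subst h1
      exact absurd (List.isChain_cons_cons.1 h2).1 (hR b)
  have h' : IsAcceptingChain R Z x [x] := ⟨rfl, by simp, x, rfl, hZ⟩
  unfold chainSum
  rw [tsum_eq_single (⟨[x], h'⟩ : {ρ : List X // IsAcceptingChain R Z x ρ})]
  · simp [chainProd]
  · rintro ⟨ρ, hρ⟩ hne
    exact absurd (Subtype.ext (h ρ hρ)) hne

theorem isAcceptingChain_cons {R : X → X → Prop} {Z : X → Prop} {x : X} (hZ : ¬ Z x)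
    (ρ : List X) : IsAcceptingChain R Z x (x :: ρ) ↔ ∃ y, R x y ∧ IsAcceptingChain R Z y ρ := by
  cases ρ with
  | nil => simp [IsAcceptingChain, hZ]
  | cons a l =>
    simp only [IsAcceptingChain, List.head?_cons, Option.some.injEq, List.isChain_cons_cons,
      List.getLast?_cons_cons, true_and]
    constructor
    · rintro ⟨⟨h1, h2⟩, h3⟩
      exact ⟨a, h1, rfl, h2, h3⟩
    · rintro ⟨y, h1, rfl, h2, h3⟩
      exact ⟨⟨h1, h2⟩, h3⟩

/-- First-step analysis: as `x` does not end an accepting chain, deleting it maps the accepting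
chains from `x` bijectively onto those from its `R`-successors. All sums live in `ℝ≥0∞`, so they may
be interchanged freely. -/
theorem chainSum_step {R : X → X → Prop} {f : X → X → ℝ≥0∞} {Z : X → Prop} {x : X}
    (hZ : ¬ Z x) (hf : ∀ y, ¬ R x y → f x y = 0) :
    chainSum R f Z x = ∑' y, f x y * chainSum R f Z y := by
  classical
  have hs : ∀ y, chainSum R f Z y =
      ∑' ρ : List X, {ρ | IsAcceptingChain R Z y ρ}.indicator (chainProd f) ρ := fun y =>
    tsum_subtype {ρ | IsAcceptingChain R Z y ρ} (chainProd f)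
  simp only [hs, ← ENNReal.tsum_mul_left]
  rw [ENNReal.tsum_comm, ← Function.Injective.tsum_eq (g := fun l : List X => x :: l)
    (fun a b h => (List.cons.inj h).2)]
  · refine tsum_congr fun ρ => ?_
    cases ρ with
    | nil => simp [IsAcceptingChain, hZ]
    | cons a l =>
      rw [tsum_eq_single a]
      · by_cases h : IsAcceptingChain R Z a (a :: l)
        · by_cases hr : R x a
          · have h2 : IsAcceptingChain R Z x (x :: a :: l) :=
              (isAcceptingChain_cons hZ _).2 ⟨a, hr, h⟩
            rw [Set.indicator_of_mem (s := {ρ | IsAcceptingChain R Z x ρ}) h2,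
              Set.indicator_of_mem (s := {ρ | IsAcceptingChain R Z a ρ}) h]
            rfl
          · rw [hf a hr, zero_mul, Set.indicator_of_notMem]
            intro h2
            obtain ⟨y, h3, h4⟩ := (isAcceptingChain_cons hZ _).1 h2
            have : a = y := by simpa using h4.1
            exact hr (this ▸ h3)
        · rw [Set.indicator_of_notMem, Set.indicator_of_notMem, mul_zero]
          · exact h
          · intro h2
            obtain ⟨y, h3, h4⟩ := (isAcceptingChain_cons hZ _).1 h2
            have : a = y := by simpa using h4.1
            exact h (this ▸ h4)
      · intro y hy
        rw [Set.indicator_of_notMem, mul_zero]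
        rintro ⟨h, -⟩
        exact hy (by simpa using h.symm)
  · intro ρ hρ
    have h : IsAcceptingChain R Z x ρ := by
      by_contra h
      exact hρ (Set.indicator_of_notMem (s := {ρ | IsAcceptingChain R Z x ρ}) h _)
    cases ρ with
    | nil => simp [IsAcceptingChain] at h
    | cons a l =>
      have : a = x := by simpa using h.1
      exact ⟨l, by simp [this]⟩

end Chains

/-! ## Uniform choices -/

section Uniform

/-- Write `Fin B` as a product of `Fin s.ncard` with another factor and let the first coordinate
choose; each element is then hit equally often. Test functions `F` express these multiplicities in
the form in which they are used. -/
theorem exists_uniform {α : Type*} (s : Set α) (hs : s.Finite) (hne : s.Nonempty) (B : ℕ)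
    (hd : s.ncard ∣ B) : ∃ g : Fin B → α, (∀ c, g c ∈ s) ∧
      ∀ F : α → ℝ≥0∞, ∑ c, F (g c) = (B / s.ncard : ℕ) * ∑ x ∈ hs.toFinset, F x := by
  classical
  obtain ⟨b, rfl⟩ := hd
  have := hs.fintype
  have hk : 0 < s.ncard := (Set.ncard_pos hs).2 hne
  have e : s ≃ Fin s.ncard := by
    refine Fintype.equivFinOfCardEq ?_
    rw [← Nat.card_eq_fintype_card, Nat.card_coe_set_eq]
  refine ⟨fun c => (e.symm (finProdFinEquiv.symm c).1).1, fun c => Subtype.prop _, fun F => ?_⟩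
  rw [Fintype.sum_equiv finProdFinEquiv.symm _ (fun p => F (e.symm p.1).1) (fun _ => rfl),
    Fintype.sum_prod_type]
  simp only [Finset.sum_const, Finset.card_univ, Fintype.card_fin, nsmul_eq_mul]
  rw [← Finset.mul_sum, Nat.mul_div_cancel_left b hk]
  congr 1
  rw [Fintype.sum_equiv e.symm (fun i => F (e.symm i).1) (fun x : s => F x.1) (fun _ => rfl)]
  rw [← Finset.sum_coe_sort hs.toFinset]
  exact Fintype.sum_equiv (Equiv.subtypeEquivRight (by simp)) _ _ (fun _ => rfl)

open Classical in
/-- A choice function that distributes `Fin B` evenly over the elements of `s`, whenever this is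
possible. -/
noncomputable def pick {α : Type*} (s : Set α) {B : ℕ} : Fin B → Option α :=
  if h : ∃ (hs : s.Finite) (g : Fin B → α), (∀ c, g c ∈ s) ∧
      ∀ F : α → ℝ≥0∞, ∑ c, F (g c) = (B / s.ncard : ℕ) * ∑ x ∈ hs.toFinset, F x
  then fun c => some (h.choose_spec.choose c) else fun _ => none

theorem pick_spec {α : Type*} {s : Set α} (hs : s.Finite) (hne : s.Nonempty) {B : ℕ}
    (hd : s.ncard ∣ B) : ∃ g : Fin B → α, (∀ c, pick s c = some (g c)) ∧ (∀ c, g c ∈ s) ∧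
      ∀ F : α → ℝ≥0∞, ∑ c, F (g c) = (B / s.ncard : ℕ) * ∑ x ∈ hs.toFinset, F x := by
  have h : ∃ (hs : s.Finite) (g : Fin B → α), (∀ c, g c ∈ s) ∧
      ∀ F : α → ℝ≥0∞, ∑ c, F (g c) = (B / s.ncard : ℕ) * ∑ x ∈ hs.toFinset, F x :=
    ⟨hs, exists_uniform s hs hne B hd⟩
  refine ⟨h.choose_spec.choose, fun c => ?_, h.choose_spec.choose_spec.1,
    h.choose_spec.choose_spec.2⟩
  unfold pick
  rw [dif_pos h]

theorem ENNReal.average_eq {ι : Type*} {s : Finset ι} {F : ι → ℝ≥0∞} {B : ℕ} (hB : 0 < B)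
    {x : ℝ≥0∞} (hs : 0 < s.card) (hd : s.card ∣ B) (hx : x = ∑ i ∈ s, (s.card : ℝ≥0∞)⁻¹ * F i) :
    ((B / s.card : ℕ) : ℝ≥0∞) * ∑ i ∈ s, F i = B * x := by
  obtain ⟨b, rfl⟩ := hd
  rw [Nat.mul_div_cancel_left b hs, hx, ← Finset.mul_sum, ← mul_assoc]
  congr 1
  push_cast
  rw [mul_comm (s.card : ℝ≥0∞), mul_assoc, ENNReal.mul_inv_cancel, mul_one]
  · exact_mod_cast hs.ne'
  · exact ENNReal.natCast_ne_top _

end Uniform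

/-! ## Steps of Turing machines -/

/-- The effect of a transition on a configuration. -/
def TMTransition.apply {t u : ℕ} {Q S : Type*} (δ : TMTransition t u Q S) (γ : TMConfig t u Q S) :
    TMConfig t u Q S where
  state := δ.tgt
  pos := fun i => NTM.movePos (δ.move i) (γ.pos i)
  tape := fun i => Function.update (γ.tape i) (γ.pos i) (δ.write i)

namespace NTM

variable {t u : ℕ} {Q S : Type*} (T : NTM t u Q S)

/-- The transitions that are applicable to a configuration. -/
def app (γ : TMConfig t u Q S) : Set (TMTransition t u Q S) :=
  {δ | δ ∈ T.rel ∧ δ.src = γ.state ∧ (∀ i, δ.read i = γ.tape i (γ.pos i)) ∧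
    ∀ i, δ.move i = TMMove.L → γ.pos i ≠ 0}

variable {T}

theorem step_iff {γ γ' : TMConfig t u Q S} : T.Step γ γ' ↔ ∃ δ ∈ T.app γ, γ' = δ.apply γ := by
  constructor
  · rintro ⟨δ, h1, h2, h3, h4, h5⟩
    exact ⟨δ, ⟨h1, h2, h3, h4⟩, h5⟩
  · rintro ⟨δ, ⟨h1, h2, h3, h4⟩, h5⟩
    exact ⟨δ, h1, h2, h3, h4, h5⟩

theorem step_apply {γ : TMConfig t u Q S} {δ : TMTransition t u Q S} (h : δ ∈ T.app γ) :
    T.Step γ (δ.apply γ) :=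
  step_iff.2 ⟨δ, h, rfl⟩

theorem movePos_inj {a b : TMMove} {p : ℕ} (ha : a = TMMove.L → p ≠ 0) (hb : b = TMMove.L → p ≠ 0)
    (h : movePos a p = movePos b p) : a = b := by
  cases a <;> cases b <;> simp [movePos] at * <;> omega

/-- Probabilities are uniform over successor configurations, whereas choices select transitions;
injectivity makes the two counts agree. The written symbol can be read at the old head position, and
the new position reveals the movement because left moves from cell `0` are excluded. -/
theorem apply_injOn (γ : TMConfig t u Q S) :
    Set.InjOn (fun δ : TMTransition t u Q S => δ.apply γ) (T.app γ) := by
  rintro ⟨a1, a2, a3, a4, a5⟩ ha ⟨b1, b2, b3, b4, b5⟩ hb h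
  obtain ⟨-, ha1, ha2, ha3⟩ := ha
  obtain ⟨-, hb1, hb2, hb3⟩ := hb
  simp only [TMTransition.apply, TMConfig.mk.injEq] at h ha1 ha2 ha3 hb1 hb2 hb3
  obtain ⟨h1, h2, h3⟩ := h
  have e1 : a2 = b2 := funext fun i => (ha2 i).trans (hb2 i).symm
  have e2 : a4 = b4 := funext fun i => by
    have := congrFun (congrFun h3 i) (γ.pos i)
    simpa using this
  have e3 : a5 = b5 := funext fun i => movePos_inj (ha3 i) (hb3 i) (congrFun h2 i)
  rw [ha1.trans hb1.symm, e1, h1, e2, e3]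

theorem next_eq_image (γ : TMConfig t u Q S) :
    T.next γ = (fun δ : TMTransition t u Q S => δ.apply γ) '' T.app γ := by
  ext γ'
  simp only [next, Set.mem_ofPred_eq, step_iff, Set.mem_image]
  exact ⟨fun ⟨δ, h, e⟩ => ⟨δ, h, e.symm⟩, fun ⟨δ, h, e⟩ => ⟨δ, h, e.symm⟩⟩

theorem next_eq_empty_iff (γ : TMConfig t u Q S) : T.next γ = ∅ ↔ T.app γ = ∅ := by
  rw [next_eq_image, Set.image_eq_empty]

theorem ncard_next (γ : TMConfig t u Q S) : (T.next γ).ncard = (T.app γ).ncard := by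
  rw [next_eq_image, (apply_injOn γ).ncard_image]

theorem finite_rel (T : NTM t u Q S) : T.rel.Finite := by
  have := T.finite_states
  have := T.finite_alphabet
  have : Finite TMMove := Finite.of_injective
    (fun a : TMMove => match a with
      | TMMove.L => (0 : Fin 3)
      | TMMove.N => 1
      | TMMove.R => 2) (by intro a b; cases a <;> cases b <;> simp)
  have : Finite (TMTransition t u Q S) := Finite.of_injective
    (fun δ : TMTransition t u Q S => (δ.src, δ.read, δ.tgt, δ.write, δ.move)) (by
      rintro ⟨⟩ ⟨⟩ h
      simpa using h)
  exact Set.toFinite _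

theorem app_subset (γ : TMConfig t u Q S) : T.app γ ⊆ T.rel := fun _ h => h.1

theorem finite_app (γ : TMConfig t u Q S) : (T.app γ).Finite :=
  T.finite_rel.subset (app_subset γ)

/-! ### Acceptance probabilities of Turing machines. -/

/-- The probability that a run from `γ` is accepting. -/
noncomputable def acceptFrom (T : NTM t u Q S) (γ : TMConfig t u Q S) : ℝ≥0∞ :=
  chainSum T.Step T.stepProb (fun γ => T.next γ = ∅ ∧ γ.state ∈ T.acc) γ

theorem acceptProb_eq (w : List S) : T.acceptProb w = T.acceptFrom (T.init w) := by
  unfold acceptProb acceptFrom chainSum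
  have : ∀ ρ, T.IsAcceptingRun w ρ ↔
      IsAcceptingChain T.Step (fun γ => T.next γ = ∅ ∧ γ.state ∈ T.acc) (T.init w) ρ := by
    intro ρ
    constructor
    · rintro ⟨⟨h1, h2, γ, h3, h4⟩, γ', h5, h6⟩
      rw [h3] at h5
      cases h5
      exact ⟨h1, h2, γ, h3, h4, h6⟩
    · rintro ⟨h1, h2, γ, h3, h4, h6⟩
      exact ⟨⟨h1, h2, γ, h3, h4⟩, γ, h3, h6⟩
  exact (Equiv.subtypeEquivRight this).tsum_eq (fun ρ => chainProd T.stepProb ρ.1)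

open Classical in
theorem acceptFrom_of_app_eq_empty {γ : TMConfig t u Q S} (h : T.app γ = ∅) :
    T.acceptFrom γ = if γ.state ∈ T.acc then 1 else 0 := by
  have hn := (next_eq_empty_iff γ).2 h
  have hR : ∀ y, ¬ T.Step γ y := fun y hy => by
    have : y ∈ T.next γ := hy
    simp [hn] at this
  split_ifs with ha
  · exact chainSum_eq_one ⟨hn, ha⟩ hR
  · unfold acceptFrom
    rw [chainSum_step (by simp [ha])]
    · simp [stepProb, hn]
    · intro y _
      simp [stepProb, hn]

/-- The first-step equation, averaged over `Fin B` instead of over the successors: divisibility lets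
`pick` hit each applicable transition equally often. -/
theorem sum_acceptFrom {γ : TMConfig t u Q S} (h : (T.app γ).Nonempty) {B : ℕ} (hB : 0 < B)
    (hd : (T.app γ).ncard ∣ B) : ∃ g : Fin B → TMTransition t u Q S,
      (∀ c, pick (T.app γ) c = some (g c)) ∧ (∀ c, g c ∈ T.app γ) ∧
      ∑ c, T.acceptFrom ((g c).apply γ) = B * T.acceptFrom γ := by
  classical
  obtain ⟨g, h1, h2, h3⟩ := pick_spec (finite_app γ) h hd
  refine ⟨g, h1, h2, ?_⟩
  rw [h3 (fun δ => T.acceptFrom (δ.apply γ))]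
  have hcard : (finite_app (T := T) γ).toFinset.card = (T.app γ).ncard :=
    (Set.ncard_eq_toFinset_card _ _).symm
  rw [← hcard] at hd ⊢
  refine ENNReal.average_eq hB ?_ hd ?_
  · rw [hcard]
    exact (Set.ncard_pos (finite_app γ)).2 h
  · unfold acceptFrom
    rw [chainSum_step]
    · have e : ∀ γ' : TMConfig t u Q S, T.stepProb γ γ' * T.acceptFrom γ' = (T.next γ).indicator
          (fun γ' => ((finite_app (T := T) γ).toFinset.card : ℝ≥0∞)⁻¹ * T.acceptFrom γ') γ' := by
        intro γ'
        unfold stepProb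
        rw [ncard_next, hcard]
        by_cases h : γ' ∈ T.next γ
        · simp [h]
        · simp [h]
      change ∑' γ', T.stepProb γ γ' * T.acceptFrom γ' = _
      simp only [e]
      rw [← tsum_subtype, ← Finset.tsum_subtype', next_eq_image]
      rw [tsum_image (fun γ' => ((finite_app (T := T) γ).toFinset.card : ℝ≥0∞)⁻¹ * T.acceptFrom γ')
        (apply_injOn γ)]
      exact ((Equiv.subtypeEquivRight (by simp)).tsum_eq
        (fun δ : T.app γ => ((finite_app (T := T) γ).toFinset.card : ℝ≥0∞)⁻¹ *
          T.acceptFrom (δ.1.apply γ))).symm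
    · rintro ⟨h0, -⟩
      rw [next_eq_empty_iff] at h0
      simp [h0] at h
    · intro y hy
      have : y ∉ T.next γ := hy
      simp [stepProb, this]

end NTM

/-! ## Acceptance probabilities of list machines -/

namespace NLM

variable {t m : ℕ} {I C A : Type*} {M : NLM t m I C A}

/-- The probability that a run from `γ` is accepting. -/
noncomputable def acceptFrom (M : NLM t m I C A) (γ : LMConfig t I C A) : ℝ≥0∞ :=
  chainSum M.Step M.stepProb (fun γ => γ.state ∈ M.acc) γ

theorem acceptProb_eq (v : Fin m → I) : M.acceptProb v = M.acceptFrom (M.init v) := by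
  unfold acceptProb acceptFrom chainSum
  have : ∀ ρ, M.IsAcceptingRun v ρ ↔
      IsAcceptingChain M.Step (fun γ => γ.state ∈ M.acc) (M.init v) ρ := by
    intro ρ
    constructor
    · rintro ⟨⟨h1, h2, -⟩, h⟩
      exact ⟨h1, h2, h⟩
    · rintro ⟨h1, h2, γ, h3, h6⟩
      exact ⟨⟨h1, h2, γ, h3, M.acc_subset h6⟩, γ, h3, h6⟩
  exact (Equiv.subtypeEquivRight this).tsum_eq (fun ρ => chainProd M.stepProb ρ.1)

open Classical in
theorem acceptFrom_of_final {γ : LMConfig t I C A} (h : γ.state ∈ M.final) :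
    M.acceptFrom γ = if γ.state ∈ M.acc then 1 else 0 := by
  have hR : ∀ y, ¬ M.Step γ y := fun y ⟨c, h', _⟩ => h' h
  split_ifs with ha
  · exact chainSum_eq_one ha hR
  · unfold acceptFrom
    have : ∀ y, M.stepProb γ y = 0 := fun y => by
      have : {c : C | M.IsSucc c γ y} = ∅ := by
        ext c
        simp only [Set.mem_ofPred_eq, Set.mem_empty_iff_false, iff_false]
        rintro ⟨h', _⟩
        exact h' h
      simp [stepProb, this]
    rw [chainSum_step (Z := fun γ : LMConfig t I C A => γ.state ∈ M.acc) ha (fun y _ => this y)]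
    simp [this]

/-- Several choices may lead to the same successor. The step probability counts them, so the sum
over successors regroups into a sum over choices. -/
theorem sum_acceptFrom [Fintype C] {γ : LMConfig t I C A} (h : γ.state ∉ M.final) :
    ∑ c : C, M.acceptFrom (M.succ γ h c) = Fintype.card C * M.acceptFrom γ := by
  classical
  have hC : Nonempty C := M.nonempty_choices
  have e : M.acceptFrom γ = ∑' γ', M.stepProb γ γ' * M.acceptFrom γ' := by
    unfold acceptFrom
    refine chainSum_step (fun ha => h (M.acc_subset ha)) fun y hy => ?_
    have : {c : C | M.IsSucc c γ y} = ∅ := by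
      ext c
      simp only [Set.mem_ofPred_eq, Set.mem_empty_iff_false, iff_false]
      exact fun hc => hy ⟨c, hc⟩
    simp [stepProb, this]
  have e2 : ∀ γ', M.stepProb γ γ' * M.acceptFrom γ' = (Fintype.card C : ℝ≥0∞)⁻¹ *
      ∑ c : C, if γ' = M.succ γ h c then M.acceptFrom (M.succ γ h c) else 0 := by
    intro γ'
    have hc : ({c : C | M.IsSucc c γ γ'}.ncard : ℝ≥0∞) * M.acceptFrom γ' =
        ∑ c : C, if γ' = M.succ γ h c then M.acceptFrom (M.succ γ h c) else 0 := by
      have : {c : C | M.IsSucc c γ γ'} =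
          ((Finset.univ.filter fun c : C => γ' = M.succ γ h c : Finset C) : Set C) := by
        ext c
        simp only [Set.mem_ofPred_eq, Finset.coe_filter, Finset.mem_univ, true_and]
        exact ⟨fun ⟨_, e⟩ => e, fun e => ⟨h, e⟩⟩
      rw [this, Set.ncard_coe_finset, ← Finset.sum_filter, ← nsmul_eq_mul, ← Finset.sum_const]
      refine Finset.sum_congr rfl fun c hc => ?_
      rw [← (Finset.mem_filter.1 hc).2]
    rw [← hc, stepProb, Nat.card_eq_fintype_card, ENNReal.div_eq_inv_mul, mul_assoc]
  rw [e]
  simp only [e2]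
  rw [ENNReal.tsum_mul_left, ← mul_assoc, ENNReal.mul_inv_cancel, one_mul,
    Summable.tsum_finsetSum (fun _ _ => ENNReal.summable)]
  · refine Finset.sum_congr rfl fun c _ => ?_
    rw [tsum_eq_single (M.succ γ h c)]
    · simp
    · intro y hy
      simp [hy]
  · exact_mod_cast Fintype.card_ne_zero
  · exact ENNReal.natCast_ne_top _

end NLM

/-! ## Reachable configurations -/

section Lists

theorem changeCount_concat {α : Type*} [DecidableEq α] (l : List α) (a b : α) :
    changeCount (l ++ [a] ++ [b]) = changeCount (l ++ [a]) + if a ≠ b then 1 else 0 := by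
  induction l with
  | nil => simp [changeCount]
  | cons x l ih =>
    cases l with
    | nil => simp [changeCount]
    | cons y l =>
      simp only [List.cons_append, changeCount] at ih ⊢
      rw [ih, add_assoc]

theorem changeCount_le_append {α : Type*} [DecidableEq α] (l l' : List α) :
    changeCount l ≤ changeCount (l ++ l') := by
  induction l with
  | nil => simp [changeCount]
  | cons x l ih =>
    cases l with
    | nil => simp [changeCount]
    | cons y l =>
      simp only [List.cons_append, changeCount] at ih ⊢
      omega

theorem zipWith_tail_concat {α β : Type*} (f : α → α → β) (l : List α) {a : α} (b : α)
    (h : l.getLast? = some a) :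
    List.zipWith f (l ++ [b]) (l ++ [b]).tail = List.zipWith f l l.tail ++ [f a b] := by
  induction l with
  | nil => simp at h
  | cons x l ih =>
    cases l with
    | nil =>
      simp only [List.getLast?_singleton, Option.some.injEq] at h
      simp [h]
    | cons y l =>
      rw [List.getLast?_cons_cons] at h
      have := ih h
      simp only [List.cons_append, List.tail_cons, List.zipWith_cons_cons] at this ⊢
      rw [this]

end Lists

/-- The head direction after a movement. -/
def TMMove.newDir : TMMove → HeadDir → HeadDir
  | TMMove.L, _ => HeadDir.left
  | TMMove.N, d => d
  | TMMove.R, _ => HeadDir.right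

/-- The sign of a head direction. -/
def HeadDir.sign : HeadDir → ℤ
  | HeadDir.left => -1
  | HeadDir.right => 1

theorem HeadDir.sign_inj {a b : HeadDir} : a.sign = b.sign ↔ a = b := by
  cases a <;> cases b <;> simp [HeadDir.sign]

namespace NTM

variable {t u : ℕ} {Q S : Type*} {T : NTM t u Q S}

/-- `γ` is reached on `w` in `τ` steps; `d i` is the current direction of the `i`-th external head
and `κ i` is the number of its direction changes. -/
inductive Reach (T : NTM t u Q S) (w : List S) :
    ℕ → TMConfig t u Q S → (Fin t → HeadDir) → (Fin t → ℕ) → Prop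
  | init : Reach T w 0 (T.init w) (fun _ => HeadDir.right) (fun _ => 0)
  | step {τ : ℕ} {γ : TMConfig t u Q S} {d : Fin t → HeadDir} {κ : Fin t → ℕ}
      {δ : TMTransition t u Q S} : Reach T w τ γ d κ → δ ∈ T.app γ →
      Reach T w (τ + 1) (δ.apply γ) (fun i => (δ.move (Sum.inl i)).newDir (d i))
        (fun i => κ i + if (δ.move (Sum.inl i)).newDir (d i) ≠ d i then 1 else 0)

theorem headMoves_concat {ρ : List (TMConfig t u Q S)} {γ γ' : TMConfig t u Q S}
    (h : ρ.getLast? = some γ) (i : Tape t u) :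
    headMoves (ρ ++ [γ']) i = headMoves ρ i ++
      [(γ'.pos i : ℤ) - (γ.pos i : ℤ)].filter (fun z => z ≠ 0) := by
  unfold headMoves
  rw [zipWith_tail_concat _ _ _ h, List.filter_append]

theorem rev_le_append (ρ ρ' : List (TMConfig t u Q S)) (i : Tape t u) :
    rev ρ i ≤ rev (ρ ++ ρ') i := by
  induction ρ' using List.reverseRecOn with
  | nil => simp
  | append_singleton l a ih =>
    rw [← List.append_assoc]
    refine ih.trans ?_
    cases h : (ρ ++ l).getLast? with
    | none =>
      rw [List.getLast?_eq_none_iff] at h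
      simp [h, rev, headMoves, changeCount]
    | some γ =>
      unfold rev
      rw [headMoves_concat h]
      exact changeCount_le_append _ _

theorem space_le_append (ρ ρ' : List (TMConfig t u Q S)) (i : Tape t u) :
    space ρ i ≤ space (ρ ++ ρ') i := by
  unfold space
  refine Finset.card_le_card fun x hx => ?_
  simp only [List.map_append, List.toFinset_append, Finset.mem_union]
  exact Or.inl hx

theorem movePos_sub {a : TMMove} {p : ℕ} (h : a = TMMove.L → p ≠ 0) (d : HeadDir) :
    [((movePos a p : ℕ) : ℤ) - (p : ℤ)].filter (fun z => z ≠ 0) =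
      if a = TMMove.N then [] else [(a.newDir d).sign] := by
  cases a
  · have : p ≠ 0 := h rfl
    obtain ⟨q, rfl⟩ := Nat.exists_eq_succ_of_ne_zero this
    simp [movePos, TMMove.newDir, HeadDir.sign]
  · simp [movePos]
  · simp [movePos, TMMove.newDir, HeadDir.sign]

/-- This ties the step-by-step bookkeeping of `Reach` to `rev` and `space`, which are defined on
whole chains. Heads move by at most one cell, so every position up to the current one has been
visited. -/
theorem Reach.exists_chain {w : List S} {τ : ℕ} {γ : TMConfig t u Q S} {d : Fin t → HeadDir}
    {κ : Fin t → ℕ} (h : T.Reach w τ γ d κ) : ∃ ρ : List (TMConfig t u Q S),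
      ρ.head? = some (T.init w) ∧ ρ.IsChain T.Step ∧ ρ.getLast? = some γ ∧ ρ.length = τ + 1 ∧
      (∀ i, rev ρ (Sum.inl i) = κ i ∧
        ((headMoves ρ (Sum.inl i) = [] ∧ d i = HeadDir.right ∧ γ.pos (Sum.inl i) = 0) ∨
        ∃ l, headMoves ρ (Sum.inl i) = l ++ [(d i).sign])) ∧
      ∀ i, ∀ p ≤ γ.pos i, p ∈ ρ.map (fun γ => γ.pos i) := by
  induction h with
  | init =>
    refine ⟨[T.init w], rfl, by simp, rfl, rfl, fun i => ⟨by simp [rev, headMoves, changeCount],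
      Or.inl ⟨by simp [headMoves], rfl, rfl⟩⟩, fun i p hp => ?_⟩
    have : p = 0 := by simpa [NTM.init] using hp
    simp [this, NTM.init]
  | @step τ γ d κ δ h hδ ih =>
    obtain ⟨ρ, h1, h2, h3, h4, h5, h6⟩ := ih
    have hne : ρ ≠ [] := by rintro rfl; simp at h1
    refine ⟨ρ ++ [δ.apply γ], ?_, ?_, by simp, by simp [h4], fun i => ?_, fun i p hp => ?_⟩
    · cases ρ with
      | nil => simp at h1
      | cons => simpa using h1
    · refine List.isChain_append.2 ⟨h2, by simp, ?_⟩
      intro x hx y hy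
      rw [h3] at hx
      simp only [Option.mem_def, Option.some.injEq, List.head?_cons] at hx hy
      subst hx hy
      exact step_apply hδ
    · obtain ⟨h7, h8⟩ := h5 i
      unfold rev at h7 ⊢
      have e : headMoves (ρ ++ [δ.apply γ]) (Sum.inl i) = headMoves ρ (Sum.inl i) ++
          if δ.move (Sum.inl i) = TMMove.N then []
          else [((δ.move (Sum.inl i)).newDir (d i)).sign] := by
        rw [headMoves_concat h3]
        congr 1
        exact movePos_sub (hδ.2.2.2 _) _
      rw [e]
      by_cases hN : δ.move (Sum.inl i) = TMMove.N
      · simp only [hN, TMMove.newDir, if_true, List.append_nil, ne_eq, not_true_eq_false, if_false,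
          add_zero]
        refine ⟨h7, ?_⟩
        simpa [TMTransition.apply, hN, movePos] using h8
      · rw [if_neg hN]
        refine ⟨?_, Or.inr ⟨_, rfl⟩⟩
        rcases h8 with ⟨h8, h9, h10⟩ | ⟨l, h8⟩
        · rw [h8] at h7 ⊢
          -- The head has not moved before and stands on cell `0`, so its first movement goes right.
          -- The conventional initial direction therefore costs no extra direction change.
          have hR : δ.move (Sum.inl i) = TMMove.R := by
            cases hm : δ.move (Sum.inl i)
            · exact absurd h10 (hδ.2.2.2 _ hm)
            · exact absurd hm hN
            · rfl
          simp only [← h7]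
          simp [hR, TMMove.newDir, h9, changeCount]
        · rw [h8] at h7 ⊢
          rw [changeCount_concat, h7]
          simp only [ne_eq, HeadDir.sign_inj]
          simp only [eq_comm]
    · have hlast : γ.pos i ≤ γ.pos i → γ.pos i ∈ ρ.map (fun γ => γ.pos i) := h6 i _
      rw [List.map_append, List.mem_append]
      by_cases hpγ : p ≤ γ.pos i
      · exact Or.inl (h6 i p hpγ)
      · right
        have : p = (δ.apply γ).pos i := by
          have h9 : (δ.apply γ).pos i ≤ γ.pos i + 1 := by
            simp only [TMTransition.apply]
            cases δ.move i <;> (simp [movePos]; try omega)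
          omega
        simp [this]

/-- The bounds on `T` concern complete runs only; well-foundedness extends every chain to one. -/
theorem exists_isRun_append {w : List S} {γ : TMConfig t u Q S}
    (hacc : Acc (fun a b => T.Step b a) γ) : ∀ ρ : List (TMConfig t u Q S),
      ρ.head? = some (T.init w) → ρ.IsChain T.Step → ρ.getLast? = some γ →
      ∃ ρ', T.IsRun w (ρ ++ ρ') := by
  induction hacc with
  | intro γ _ ih =>
    intro ρ h1 h2 h3
    rcases Set.eq_empty_or_nonempty (T.next γ) with h | ⟨γ', h⟩
    · exact ⟨[], by simpa using ⟨h1, h2, γ, h3, h⟩⟩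
    · obtain ⟨ρ', h'⟩ := ih γ' h (ρ ++ [γ']) (by cases ρ <;> simp_all) (by
        refine List.isChain_append.2 ⟨h2, by simp, ?_⟩
        intro x hx y hy
        rw [h3] at hx
        simp only [Option.mem_def, Option.some.injEq, List.head?_cons] at hx hy
        subst hx hy
        exact h) (by simp)
      exact ⟨γ' :: ρ', by simpa using h'⟩

theorem acc_init {w : List S} (h : ¬ T.HasInfiniteRun w) :
    Acc (fun a b => T.Step b a) (T.init w) := by
  by_contra hacc
  obtain ⟨f, hf⟩ := not_acc_iff_exists_descending_chain.1 hacc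
  exact h ⟨f, hf⟩

theorem Reach.acc {w : List S} {τ : ℕ} {γ : TMConfig t u Q S} {d : Fin t → HeadDir}
    {κ : Fin t → ℕ} (h : T.Reach w τ γ d κ) (hw : ¬ T.HasInfiniteRun w) :
    Acc (fun a b => T.Step b a) γ := by
  induction h with
  | init => exact acc_init hw
  | step _ hδ ih => exact ih.inv (step_apply hδ)

/-- Every reachable configuration lies on a run. -/
theorem Reach.exists_isRun {w : List S} {τ : ℕ} {γ : TMConfig t u Q S} {d : Fin t → HeadDir}
    {κ : Fin t → ℕ} (h : T.Reach w τ γ d κ) (hw : ¬ T.HasInfiniteRun w) :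
    ∃ ρ, T.IsRun w ρ ∧ τ + 1 ≤ ρ.length ∧ (∀ i, κ i ≤ rev ρ (Sum.inl i)) ∧
      ∀ i, γ.pos i + 1 ≤ space ρ i := by
  obtain ⟨ρ, h1, h2, h3, h4, h5, h6⟩ := h.exists_chain
  obtain ⟨ρ', h'⟩ := exists_isRun_append (h.acc hw) ρ h1 h2 h3
  refine ⟨ρ ++ ρ', h', by simp [← h4], fun i => ?_, fun i => ?_⟩
  · rw [← (h5 i).1]
    exact rev_le_append _ _ _
  · refine le_trans ?_ (space_le_append ρ ρ' i)
    unfold space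
    rw [← Finset.card_range (γ.pos i + 1)]
    refine Finset.card_le_card fun p hp => ?_
    rw [List.mem_toFinset]
    exact h6 i p (by simpa [Nat.lt_succ_iff] using hp)

/-! ### Consequences of boundedness for reachable configurations. -/

section Bounded

variable {r s : ℕ → ℕ} {w : List S} {τ : ℕ} {γ : TMConfig t u Q S} {d : Fin t → HeadDir}
  {κ : Fin t → ℕ}

theorem Reach.sum_le (h : T.Reach w τ γ d κ) (hT : T.IsBounded r s) (hw : T.IsInput w) :
    1 + ∑ i, κ i ≤ r w.length := by
  obtain ⟨ρ, h1, -, h2, -⟩ := h.exists_isRun (hT w hw).1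
  refine le_trans ?_ ((hT w hw).2 ρ h1).1
  gcongr with i
  exact h2 i

theorem Reach.pos_lt (h : T.Reach w τ γ d κ) (hT : T.IsBounded r s) (hw : T.IsInput w)
    (j : Fin u) : γ.pos (Sum.inr j) < s w.length := by
  obtain ⟨ρ, h1, -, -, h2⟩ := h.exists_isRun (hT w hw).1
  refine lt_of_lt_of_le (Nat.lt_of_succ_le (h2 (Sum.inr j))) (le_trans ?_ ((hT w hw).2 ρ h1).2)
  exact Finset.single_le_sum (f := fun j => space ρ (Sum.inr j)) (fun _ _ => Nat.zero_le _)
    (Finset.mem_univ j)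

theorem Reach.tape_eq_blank (h : T.Reach w τ γ d κ) (hT : T.IsBounded r s) (hw : T.IsInput w)
    (j : Fin u) {k : ℕ} (hk : s w.length ≤ k) : γ.tape (Sum.inr j) k = T.blank := by
  induction h with
  | init => rfl
  | step h' hδ ih =>
    have := h'.pos_lt hT hw j
    simp only [TMTransition.apply]
    rw [Function.update_of_ne (by omega)]
    exact ih

theorem Reach.pos_le (h : T.Reach w τ γ d κ) (i : Tape t u) : γ.pos i ≤ τ := by
  induction h with
  | init => rfl
  | @step _ _ _ _ δ h' hδ ih =>
    simp only [TMTransition.apply]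
    cases δ.move i <;> simp [movePos] <;> omega

end Bounded

end NTM

/-! ## The length of runs -/

namespace NTM

variable {t u : ℕ} {Q S : Type*} {T : NTM t u Q S}

/-- All cells of the `i`-th external tape to the right of the head are blank. -/
def BlankRight (T : NTM t u Q S) (γ : TMConfig t u Q S) (i : Fin t) : Prop :=
  ∀ k, γ.pos (Sum.inl i) < k → γ.tape (Sum.inl i) k = T.blank

/-- Steps in which external heads move only to the right, and only within blank areas. -/
def BlankStep (T : NTM t u Q S) (γ γ' : TMConfig t u Q S) : Prop :=
  ∃ δ ∈ T.app γ, γ' = δ.apply γ ∧ ∀ i, δ.move (Sum.inl i) = TMMove.N ∨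
    (δ.move (Sum.inl i) = TMMove.R ∧ T.BlankRight γ i)

/-- `γ` and `γ'` agree in everything but the external memory beyond the scanned cells. -/
structure LocalEq (γ γ' : TMConfig t u Q S) : Prop where
  state : γ.state = γ'.state
  pos : ∀ j, γ.pos (Sum.inr j) = γ'.pos (Sum.inr j)
  tape : ∀ j, γ.tape (Sum.inr j) = γ'.tape (Sum.inr j)
  scanned : ∀ i, γ.tape (Sum.inl i) (γ.pos (Sum.inl i)) = γ'.tape (Sum.inl i) (γ'.pos (Sum.inl i))

theorem BlankStep.step {γ γ' : TMConfig t u Q S} (h : T.BlankStep γ γ') : T.Step γ γ' := by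
  obtain ⟨δ, hδ, rfl, -⟩ := h
  exact step_apply hδ

theorem BlankStep.blankRight {γ γ' : TMConfig t u Q S} (h : T.BlankStep γ γ') {i : Fin t}
    (hi : T.BlankRight γ i) : T.BlankRight γ' i := by
  obtain ⟨δ, hδ, rfl, h⟩ := h
  intro k hk
  rcases h i with h | ⟨h, -⟩ <;>
  · simp only [TMTransition.apply, h, movePos] at hk ⊢
    rw [Function.update_of_ne (by omega)]
    exact hi k (by omega)

/-- A blank step depends on local data only. An external head that rests sees the symbol just
written, and one that moves right sees a blank in both configurations; no external head moves left,
so its position is irrelevant to applicability. -/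
theorem BlankStep.simulate {γ γ₁ γ' : TMConfig t u Q S} (h : T.BlankStep γ γ₁)
    (he : LocalEq γ γ') (hb : ∀ i, T.BlankRight γ i → T.BlankRight γ' i) :
    ∃ γ₁', T.BlankStep γ' γ₁' ∧ LocalEq γ₁ γ₁' ∧
      ∀ i, T.BlankRight γ₁ i → T.BlankRight γ₁' i := by
  obtain ⟨δ, hδ, rfl, h⟩ := h
  obtain ⟨h1, h2, h3, h4⟩ := hδ
  have hδ' : δ ∈ T.app γ' := by
    refine ⟨h1, h2.trans he.state, ?_, ?_⟩
    · rintro (i | j)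
      · exact (h3 _).trans (he.scanned i)
      · rw [← he.tape, ← he.pos]
        exact h3 _
    · rintro (i | j) hi
      · rcases h i with h | ⟨h, -⟩ <;> simp [h] at hi
      · rw [← he.pos]
        exact h4 _ hi
  refine ⟨δ.apply γ', ⟨δ, hδ', rfl, fun i => (h i).imp_right fun h' => ⟨h'.1, hb i h'.2⟩⟩,
    ⟨rfl, ?_, ?_, ?_⟩, ?_⟩
  · intro j
    simp only [TMTransition.apply, he.pos]
  · intro j
    simp only [TMTransition.apply, he.pos, he.tape]
  · intro i
    rcases h i with h | ⟨h, h'⟩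
    · simp [TMTransition.apply, h, movePos]
    · simp [TMTransition.apply, h, movePos, h' _ (Nat.lt_succ_self _),
        hb i h' _ (Nat.lt_succ_self _)]
  · intro i hi k hk
    have hi' : T.BlankRight γ' i := by
      rcases h i with h | ⟨h, h'⟩
      · refine hb i fun k hk => ?_
        have := hi k (by simpa [TMTransition.apply, h, movePos] using hk)
        simp only [TMTransition.apply] at this
        rwa [Function.update_of_ne hk.ne'] at this
      · exact hb i h'
    exact BlankStep.blankRight ⟨δ, hδ', rfl,
      fun i => (h i).imp_right fun h' => ⟨h'.1, hb i h'.2⟩⟩ hi' k hk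

theorem simulate_transGen {γ γ₁ γ' : TMConfig t u Q S} (h : Relation.TransGen T.BlankStep γ γ₁)
    (he : LocalEq γ γ') (hb : ∀ i, T.BlankRight γ i → T.BlankRight γ' i) :
    ∃ γ₁', Relation.TransGen T.BlankStep γ' γ₁' ∧ LocalEq γ₁ γ₁' ∧
      ∀ i, T.BlankRight γ₁ i → T.BlankRight γ₁' i := by
  induction h with
  | single h =>
    obtain ⟨γ₁', h1, h2, h3⟩ := h.simulate he hb
    exact ⟨γ₁', .single h1, h2, h3⟩
  | tail _ h ih =>
    obtain ⟨γ₁', h1, h2, h3⟩ := ih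
    obtain ⟨γ₂', h4, h5, h6⟩ := h.simulate h2 h3
    exact ⟨γ₂', h1.tail h4, h5, h6⟩

/-- A repetition of a local configuration leads to an infinite run. -/
theorem not_localEq_of_acc {γ γ' : TMConfig t u Q S} (hacc : Acc (fun a b => T.Step b a) γ)
    (h : Relation.TransGen T.BlankStep γ γ') : ¬ LocalEq γ γ' := by
  have hb : ∀ i, T.BlankRight γ i → T.BlankRight γ' i := by
    intro i hi
    induction h with
    | single h => exact h.blankRight hi
    | tail _ h ih => exact h.blankRight ih
  have key : ∀ γ, Acc (Relation.TransGen (fun a b => T.Step b a)) γ → ∀ γ',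
      Relation.TransGen T.BlankStep γ γ' → (∀ i, T.BlankRight γ i → T.BlankRight γ' i) →
      ¬ LocalEq γ γ' := by
    intro γ hacc
    induction hacc with
    | intro γ _ ih =>
      intro γ' h hb he
      -- The loop from `γ` to `γ'` can be repeated from `γ'`, which is a proper descendant of `γ`;
      -- well-founded induction excludes this.
      obtain ⟨γ'', h1, h2, h3⟩ := simulate_transGen h he hb
      refine ih γ' ?_ γ'' h1 h3 h2
      exact Relation.transGen_swap.2 (Relation.TransGen.lift id (fun _ _ h => BlankStep.step h) _ _ h)
  exact key γ hacc.transGen γ' h hb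

/-! ### The potential argument for the run length. -/

/-- The local part of a configuration whose internal heads are on the first `s` cells. -/
def localKey (s : ℕ) [NeZero s] (γ : TMConfig t u Q S) :
    Q × (Fin u → Fin s) × (Fin u → Fin s → S) × (Fin t → S) :=
  (γ.state, fun j => Fin.ofNat s (γ.pos (Sum.inr j)), fun j k => γ.tape (Sum.inr j) k,
    fun i => γ.tape (Sum.inl i) (γ.pos (Sum.inl i)))

/-- The truncation in `localKey` loses nothing: on reachable configurations the internal heads stay
on the first `s w.length` cells and the rest of the internal tapes is blank. -/
theorem Reach.localEq {r s : ℕ → ℕ} {w : List S} [NeZero (s w.length)] {τ τ' : ℕ}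
    {γ γ' : TMConfig t u Q S}
    {d d' : Fin t → HeadDir} {κ κ' : Fin t → ℕ} (hT : T.IsBounded r s) (hw : T.IsInput w)
    (h : T.Reach w τ γ d κ) (h' : T.Reach w τ' γ' d' κ')
    (he : localKey (s w.length) γ = localKey (s w.length) γ') : LocalEq γ γ' := by
  simp only [localKey, Prod.mk.injEq] at he
  obtain ⟨h1, h2, h3, h4⟩ := he
  refine ⟨h1, fun j => ?_, fun j => funext fun k => ?_, fun i => congrFun h4 i⟩
  · have := congrArg Fin.val (congrFun h2 j)
    simpa [Fin.ofNat, Nat.mod_eq_of_lt (h.pos_lt hT hw j),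
      Nat.mod_eq_of_lt (h'.pos_lt hT hw j)] using this
  · by_cases hk : k < s w.length
    · exact congrFun (congrFun h3 j) ⟨k, hk⟩
    · rw [h.tape_eq_blank hT hw j (not_lt.1 hk), h'.tape_eq_blank hT hw j (not_lt.1 hk)]

/-- The number of steps the head can still move in its direction within the first `x` cells. -/
def headroom (x p : ℕ) : HeadDir → ℕ
  | HeadDir.right => x - 1 - p
  | HeadDir.left => p

/-- `X i` delimits the explored part of tape `i`, and `K` collects local keys of earlier
configurations from which blank steps lead to the present one. Without a turn the left side of the
last inequality does not increase: either `K` gains a key, or `K` is restarted at the expense of one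
unit of headroom, which is worth `W`. A turn may restore the headroom up to `∑ i, X i`, and the
additional factor `2 * W + 3` pays for that. -/
theorem Reach.potential {r s : ℕ → ℕ} {w : List S} [NeZero (s w.length)] [Fintype Q] [Fintype S]
    {τ : ℕ} {γ : TMConfig t u Q S} {d : Fin t → HeadDir} {κ : Fin t → ℕ}
    (hT : T.IsBounded r s) (hw : T.IsInput w) (h : T.Reach w τ γ d κ) {W : ℕ}
    (hW : W = Fintype.card (Q × (Fin u → Fin (s w.length)) × (Fin u → Fin (s w.length) → S) ×
      (Fin t → S))) :
    ∃ (X : Fin t → ℕ) (K : Finset (Q × (Fin u → Fin (s w.length)) ×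
        (Fin u → Fin (s w.length) → S) × (Fin t → S))),
      (∀ i, γ.pos (Sum.inl i) < X i) ∧ (∀ i, ∀ k, X i ≤ k → γ.tape (Sum.inl i) k = T.blank) ∧
      ∑ i, X i ≤ w.length + t + τ ∧ localKey (s w.length) γ ∈ K ∧
      (∀ x ∈ K, ∃ τ' γ' d' κ', T.Reach w τ' γ' d' κ' ∧ localKey (s w.length) γ' = x ∧
        Relation.ReflTransGen T.BlankStep γ' γ) ∧
      τ + (∑ i, headroom (X i) (γ.pos (Sum.inl i)) (d i)) * W + (W - K.card) + 1 ≤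
        (w.length + t + 1) * (2 * W + 3) ^ (∑ i, κ i + 1) := by
  classical
  induction h with
  | init =>
    refine ⟨fun i => (if i.val = 0 then w.length else 0) + 1, {localKey _ (T.init w)}, fun i => ?_,
      fun i k hk => ?_, ?_, by simp, ?_, ?_⟩
    · simp [NTM.init]
    · simp only [NTM.init]
      split_ifs with hi
      · simp only [if_pos hi] at hk
        rw [List.getD_eq_default _ _ (by omega)]
      · rfl
    · rw [Finset.sum_add_distrib]
      have : ∑ i : Fin t, (if i.val = 0 then w.length else 0) ≤ w.length := by
        rcases t with _ | t
        · simp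
        · rw [Finset.sum_eq_single 0]
          · simp
          · intro i _ hi
            rw [if_neg]
            intro h
            exact hi (Fin.ext h)
          · simp
      simp only [Finset.sum_const, Finset.card_univ, Fintype.card_fin, smul_eq_mul, mul_one]
      omega
    · intro x hx
      rw [Finset.mem_singleton] at hx
      exact ⟨0, _, _, _, Reach.init, hx.symm, .refl⟩
    · have : ∑ i : Fin t, headroom ((if i.val = 0 then w.length else 0) + 1)
          ((T.init w).pos (Sum.inl i)) HeadDir.right ≤ w.length := by
        rcases t with _ | t
        · simp
        · rw [Finset.sum_eq_single 0]
          · simp [headroom, NTM.init]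
          · intro i _ hi
            rw [if_neg]
            · simp [headroom]
            · intro h
              exact hi (Fin.ext h)
          · simp
      generalize (∑ i : Fin t, headroom ((if i.val = 0 then w.length else 0) + 1)
          ((T.init w).pos (Sum.inl i)) HeadDir.right) = y at this
      simp only [Finset.sum_const_zero, zero_add, pow_one, Finset.card_singleton]
      have h2 : W - 1 ≤ W := Nat.sub_le _ _
      nlinarith [Nat.mul_le_mul_right W this]
  | @step τ γ d κ δ h hδ ih =>
    obtain ⟨X, K, hX1, hX2, hX3, hK1, hK2, hpot⟩ := ih
    have hr' := h.step hδ
    set d' := fun i => (δ.move (Sum.inl i)).newDir (d i) with hd'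
    set κ' := fun i => κ i + if (δ.move (Sum.inl i)).newDir (d i) ≠ d i then 1 else 0 with hκ'
    have hKW : ∀ K : Finset (Q × (Fin u → Fin (s w.length)) × (Fin u → Fin (s w.length) → S) ×
      (Fin t → S)), K.card ≤ W := fun K => hW ▸ Finset.card_le_univ K
    have hpos1 : ∀ i, (δ.apply γ).pos (Sum.inl i) ≤ γ.pos (Sum.inl i) + 1 := fun i => by
      simp only [TMTransition.apply]
      cases δ.move (Sum.inl i) <;> (simp only [movePos]; omega)
    have htape : ∀ i, ∀ k, X i ≤ k → (δ.apply γ).tape (Sum.inl i) k = T.blank := by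
      intro i k hk
      simp only [TMTransition.apply]
      have := hX1 i
      rw [Function.update_of_ne (by omega)]
      exact hX2 i k hk
    have hsingle : ∀ x ∈ ({localKey (s w.length) (δ.apply γ)} : Finset _),
        ∃ τ' γ' d' κ', T.Reach w τ' γ' d' κ' ∧ localKey (s w.length) γ' = x ∧
        Relation.ReflTransGen T.BlankStep γ' (δ.apply γ) := by
      intro x hx
      rw [Finset.mem_singleton] at hx
      exact ⟨_, _, _, _, hr', hx.symm, .refl⟩
    have hblank : T.BlankStep γ (δ.apply γ) →
        (∀ x ∈ insert (localKey (s w.length) (δ.apply γ)) K,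
          ∃ τ' γ' d' κ', T.Reach w τ' γ' d' κ' ∧ localKey (s w.length) γ' = x ∧
          Relation.ReflTransGen T.BlankStep γ' (δ.apply γ)) ∧
        (insert (localKey (s w.length) (δ.apply γ)) K).card = K.card + 1 := by
      intro hstep
      constructor
      · intro x hx
        rcases Finset.mem_insert.1 hx with rfl | hx
        · exact ⟨_, _, _, _, hr', rfl, .refl⟩
        · obtain ⟨τ', γ', d', κ', h1, h2, h3⟩ := hK2 x hx
          exact ⟨τ', γ', d', κ', h1, h2, h3.tail hstep⟩
      -- A key that is already in `K` would close a loop of blank steps between locally equal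
      -- configurations.
      · refine Finset.card_insert_of_notMem fun hx => ?_
        obtain ⟨τ', γ', d', κ', h1, h2, h3⟩ := hK2 _ hx
        exact not_localEq_of_acc (h1.acc (hT w hw).1) (Relation.TransGen.tail' h3 hstep)
          (Reach.localEq hT hw h1 hr' h2)
    by_cases hN : ∀ i, δ.move (Sum.inl i) = TMMove.N
    -- No external head moves: `τ` grows by one and `W - K.card` shrinks by one.
    · have hdull : T.BlankStep γ (δ.apply γ) := ⟨δ, hδ, rfl, fun i => Or.inl (hN i)⟩
      have hp : ∀ i, (δ.apply γ).pos (Sum.inl i) = γ.pos (Sum.inl i) := fun i => by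
        simp [TMTransition.apply, hN i, movePos]
      have hdd : d' = d := by
        funext i
        simp [hd', hN i, TMMove.newDir]
      have hkk : κ' = κ := by
        funext i
        simp [hκ', hN i, TMMove.newDir]
      obtain ⟨h1, h2⟩ := hblank hdull
      refine ⟨X, _, fun i => by rw [hp]; exact hX1 i, htape, by omega,
        Finset.mem_insert_self _ K, h1, ?_⟩
      have h3 := hKW (insert (localKey (s w.length) (δ.apply γ)) K)
      change _ ≤ (w.length + t + 1) * (2 * W + 3) ^ (∑ j, κ' j + 1)
      simp only [hp, hdd, hkk]
      rw [h2] at h3 ⊢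
      omega
    · push Not at hN
      obtain ⟨i, hi⟩ := hN
      have hother : ∀ j, j ≠ i → δ.move (Sum.inl j) = TMMove.N := by
        intro j hj
        by_contra hjN
        exact hj (Sum.inl_injective (T.normalized δ hδ.1 _ _ hjN hi))
      have hp : ∀ j, j ≠ i → (δ.apply γ).pos (Sum.inl j) = γ.pos (Sum.inl j) := fun j hj => by
        simp [TMTransition.apply, hother j hj, movePos]
      have hdj : ∀ j, j ≠ i → d' j = d j := fun j hj => by
        simp [hd', hother j hj, TMMove.newDir]
      have hκj : ∀ j, j ≠ i → κ' j = κ j := fun j hj => by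
        simp [hκ', hother j hj, TMMove.newDir]
      by_cases hturn : d' i = d i
      · have hkk : κ' = κ := by
          funext j
          by_cases hj : j = i
          · subst hj
            simp [hκ', hd'] at hturn ⊢
            exact hturn
          · exact hκj j hj
        have hdd : d' = d := by
          funext j
          by_cases hj : j = i
          · exact hj ▸ hturn
          · exact hdj j hj
        by_cases hfresh : (δ.apply γ).pos (Sum.inl i) < X i
        -- A move within the explored part uses up headroom, which pays for the restart of `K` with
        -- a single key.
        · have hlt : headroom (X i) ((δ.apply γ).pos (Sum.inl i)) (d i) <
              headroom (X i) (γ.pos (Sum.inl i)) (d i) := by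
            simp only [hd'] at hturn
            simp only [TMTransition.apply] at hfresh ⊢
            cases hm : δ.move (Sum.inl i)
            · rw [hm] at hturn
              have := hδ.2.2.2 _ hm
              rw [← hturn]
              simp only [TMMove.newDir, headroom, movePos]
              omega
            · exact absurd hm hi
            · rw [hm] at hturn hfresh
              rw [← hturn]
              simp only [TMMove.newDir, headroom, movePos] at hfresh ⊢
              omega
          have hsum : ∑ j, headroom (X j) ((δ.apply γ).pos (Sum.inl j)) (d' j) <
              ∑ j, headroom (X j) (γ.pos (Sum.inl j)) (d j) := by
            rw [hdd]
            refine Finset.sum_lt_sum (fun j _ => ?_) ⟨i, Finset.mem_univ _, hlt⟩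
            by_cases hj : j = i
            · exact hj ▸ hlt.le
            · rw [hp j hj]
          refine ⟨X, {localKey (s w.length) (δ.apply γ)}, fun j => ?_, htape, by omega,
            Finset.mem_singleton_self _, hsingle, ?_⟩
          · by_cases hj : j = i
            · exact hj ▸ hfresh
            · rw [hp j hj]
              exact hX1 j
          · change _ ≤ (w.length + t + 1) * (2 * W + 3) ^ (∑ j, κ' j + 1)
            simp only [hkk, Finset.card_singleton]
            have h1 := hKW {localKey (s w.length) (δ.apply γ)}
            rw [Finset.card_singleton] at h1
            have h2 := Nat.mul_le_mul_right W (Nat.succ_le_of_lt hsum)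
            rw [Nat.succ_mul] at h2
            omega
        -- The head leaves the explored part, which is only possible to the right and from its last
        -- cell. The step is blank, and this head has headroom zero before and after it.
        · have hR : δ.move (Sum.inl i) = TMMove.R := by
            have := hX1 i
            cases hm : δ.move (Sum.inl i)
            · simp only [TMTransition.apply, hm, movePos] at hfresh
              omega
            · exact absurd hm hi
            · rfl
          have hpi : (δ.apply γ).pos (Sum.inl i) = γ.pos (Sum.inl i) + 1 := by
            simp [TMTransition.apply, hR, movePos]
          have hXi : X i = γ.pos (Sum.inl i) + 1 := by
            have := hX1 i
            omega
          have hdi : d i = HeadDir.right := by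
            rw [← hturn]
            simp [hd', hR, TMMove.newDir]
          have hdull : T.BlankStep γ (δ.apply γ) := ⟨δ, hδ, rfl, fun j => by
            by_cases hj : j = i
            · subst hj
              exact Or.inr ⟨hR, fun k hk => hX2 _ k (by omega)⟩
            · exact Or.inl (hother j hj)⟩
          obtain ⟨h1, h2⟩ := hblank hdull
          refine ⟨Function.update X i (X i + 1), _, fun j => ?_, fun j k hk => ?_, ?_,
            Finset.mem_insert_self _ K, h1, ?_⟩
          · by_cases hj : j = i
            · subst hj
              rw [Function.update_self]
              omega
            · rw [Function.update_of_ne hj, hp j hj]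
              exact hX1 j
          · refine htape j k ?_
            by_cases hj : j = i
            · subst hj
              rw [Function.update_self] at hk
              omega
            · rwa [Function.update_of_ne hj] at hk
          · rw [Finset.sum_update_of_mem (Finset.mem_univ i)]
            rw [← Finset.add_sum_erase _ _ (Finset.mem_univ i)] at hX3
            rw [Finset.sdiff_singleton_eq_erase]
            omega
          · have h3 := hKW (insert (localKey (s w.length) (δ.apply γ)) K)
            have h4 : ∀ j, headroom (Function.update X i (X i + 1) j)
                ((δ.apply γ).pos (Sum.inl j)) (d j) =
                headroom (X j) (γ.pos (Sum.inl j)) (d j) := by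
              intro j
              by_cases hj : j = i
              · subst hj
                rw [Function.update_self, hpi, hdi]
                simp only [headroom]
                omega
              · rw [Function.update_of_ne hj, hp j hj]
            change _ ≤ (w.length + t + 1) * (2 * W + 3) ^ (∑ j, κ' j + 1)
            simp only [hdd, hkk, h4]
            rw [h2] at h3 ⊢
            omega
      · have hκs : ∑ j, κ' j = ∑ j, κ j + 1 := by
          have h1 : κ' i = κ i + 1 := by
            simp only [hκ']
            rw [if_pos hturn]
          have h2 : κ' i + ∑ j ∈ Finset.univ.erase i, κ' j = ∑ j, κ' j :=
            Finset.add_sum_erase _ _ (Finset.mem_univ i)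
          have h3 : κ i + ∑ j ∈ Finset.univ.erase i, κ j = ∑ j, κ j :=
            Finset.add_sum_erase _ _ (Finset.mem_univ i)
          have h4 : ∑ j ∈ Finset.univ.erase i, κ' j = ∑ j ∈ Finset.univ.erase i, κ j :=
            Finset.sum_congr rfl fun j hj => hκj j (Finset.ne_of_mem_erase hj)
          omega
        have hX' : ∀ j, (δ.apply γ).pos (Sum.inl j) < Function.update X i (X i + 1) j := by
          intro j
          have h1 := hX1 j
          by_cases hj : j = i
          · subst hj
            rw [Function.update_self]
            have := hpos1 j
            omega
          · rw [Function.update_of_ne hj, hp j hj]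
            exact h1
        have hXs : ∑ j, Function.update X i (X i + 1) j ≤ w.length + t + (τ + 1) := by
          rw [Finset.sum_update_of_mem (Finset.mem_univ i)]
          rw [← Finset.add_sum_erase _ _ (Finset.mem_univ i)] at hX3
          rw [Finset.sdiff_singleton_eq_erase]
          omega
        have hsum : ∑ j, headroom (Function.update X i (X i + 1) j)
            ((δ.apply γ).pos (Sum.inl j)) (d' j) ≤ w.length + t + (τ + 1) := by
          refine le_trans (Finset.sum_le_sum fun j _ => ?_) hXs
          have := hX' j
          cases d' j <;> simp only [headroom] <;> omega
        refine ⟨Function.update X i (X i + 1), {localKey (s w.length) (δ.apply γ)}, hX',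
          fun j k hk => ?_, hXs, Finset.mem_singleton_self _, hsingle, ?_⟩
        · refine htape j k ?_
          by_cases hj : j = i
          · subst hj
            rw [Function.update_self] at hk
            omega
          · rwa [Function.update_of_ne hj] at hk
        · change _ ≤ (w.length + t + 1) * (2 * W + 3) ^ (∑ j, κ' j + 1)
          rw [hκs, pow_succ _ (∑ j, κ j + 1), ← mul_assoc]
          -- `Y` dominates both `w.length + t + 1` and `τ + 1`, so the headroom after the turn is
          -- below `2 * Y`; this is the origin of the `2` in `2 * W + 3`.
          set Y := (w.length + t + 1) * (2 * W + 3) ^ (∑ i, κ i + 1) with hY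
          have h1 : w.length + t + 1 ≤ Y := Nat.le_mul_of_pos_right _ (by positivity)
          have h2 : τ + 1 ≤ Y := by omega
          have h3 := Nat.mul_le_mul_right W hsum
          rw [Finset.card_singleton]
          have h4 : W - 1 ≤ W := Nat.sub_le _ _
          nlinarith [Nat.mul_le_mul_right W h1, Nat.mul_le_mul_right W h2]

/-- The length of computations of bounded machines. -/
theorem Reach.lt_length_bound {r s : ℕ → ℕ} {w : List S} [NeZero (s w.length)] [Fintype Q]
    [Fintype S] {τ : ℕ} {γ : TMConfig t u Q S} {d : Fin t → HeadDir} {κ : Fin t → ℕ}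
    (hT : T.IsBounded r s) (hw : T.IsInput w) (h : T.Reach w τ γ d κ) :
    τ + 1 ≤ (w.length + t + 1) * (2 * (Fintype.card Q * (s w.length ^ u *
      ((Fintype.card S ^ s w.length) ^ u * Fintype.card S ^ t))) + 3) ^ r w.length := by
  classical
  obtain ⟨X, K, -, -, -, -, -, h1⟩ := h.potential hT hw rfl
  have h2 := h.sum_le hT hw
  simp only [Fintype.card_prod, Fintype.card_pi, Fintype.card_fin, Finset.prod_const,
    Finset.card_univ] at h1
  refine le_trans (b := _) ?_ (Nat.mul_le_mul_left _ (Nat.pow_le_pow_right (by omega)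
    (show ∑ i, κ i + 1 ≤ r w.length by omega)))
  omega

theorem exists_reach_of_isChain {w : List S} (ρ : List (TMConfig t u Q S)) :
    ∀ {τ : ℕ} {γ : TMConfig t u Q S} {d : Fin t → HeadDir} {κ : Fin t → ℕ},
    T.Reach w τ γ d κ → (γ :: ρ).IsChain T.Step → ∃ γ' d' κ', T.Reach w (τ + ρ.length) γ' d' κ' := by
  induction ρ with
  | nil => exact fun h _ => ⟨_, _, _, h⟩
  | cons a l ih =>
    intro τ γ d κ h hc
    rw [List.isChain_cons_cons] at hc
    obtain ⟨δ, hδ, rfl⟩ := step_iff.1 hc.1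
    obtain ⟨γ', d', κ', h'⟩ := ih (h.step hδ) hc.2
    refine ⟨γ', d', κ', ?_⟩
    rw [List.length_cons]
    convert h' using 1
    omega

theorem IsRun.exists_reach {w : List S} {ρ : List (TMConfig t u Q S)} (h : T.IsRun w ρ) :
    ∃ τ γ d κ, T.Reach w τ γ d κ ∧ ρ.length = τ + 1 := by
  obtain ⟨h1, h2, -⟩ := h
  cases ρ with
  | nil => simp at h1
  | cons a l =>
    simp only [List.head?_cons, Option.some.injEq] at h1
    subst h1
    obtain ⟨γ, d, κ, h⟩ := exists_reach_of_isChain l Reach.init h2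
    exact ⟨_, γ, d, κ, h, by simp⟩

end NTM

/-! ## Histories: the possible contents of list cells -/

/-- The contents of list cells that occur in runs of a list machine. -/
inductive History (I C A : Type*) (t : ℕ)
  | input (v : I)
  | empty
  | node (a : A) (x : Fin t → History I C A t) (c : C)

namespace History

variable {I C A : Type*} {t : ℕ}

/-- The string that represents a history. -/
def encode : History I C A t → List (LMSymbol I C A)
  | input v => [LMSymbol.opening, LMSymbol.input v, LMSymbol.closing]
  | empty => [LMSymbol.opening, LMSymbol.closing]
  | node a x c => [LMSymbol.state a] ++
      (List.finRange t).flatMap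
        (fun i => [LMSymbol.opening] ++ encode (x i) ++ [LMSymbol.closing]) ++
      [LMSymbol.opening, LMSymbol.choice c, LMSymbol.closing]

theorem flatMap_inj {ι : Type*} {x y : ι → History I C A t} (l : List ι)
    (hx : ∀ i, ∀ (h' : History I C A t) (r r' : List (LMSymbol I C A)),
      encode (x i) ++ LMSymbol.closing :: r = encode h' ++ LMSymbol.closing :: r' →
      x i = h' ∧ r = r') (r r' : List (LMSymbol I C A))
    (h : l.flatMap (fun i => [LMSymbol.opening] ++ encode (x i) ++ [LMSymbol.closing]) ++ r =
      l.flatMap (fun i => [LMSymbol.opening] ++ encode (y i) ++ [LMSymbol.closing]) ++ r') :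
    (∀ i ∈ l, x i = y i) ∧ r = r' := by
  induction l with
  | nil => simpa using h
  | cons i l ih =>
    simp only [List.flatMap_cons, List.cons_append, List.append_assoc, List.cons.injEq,
      List.nil_append, true_and] at h
    obtain ⟨h1, h2⟩ := hx i _ _ _ h
    obtain ⟨h3, h4⟩ := ih (by simpa only [List.cons_append, List.append_assoc,
      List.nil_append] using h2)
    exact ⟨by simpa using ⟨h1, h3⟩, h4⟩

/-- The code is self-delimiting: its first two symbols reveal the constructor, and a node contains a
fixed number of bracketed subcodes. The trailing strings are carried along so that parsing can
continue after each subcode. -/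
theorem encode_append_inj (x : History I C A t) : ∀ (y : History I C A t)
    (r r' : List (LMSymbol I C A)),
    encode x ++ LMSymbol.closing :: r = encode y ++ LMSymbol.closing :: r' → x = y ∧ r = r' := by
  induction x with
  | input v =>
    intro y r r' h
    cases y <;> simp [encode] at h ⊢
    exact h
  | empty =>
    intro y r r' h
    cases y <;> simp [encode] at h ⊢
    exact h
  | node a x c ih =>
    intro y r r' h
    cases y with
    | input v => simp [encode] at h
    | empty => simp [encode] at h
    | node a' x' c' =>
      simp only [encode, List.append_assoc, List.cons_append, List.nil_append, List.cons.injEq,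
        LMSymbol.state.injEq] at h
      obtain ⟨h1, h2⟩ := h
      obtain ⟨h3, h4⟩ := flatMap_inj (x := x) (y := x') (List.finRange t) ih _ _
        (by simpa only [List.cons_append, List.append_assoc, List.nil_append] using h2)
      simp only [List.cons.injEq, LMSymbol.choice.injEq, true_and] at h4
      have h5 : x = x' := funext fun i => h3 i (List.mem_finRange i)
      exact ⟨by rw [h1, h5, h4.1], h4.2⟩

theorem encode_injective : Function.Injective (encode : History I C A t → _) := fun x y h =>
  (encode_append_inj x y [] [] (by rw [h])).1

instance : Nonempty (History I C A t) := ⟨empty⟩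

/-- The history that is represented by a string. -/
noncomputable def decode : List (LMSymbol I C A) → History I C A t := Function.invFun encode

@[simp]
theorem decode_encode (x : History I C A t) : decode (encode x) = x :=
  Function.leftInverse_invFun encode_injective x

end History

/-! ## Tape blocks -/

theorem HeadDir.eq_left_or_right (d : HeadDir) : d = HeadDir.left ∨ d = HeadDir.right := by
  cases d <;> simp

/-- A block of consecutive cells `lo, …, hi - 1` of a tape with inscription `sym`; `next` is the
number of the first input item that is not to the left of the end of the block. -/
structure Block (S : Type*) where
  lo : ℕ
  hi : ℕ
  sym : ℕ → S
  next : ℕ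

/-- What a list machine knows about a tape: the head direction, the head position, the position
`cut` that separates the blocks on the left from those on the right of the list head, the number of
input items to the left of it, and possibly the scanned symbol. -/
structure TapeInfo (S : Type*) where
  dir : HeadDir
  pos : ℕ
  cut : ℕ
  idx : ℕ
  ovr : Option S

namespace TapeInfo

variable {S : Type*}

/-- The positions that are covered by the current list cell. -/
def Visible (f : TapeInfo S) (b : Block S) (p : ℕ) : Prop :=
  match f.dir with
  | HeadDir.right => f.cut ≤ p ∧ p < b.hi
  | HeadDir.left => b.lo ≤ p ∧ p < f.cut

/-- The tape inscription, as far as it is known. -/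
def tape (f : TapeInfo S) (b : Block S) : ℕ → S :=
  match f.ovr with
  | none => b.sym
  | some a => Function.update b.sym f.pos a

end TapeInfo

/-- The change to the representation of a tape in a step of the list machine. -/
structure TapeUpdate (S : Type*) where
  info : TapeInfo S
  pass : Bool
  sym : ℕ → S

namespace TapeUpdate

variable {S : Type*}

/-- The block that is represented by the new list cell. -/
def written (up : TapeUpdate S) (f : TapeInfo S) (idx : ℕ) : Block S where
  lo := min f.cut up.info.cut
  hi := max f.cut up.info.cut
  sym := up.sym
  next := idx

/-- The list head leaves a block that does not contain the position of the tape head. -/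
def skip (f : TapeInfo S) (b : Block S) : TapeUpdate S where
  info := { f with
    cut := match f.dir with
      | HeadDir.right => b.hi
      | HeadDir.left => b.lo
    idx := b.next }
  pass := true
  sym := b.sym

/-- Nothing happens to the tape. -/
def stay (f : TapeInfo S) (b : Block S) : TapeUpdate S where
  info := f
  pass := false
  sym := b.sym

/-- The tape head at `p` does not move, and the tape inscription is `τ`. -/
def split (f : TapeInfo S) (p : ℕ) (τ : ℕ → S) : TapeUpdate S where
  info :=
    { dir := f.dir
      pos := p
      cut := match f.dir with
        | HeadDir.right => p
        | HeadDir.left => p + 1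
      idx := f.idx
      ovr := some (τ p) }
  pass := false
  sym := τ

/-- The tape head at `p` turns or leaves the block by the movement `mv`; the tape inscription
is `τ`. -/
def leave (f : TapeInfo S) (b : Block S) (p : ℕ) (τ : ℕ → S) (mv : TMMove) : TapeUpdate S where
  info :=
    { dir := mv.newDir f.dir
      pos := NTM.movePos mv p
      cut := match f.dir with
        | HeadDir.right => p + 1
        | HeadDir.left => p
      idx := if mv.newDir f.dir = f.dir then b.next else f.idx
      ovr := none }
  pass := decide (mv.newDir f.dir = f.dir)
  sym := τ

end TapeUpdate

/-! ## Representations of tapes by lists of blocks -/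

section Represent

variable {S X : Type*}

/-- The cells `0, …, e - 1` of the tape `τ` are represented by the list of blocks (in reverse
order). -/
def LeftOK (blk : X → ℕ → Block S) (τ : ℕ → S) : List X → ℕ → Prop
  | [], e => e = 0
  | x :: l, e => ∃ b : Block S, (∀ idx, blk x idx = { b with next := idx }) ∧ b.lo ≤ e ∧ e ≤ b.hi ∧
      (∀ k, b.lo ≤ k → k < e → b.sym k = τ k) ∧ LeftOK blk τ l b.lo

/-- The cells `s, …, H - 1` of the tape `τ` are represented by the list of blocks. -/
def RightOK (blk : X → ℕ → Block S) (H : ℕ) (τ : ℕ → S) : List X → ℕ → ℕ → Prop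
  | [], s, _ => s = H
  | x :: l, s, idx => (blk x idx).lo ≤ s ∧ s ≤ (blk x idx).hi ∧
      (∀ k, s ≤ k → k < (blk x idx).hi → (blk x idx).sym k = τ k) ∧
      RightOK blk H τ l (blk x idx).hi (blk x idx).next

variable {blk : X → ℕ → Block S} {H : ℕ} {τ τ' : ℕ → S}

theorem LeftOK.congr {l : List X} {e : ℕ} (h : LeftOK blk τ l e) (he : ∀ k < e, τ k = τ' k) :
    LeftOK blk τ' l e := by
  induction l generalizing e with
  | nil => exact h
  | cons x l ih =>
    obtain ⟨b, h1, h2, h3, h4, h5⟩ := h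
    exact ⟨b, h1, h2, h3, fun k hk hk' => (h4 k hk hk').trans (he k hk'),
      ih h5 fun k hk => he k (by omega)⟩

theorem RightOK.congr {l : List X} {s idx : ℕ} (h : RightOK blk H τ l s idx)
    (he : ∀ k, s ≤ k → τ k = τ' k) : RightOK blk H τ' l s idx := by
  induction l generalizing s idx with
  | nil => exact h
  | cons x l ih =>
    obtain ⟨h1, h2, h3, h4⟩ := h
    exact ⟨h1, h2, fun k hk hk' => (h3 k hk hk').trans (he k hk),
      ih h4 fun k hk => he k (by omega)⟩

/-- Cells on the left of the gap have been written by the machine, and their blocks have a fixed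
place. Only input items that have not been read, all on the right of the gap, need the item counter
to know where they are. The hypothesis `hy` keeps up this distinction. -/
theorem LeftOK.push {l : List X} {e e' : ℕ} (h : LeftOK blk τ l e) {y : X} {b : Block S}
    (hy : ∀ idx, blk y idx = { b with next := idx }) (hlo : b.lo = e) (hhi : b.hi = e')
    (he : e ≤ e') (hτ : ∀ k < e, τ k = τ' k) (hs : ∀ k, e ≤ k → k < e' → b.sym k = τ' k) :
    LeftOK blk τ' (y :: l) e' :=
  ⟨b, hy, by omega, by omega, fun k hk hk' => hs k (by omega) hk', hlo ▸ h.congr hτ⟩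

theorem RightOK.push {l : List X} {s s' idx : ℕ} (h : RightOK blk H τ l s idx) {y : X}
    {b : Block S} (hy : ∀ idx, blk y idx = { b with next := idx }) (hlo : b.lo = s')
    (hhi : b.hi = s) (hs : s' ≤ s) (hτ : ∀ k, s ≤ k → τ k = τ' k)
    (hb : ∀ k, s' ≤ k → k < s → b.sym k = τ' k) : RightOK blk H τ' (y :: l) s' idx := by
  refine ⟨?_, ?_, fun k hk hk' => ?_, ?_⟩
  · rw [hy]
    exact hlo.le
  · rw [hy]
    exact hs.trans hhi.ge
  · rw [hy] at hk' ⊢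
    exact hb k hk (hk'.trans_le hhi.le)
  · rw [hy]
    simp only [hhi]
    exact h.congr hτ

/-- The first block may reach beyond the gap, since only its part before the gap is compared with
the tape. Thus the gap can move into a block while its list cell stays unchanged, as happens when a
new cell is inserted next to it. -/
theorem LeftOK.restrict {x : X} {l : List X} {e e' : ℕ} (h : LeftOK blk τ (x :: l) e)
    (idx : ℕ) (h1 : (blk x idx).lo ≤ e') (h2 : e' ≤ e) (hτ : ∀ k < e', τ k = τ' k) :
    LeftOK blk τ' (x :: l) e' := by
  obtain ⟨b, h3, h4, h5, h6, h7⟩ := h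
  rw [h3] at h1
  exact ⟨b, h3, h1, h2.trans h5, fun k hk hk' => (h6 k hk (by omega)).trans (hτ k hk'),
    h7.congr fun k hk => hτ k (hk.trans_le h1)⟩

theorem RightOK.restrict {x : X} {l : List X} {s s' idx : ℕ} (h : RightOK blk H τ (x :: l) s idx)
    (h1 : s ≤ s') (h2 : s' ≤ (blk x idx).hi) (hτ : ∀ k, s' ≤ k → τ k = τ' k) :
    RightOK blk H τ' (x :: l) s' idx := by
  obtain ⟨h3, h4, h5, h6⟩ := h
  exact ⟨h3.trans h1, h2, fun k hk hk' => (h5 k (by omega) hk').trans (hτ k hk),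
    h6.congr fun k hk => hτ k (by omega)⟩

/-- The list of blocks `L.reverse ++ R` represents the tape `τ` with head position `p`. -/
structure TapeRep (blk : X → ℕ → Block S) (H : ℕ) (f : TapeInfo S) (L R : List X) (p : ℕ)
    (τ : ℕ → S) : Prop where
  pos : f.pos = p
  lt : p < H
  side : match f.dir with
    | HeadDir.right => f.cut ≤ p
    | HeadDir.left => p < f.cut
  rep : ∃ τ₀ : ℕ → S, LeftOK blk τ₀ L f.cut ∧ RightOK blk H τ₀ R f.cut f.idx ∧
    (∀ k, k ≠ p → τ₀ k = τ k) ∧ (f.ovr = none → τ₀ p = τ p)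
  scanned : ∀ a, f.ovr = some a → a = τ p
  visible : f.ovr ≠ none → ∀ x, (match f.dir with
    | HeadDir.right => R.head?
    | HeadDir.left => L.head?) = some x → f.Visible (blk x f.idx) p

/-! ### Effects of updates on the representation of a tape. -/

/-- The current list cell. -/
def frontCell (d : HeadDir) (L R : List X) : Option X :=
  match d with
  | HeadDir.right => R.head?
  | HeadDir.left => L.head?

/-- The list of cells on the left of the gap after an update. -/
def nextLeft (d : HeadDir) (pass : Bool) (y : X) (L : List X) : List X :=
  match d with
  | HeadDir.right => y :: L
  | HeadDir.left => if pass then L.tail else L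

/-- The list of cells on the right of the gap after an update. -/
def nextRight (d : HeadDir) (pass : Bool) (y : X) (R : List X) : List X :=
  match d with
  | HeadDir.right => if pass then R.tail else R
  | HeadDir.left => y :: R

variable {f : TapeInfo S} {L R : List X} {p : ℕ}

/-- The tape head lies on that side of the gap to which it is directed, and the blocks there fill
everything up to `H`, respectively down to `0`; so there is at least one. -/
theorem TapeRep.exists_frontCell (h : TapeRep blk H f L R p τ) :
    ∃ x, frontCell f.dir L R = some x := by
  obtain ⟨τ₀, h1, h2, -⟩ := h.rep
  have h3 := h.side
  have h4 := h.lt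
  unfold frontCell
  cases hd : f.dir
  · rw [hd] at h3
    cases L with
    | nil =>
      simp only [LeftOK] at h1
      simp only at h3
      omega
    | cons x l => exact ⟨x, rfl⟩
  · rw [hd] at h3
    cases R with
    | nil =>
      simp only [RightOK] at h2
      simp only at h3
      omega
    | cons x l => exact ⟨x, rfl⟩

/-- A writing step of the list machine affects every list, even if nothing happens on its tape. In
that case the inserted block is empty, with both ends at the gap. -/
theorem TapeRep.stay (h : TapeRep blk H f L R p τ) (x : X) {y : X}
    (hy : ∀ idx, blk y idx = (TapeUpdate.stay f (blk x f.idx)).written f idx) :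
    TapeRep blk H (TapeUpdate.stay f (blk x f.idx)).info (nextLeft f.dir false y L)
      (nextRight f.dir false y R) p τ := by
  obtain ⟨h1, h2, h3, ⟨τ₀, h4, h5, h6, h7⟩, h8, h9⟩ := h
  refine ⟨h1, h2, h3, ⟨τ₀, ?_, ?_, h6, h7⟩, h8, ?_⟩
  · simp only [nextLeft, TapeUpdate.stay]
    cases f.dir
    · exact h4
    · exact h4.push (b := (TapeUpdate.stay f (blk x f.idx)).written f 0) hy
        (by simp [TapeUpdate.written, TapeUpdate.stay])
        (by simp [TapeUpdate.written, TapeUpdate.stay]) le_rfl (fun _ _ => rfl)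
        (fun k hk hk' => by omega)
  · simp only [nextRight, TapeUpdate.stay]
    cases f.dir
    · exact h5.push (b := (TapeUpdate.stay f (blk x f.idx)).written f 0) hy
        (by simp [TapeUpdate.written, TapeUpdate.stay])
        (by simp [TapeUpdate.written, TapeUpdate.stay]) le_rfl (fun _ _ => rfl)
        (fun k hk hk' => by omega)
    · exact h5
  · simp only [nextLeft, nextRight, TapeUpdate.stay]
    cases hd : f.dir <;> simpa [hd] using h9

/-- The rest of the crossed block is recorded again in the new cell, and `next` hands on the item
counter. -/
theorem TapeRep.skip (h : TapeRep blk H f L R p τ) {x y : X}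
    (hx : frontCell f.dir L R = some x) (hv : ¬ f.Visible (blk x f.idx) p)
    (hy : ∀ idx, blk y idx = (TapeUpdate.skip f (blk x f.idx)).written f idx) :
    TapeRep blk H (TapeUpdate.skip f (blk x f.idx)).info (nextLeft f.dir true y L)
      (nextRight f.dir true y R) p τ := by
  obtain ⟨h1, h2, h3, ⟨τ₀, h4, h5, h6, h7⟩, h8, h9⟩ := h
  -- A symbol is stored only while the tape head is within the current block, so crossing the block
  -- cannot invalidate one.
  have ho : f.ovr = none := by
    by_contra ho
    exact hv (h9 ho x hx)
  refine ⟨h1, h2, ?_, ⟨τ₀, ?_, ?_, h6, h7⟩, h8, ?_⟩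
  · simp only [TapeUpdate.skip]
    unfold TapeInfo.Visible at hv
    cases hd : f.dir <;> simp only [hd] at h3 hv ⊢ <;> omega
  · unfold TapeInfo.Visible at hv
    simp only [nextLeft, TapeUpdate.skip]
    cases hd : f.dir
    · simp only [frontCell, hd, List.head?_eq_some_iff] at hx
      obtain ⟨l, rfl⟩ := hx
      obtain ⟨b, hb1, -, -, -, hb2⟩ := h4
      simp only [if_true, List.tail_cons, hb1]
      exact hb2
    · simp only [frontCell, hd, List.head?_eq_some_iff] at hx
      obtain ⟨l, rfl⟩ := hx
      obtain ⟨hb1, hb2, hb3, hb4⟩ := h5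
      exact h4.push (b := (TapeUpdate.skip f (blk x f.idx)).written f 0) hy
        (by simp [TapeUpdate.written, TapeUpdate.skip, hd, hb2])
        (by simp [TapeUpdate.written, TapeUpdate.skip, hd, hb2]) hb2 (fun _ _ => rfl) hb3
  · unfold TapeInfo.Visible at hv
    simp only [nextRight, TapeUpdate.skip]
    cases hd : f.dir
    · simp only [frontCell, hd, List.head?_eq_some_iff] at hx
      obtain ⟨l, rfl⟩ := hx
      obtain ⟨b, hb1, hb3, hb4, hb5, hb2⟩ := h4
      have e : (blk x f.idx).next = f.idx := by rw [hb1]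
      have e2 : (blk x f.idx).lo = b.lo := by rw [hb1]
      have e3 : (blk x f.idx).sym = b.sym := by rw [hb1]
      rw [e]
      exact h5.push (b := (TapeUpdate.skip f (blk x f.idx)).written f 0) hy
        (by simp [TapeUpdate.written, TapeUpdate.skip, hd, e2, hb3])
        (by simp [TapeUpdate.written, TapeUpdate.skip, hd, e2, hb3]) (e2 ▸ hb3) (fun _ _ => rfl)
        (fun k hk hk' => by
          simp only [TapeUpdate.written, TapeUpdate.skip, e3]
          exact hb5 k (e2 ▸ hk) hk')
    · simp only [frontCell, hd, List.head?_eq_some_iff] at hx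
      obtain ⟨l, rfl⟩ := hx
      obtain ⟨hb1, hb2, hb3, hb4⟩ := h5
      simp only [if_true, List.tail_cons]
      exact hb4
  · intro h
    exact absurd ho h

/-- The part of the tape that can have changed while the head has moved from `p` to `p'` in
direction `d`. -/
def ChangedBetween (d : HeadDir) (p p' : ℕ) (τ τ' : ℕ → S) : Prop :=
  match d with
  | HeadDir.right => p ≤ p' ∧ ∀ k, k < p ∨ p' < k → τ' k = τ k
  | HeadDir.left => p' ≤ p ∧ ∀ k, k < p' ∨ p < k → τ' k = τ k

/-- The new cell takes the part that the head has passed, without `p'`. The old cell stays current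
and is still correct beyond `p'`, where the head has not been; only its symbol at `p'` may be
outdated, and this symbol is kept in `ovr`. -/
theorem TapeRep.split (h : TapeRep blk H f L R p τ) {x y : X} {p' : ℕ} {σ : ℕ → S}
    (hx : frontCell f.dir L R = some x) (hv : f.Visible (blk x f.idx) p')
    (hτ : ChangedBetween f.dir p p' τ τ') (hp : p' < H)
    (hσ : ∀ k, f.Visible (blk x f.idx) k → σ k = τ' k)
    (hy : ∀ idx, blk y idx = (TapeUpdate.split f p' σ).written f idx) :
    TapeRep blk H (TapeUpdate.split f p' σ).info (nextLeft f.dir false y L)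
      (nextRight f.dir false y R) p' τ' := by
  classical
  obtain ⟨h1, h2, h3, ⟨τ₀, h4, h5, h6, h7⟩, h8, h9⟩ := h
  have hσp := hσ p' hv
  unfold TapeInfo.Visible at hv hσ
  unfold ChangedBetween at hτ
  -- The witness is the inscription recorded in the list cells: current everywhere except possibly
  -- at `p'`.
  refine ⟨rfl, hp, ?_, ⟨fun k => if k = p' then τ₀ k else τ' k, ?_, ?_, fun k hk => by simp [hk],
    by simp [TapeUpdate.split]⟩, ?_, ?_⟩
  · simp only [TapeUpdate.split]
    cases hd : f.dir <;> simp
  · simp only [nextLeft, TapeUpdate.split]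
    cases hd : f.dir
    · dsimp only
      simp only [hd] at hv hσ hτ h3
      simp only [frontCell, hd, List.head?_eq_some_iff] at hx
      obtain ⟨l, rfl⟩ := hx
      refine h4.restrict f.idx (by omega) (by omega) fun k hk => ?_
      split_ifs with hkp
      · rfl
      · rw [hτ.2 k (by omega), h6 k (by omega)]
    · dsimp only
      simp only [hd] at hv hσ hτ h3
      simp only [frontCell, hd, List.head?_eq_some_iff] at hx
      obtain ⟨l, rfl⟩ := hx
      refine h4.push (b := (TapeUpdate.split f p' σ).written f 0) hy
        (by simp [TapeUpdate.written, TapeUpdate.split, hd, hv.1])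
        (by simp [TapeUpdate.written, TapeUpdate.split, hd, hv.1]) hv.1 (fun k hk => ?_)
        (fun k hk hk' => ?_)
      · rw [if_neg (by omega), hτ.2 k (by omega), h6 k (by omega)]
      · rw [if_neg (by omega)]
        exact hσ k ⟨hk, by omega⟩
  · simp only [nextRight, TapeUpdate.split]
    cases hd : f.dir
    · dsimp only
      simp only [hd] at hv hσ hτ h3
      simp only [frontCell, hd, List.head?_eq_some_iff] at hx
      obtain ⟨l, rfl⟩ := hx
      have hc : p' + 1 ≤ f.cut := hv.2
      refine h5.push (b := (TapeUpdate.split f p' σ).written f 0) hy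
        (by simp [TapeUpdate.written, TapeUpdate.split, hd, hc])
        (by simp [TapeUpdate.written, TapeUpdate.split, hd, hc]) hc (fun k hk => ?_)
        (fun k hk hk' => ?_)
      · rw [if_neg (by omega), hτ.2 k (by omega), h6 k (by omega)]
      · rw [if_neg (by omega)]
        exact hσ k ⟨by omega, by omega⟩
    · dsimp only
      simp only [hd] at hv hσ hτ h3
      simp only [frontCell, hd, List.head?_eq_some_iff] at hx
      obtain ⟨l, rfl⟩ := hx
      refine h5.restrict (by omega) (by omega) fun k hk => ?_
      split_ifs with hkp
      · rfl
      · rw [hτ.2 k (by omega), h6 k (by omega)]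
  · intro a ha
    simp only [TapeUpdate.split, Option.some.injEq] at ha
    rw [← ha, hσp]
  · intro _ z hz
    unfold TapeInfo.Visible
    simp only [TapeUpdate.split] at hz ⊢
    cases hd : f.dir
    · simp only [hd, nextLeft, frontCell] at hx hz hv ⊢
      simp only [Bool.false_eq_true, if_false, hx, Option.some.injEq] at hz
      subst hz
      omega
    · simp only [hd, nextRight, frontCell] at hx hz hv ⊢
      simp only [Bool.false_eq_true, if_false, hx, Option.some.injEq] at hz
      subst hz
      omega

/-- In contrast to `TapeRep.split`, the new cell includes `p'`, so no symbol has to be stored. If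
the direction persists, `hb` makes `p'` the last cell of the block in that direction, and the block
is used up. If the head turns, the old cell retains what lies beyond `p'`, and the new cell becomes
the current one. -/
theorem TapeRep.leave (h : TapeRep blk H f L R p τ) {x y : X} {p' : ℕ} {σ : ℕ → S} {mv : TMMove}
    (hx : frontCell f.dir L R = some x) (hv : f.Visible (blk x f.idx) p')
    (hτ : ChangedBetween f.dir p p' τ τ') (hp : NTM.movePos mv p' < H) (hN : mv ≠ TMMove.N)
    (hL : mv = TMMove.L → p' ≠ 0)
    (hb : mv.newDir f.dir = f.dir → ¬ f.Visible (blk x f.idx) (NTM.movePos mv p'))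
    (hσ : ∀ k, f.Visible (blk x f.idx) k → σ k = τ' k)
    (hy : ∀ idx, blk y idx = (TapeUpdate.leave f (blk x f.idx) p' σ mv).written f idx) :
    TapeRep blk H (TapeUpdate.leave f (blk x f.idx) p' σ mv).info
      (nextLeft f.dir (TapeUpdate.leave f (blk x f.idx) p' σ mv).pass y L)
      (nextRight f.dir (TapeUpdate.leave f (blk x f.idx) p' σ mv).pass y R)
      (NTM.movePos mv p') τ' := by
  classical
  obtain ⟨h1, h2, h3, ⟨τ₀, h4, h5, h6, h7⟩, h8, h9⟩ := h
  unfold TapeInfo.Visible at hv hσ hb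
  unfold ChangedBetween at hτ
  refine ⟨rfl, hp, ?_, ⟨τ', ?_, ?_, fun k _ => rfl, fun _ => rfl⟩, ?_, ?_⟩
  · simp only [TapeUpdate.leave]
    cases mv
    · have := hL rfl
      cases hd : f.dir <;> (simp only [TMMove.newDir, NTM.movePos]; omega)
    · exact absurd rfl hN
    · cases hd : f.dir <;> simp [TMMove.newDir, NTM.movePos]
  · rcases f.dir.eq_left_or_right with hd | hd
    · simp only [nextLeft, TapeUpdate.leave, hd]
      simp only [hd] at hv hσ hτ h3 hb
      simp only [frontCell, hd, List.head?_eq_some_iff] at hx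
      obtain ⟨l, rfl⟩ := hx
      by_cases hpass : mv.newDir HeadDir.left = HeadDir.left
      · have hmv : mv = TMMove.L := by cases mv <;> simp_all [TMMove.newDir]
        subst hmv
        have := hb hpass
        have h0 := hL rfl
        simp only [NTM.movePos] at this
        have e : p' = (blk x f.idx).lo := by omega
        obtain ⟨b, hb1, hb3, hb4, hb5, hb2⟩ := h4
        have e2 : (blk x f.idx).lo = b.lo := by rw [hb1]
        simp only [hpass, decide_true, if_true, List.tail_cons]
        rw [e, e2]
        exact hb2.congr fun k hk => by rw [hτ.2 k (by omega), h6 k (by omega)]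
      · simp only [hpass, decide_false, Bool.false_eq_true, if_false]
        exact h4.restrict f.idx (by omega) (by omega) fun k hk => by
          rw [hτ.2 k (by omega), h6 k (by omega)]
    · simp only [nextLeft, TapeUpdate.leave, hd]
      simp only [hd] at hv hσ hτ h3
      simp only [frontCell, hd, List.head?_eq_some_iff] at hx
      obtain ⟨l, rfl⟩ := hx
      have hc : f.cut ≤ p' + 1 := by omega
      refine h4.push (b := (TapeUpdate.leave f (blk x f.idx) p' σ mv).written f 0) hy
        (by simp [TapeUpdate.written, TapeUpdate.leave, hd, hc])
        (by simp [TapeUpdate.written, TapeUpdate.leave, hd, hc]) hc (fun k hk => ?_)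
        (fun k hk hk' => ?_)
      · rw [hτ.2 k (by omega), h6 k (by omega)]
      · exact hσ k ⟨hk, by omega⟩
  · rcases f.dir.eq_left_or_right with hd | hd
    · simp only [nextRight, TapeUpdate.leave, hd]
      simp only [hd] at hv hσ hτ h3
      simp only [frontCell, hd, List.head?_eq_some_iff] at hx
      obtain ⟨l, rfl⟩ := hx
      have hc : p' ≤ f.cut := by omega
      have e : (if mv.newDir HeadDir.left = HeadDir.left then (blk x f.idx).next else f.idx) =
          f.idx := by
        split_ifs
        · obtain ⟨b, hb1, -⟩ := h4
          rw [hb1]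
        · rfl
      rw [e]
      refine h5.push (b := (TapeUpdate.leave f (blk x f.idx) p' σ mv).written f 0) hy
        (by simp [TapeUpdate.written, TapeUpdate.leave, hd, hc])
        (by simp [TapeUpdate.written, TapeUpdate.leave, hd, hc]) hc (fun k hk => ?_)
        (fun k hk hk' => ?_)
      · rw [hτ.2 k (by omega), h6 k (by omega)]
      · exact hσ k ⟨by omega, by omega⟩
    · simp only [nextRight, TapeUpdate.leave, hd]
      simp only [hd] at hv hσ hτ h3 hb
      simp only [frontCell, hd, List.head?_eq_some_iff] at hx
      obtain ⟨l, rfl⟩ := hx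
      by_cases hpass : mv.newDir HeadDir.right = HeadDir.right
      · have hmv : mv = TMMove.R := by cases mv <;> simp_all [TMMove.newDir]
        subst hmv
        have := hb hpass
        simp only [NTM.movePos] at this
        have e : p' + 1 = (blk x f.idx).hi := by omega
        obtain ⟨hb1, hb3, hb4, hb2⟩ := h5
        simp only [hpass, decide_true, if_true, List.tail_cons]
        rw [e]
        exact hb2.congr fun k hk => by rw [hτ.2 k (by omega), h6 k (by omega)]
      · simp only [hpass, decide_false, Bool.false_eq_true, if_false]
        exact h5.restrict (by omega) (by omega) fun k hk => by
          rw [hτ.2 k (by omega), h6 k (by omega)]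
  · simp [TapeUpdate.leave]
  · simp [TapeUpdate.leave]

/-- The tape inscription is known on the current block. -/
theorem TapeRep.tape_eq (h : TapeRep blk H f L R p τ) {x : X}
    (hx : frontCell f.dir L R = some x) {k : ℕ} (hk : f.Visible (blk x f.idx) k) :
    f.tape (blk x f.idx) k = τ k := by
  obtain ⟨h1, h2, h3, ⟨τ₀, h4, h5, h6, h7⟩, h8, h9⟩ := h
  have hs : (blk x f.idx).sym k = τ₀ k := by
    unfold TapeInfo.Visible at hk
    cases hd : f.dir
    · simp only [hd] at hk
      simp only [frontCell, hd, List.head?_eq_some_iff] at hx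
      obtain ⟨l, rfl⟩ := hx
      obtain ⟨b, hb1, -, -, hb2, -⟩ := h4
      rw [hb1] at hk ⊢
      exact hb2 k hk.1 hk.2
    · simp only [hd] at hk
      simp only [frontCell, hd, List.head?_eq_some_iff] at hx
      obtain ⟨l, rfl⟩ := hx
      exact h5.2.2.1 k hk.1 hk.2
  unfold TapeInfo.tape
  cases ho : f.ovr with
  | none =>
    by_cases hkp : k = p
    · subst hkp
      exact hs.trans (h7 ho)
    · exact hs.trans (h6 k hkp)
  | some a =>
    by_cases hkp : k = p
    · simp [hkp, h1, h8 a ho]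
    · simp only [h1]
      rw [Function.update_of_ne hkp]
      exact hs.trans (h6 k hkp)

end Represent

/-! ## Simulation within the current blocks -/

namespace NTM

variable {t u : ℕ} {Q S : Type*} {T : NTM t u Q S} {B : ℕ}

/-- The transition turns the `i`-th external head or moves it out of the region `vis i`. -/
def Blocked (d : Fin t → HeadDir) (vis : Fin t → ℕ → Prop) (γ : TMConfig t u Q S)
    (δ : TMTransition t u Q S) (i : Fin t) : Prop :=
  δ.move (Sum.inl i) ≠ TMMove.N ∧ ((δ.move (Sum.inl i)).newDir (d i) = d i →
    ¬ vis i (movePos (δ.move (Sum.inl i)) (γ.pos (Sum.inl i))))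

open Classical in
/-- Execute steps with the given choices until a head would turn or leave its region. The result is
the last configuration, and the transition and the head that are responsible for the end of the
simulation, if any. -/
noncomputable def simulate (T : NTM t u Q S) (d : Fin t → HeadDir) (vis : Fin t → ℕ → Prop) :
    List (Fin B) → TMConfig t u Q S →
      TMConfig t u Q S × Option (TMTransition t u Q S × Fin t)
  | [], γ => (γ, none)
  | c :: cs, γ =>
    match pick (T.app γ) c with
    | none => (γ, none)
    | some δ =>
      if h : ∃ i, Blocked d vis γ δ i then (γ, some (δ, h.choose))
      else simulate T d vis cs (δ.apply γ)

/-- Agreement of configurations in the regions `vis i` of the external tapes. -/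
structure Agree (vis : Fin t → ℕ → Prop) (γ γ' : TMConfig t u Q S) : Prop where
  state : γ.state = γ'.state
  pos : γ.pos = γ'.pos
  internal : ∀ j, γ.tape (Sum.inr j) = γ'.tape (Sum.inr j)
  external : ∀ i k, vis i k → γ.tape (Sum.inl i) k = γ'.tape (Sum.inl i) k

variable {d : Fin t → HeadDir} {vis : Fin t → ℕ → Prop} {γ γ' : TMConfig t u Q S}

theorem Agree.app_eq (h : Agree vis γ γ') (hv : ∀ i, vis i (γ.pos (Sum.inl i))) :
    T.app γ = T.app γ' := by
  have hs : ∀ i, γ.tape i (γ'.pos i) = γ'.tape i (γ'.pos i) := by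
    rintro (i | j)
    · rw [← h.pos]
      exact h.external i _ (hv i)
    · rw [h.internal]
  ext δ
  simp only [app, Set.mem_ofPred_eq, h.state, hs, h.pos]

theorem Agree.apply (h : Agree vis γ γ') (δ : TMTransition t u Q S) :
    Agree vis (δ.apply γ) (δ.apply γ') := by
  refine ⟨rfl, ?_, fun j => ?_, fun i k hk => ?_⟩
  · simp only [TMTransition.apply, h.pos]
  · simp only [TMTransition.apply, h.pos, h.internal]
  · simp only [TMTransition.apply, h.pos, Function.update_apply]
    split_ifs
    · rfl
    · exact h.external i k hk

theorem not_blocked_iff {δ : TMTransition t u Q S} (h : ¬ ∃ i, Blocked d vis γ δ i) (i : Fin t) :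
    (δ.move (Sum.inl i)).newDir (d i) = d i ∧
      (vis i (γ.pos (Sum.inl i)) → vis i ((δ.apply γ).pos (Sum.inl i))) := by
  push Not at h
  have h := h i
  unfold Blocked at h
  by_cases hN : δ.move (Sum.inl i) = TMMove.N
  · simp [hN, TMMove.newDir, TMTransition.apply, movePos]
  · have h' := not_and.1 h hN
    push Not at h'
    exact ⟨h'.1, fun _ => h'.2⟩

/-- The partial knowledge of the list machine suffices: the stopping test looks only at transitions
and head positions, and until it applies the heads scan cells on which both configurations agree. -/
theorem simulate_agree (cs : List (Fin B)) : ∀ {γ γ' : TMConfig t u Q S}, Agree vis γ γ' →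
    (∀ i, vis i (γ.pos (Sum.inl i))) →
    (T.simulate d vis cs γ).2 = (T.simulate d vis cs γ').2 ∧
    Agree vis (T.simulate d vis cs γ).1 (T.simulate d vis cs γ').1 ∧
    ∀ i, vis i ((T.simulate d vis cs γ').1.pos (Sum.inl i)) := by
  induction cs with
  | nil => exact fun h hv => ⟨rfl, h, fun i => by rw [simulate, ← h.pos]; exact hv i⟩
  | cons c cs ih =>
    intro γ γ' h hv
    unfold simulate
    rw [h.app_eq hv]
    cases pick (T.app γ') c with
    | none => exact ⟨rfl, h, fun i => by simp only [← h.pos]; exact hv i⟩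
    | some δ =>
      have hb : Blocked d vis γ δ = Blocked d vis γ' δ := by
        funext i
        simp only [Blocked, h.pos]
      dsimp only
      rw [hb]
      by_cases hex : ∃ i, Blocked d vis γ' δ i
      · simp only [dif_pos hex]
        exact ⟨trivial, h, fun i => by rw [← h.pos]; exact hv i⟩
      · simp only [dif_neg hex]
        rw [← hb] at hex
        exact ih (h.apply δ) fun i => (not_blocked_iff hex i).2 (hv i)

theorem changedBetween_apply {δ : TMTransition t u Q S} (i : Fin t) {p : ℕ} {τ : ℕ → S}
    (h : ChangedBetween (d i) p (γ.pos (Sum.inl i)) τ (γ.tape (Sum.inl i))) :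
    ChangedBetween (d i) p (γ.pos (Sum.inl i)) τ ((δ.apply γ).tape (Sum.inl i)) := by
  unfold ChangedBetween at h ⊢
  simp only [TMTransition.apply]
  cases hd : d i <;> simp only [hd] at h ⊢ <;> refine ⟨h.1, fun k hk => ?_⟩ <;>
  · have := h.1
    rw [Function.update_of_ne (by omega)]
    exact h.2 k hk

theorem ChangedBetween.extend {δ : TMTransition t u Q S} (hδ : δ ∈ T.app γ) (i : Fin t)
    (hd : (δ.move (Sum.inl i)).newDir (d i) = d i) {p' : ℕ} {τ : ℕ → S}
    (h : ChangedBetween (d i) ((δ.apply γ).pos (Sum.inl i)) p'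
      ((δ.apply γ).tape (Sum.inl i)) τ) :
    ChangedBetween (d i) (γ.pos (Sum.inl i)) p' (γ.tape (Sum.inl i)) τ := by
  unfold ChangedBetween at h ⊢
  have hL := hδ.2.2.2 (Sum.inl i)
  have hpos : (d i = HeadDir.left → (δ.apply γ).pos (Sum.inl i) ≤ γ.pos (Sum.inl i)) ∧
      (d i = HeadDir.right → γ.pos (Sum.inl i) ≤ (δ.apply γ).pos (Sum.inl i)) := by
    simp only [TMTransition.apply]
    cases hm : δ.move (Sum.inl i) <;> rw [hm] at hd <;> simp only [TMMove.newDir] at hd <;>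
      simp only [movePos] <;> refine ⟨fun h => ?_, fun h => ?_⟩ <;>
      first | omega | (rw [h] at hd; simp at hd)
  have htape : ∀ k, k ≠ γ.pos (Sum.inl i) →
      (δ.apply γ).tape (Sum.inl i) k = γ.tape (Sum.inl i) k := fun k hk => by
    simp only [TMTransition.apply]
    rw [Function.update_of_ne hk]
  cases hdi : d i
  · simp only [hdi] at h ⊢
    have := hpos.1 hdi
    exact ⟨by omega, fun k hk => by rw [h.2 k (by omega), htape k (by omega)]⟩
  · simp only [hdi] at h ⊢
    have := hpos.2 hdi
    exact ⟨by omega, fun k hk => by rw [h.2 k (by omega), htape k (by omega)]⟩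

theorem pick_app (hB : ∀ γ : TMConfig t u Q S, (T.app γ).Nonempty → (T.app γ).ncard ∣ B)
    (γ : TMConfig t u Q S) (c : Fin B) :
    (T.app γ = ∅ ∧ pick (T.app γ) c = none) ∨ ∃ δ ∈ T.app γ, pick (T.app γ) c = some δ := by
  rcases Set.eq_empty_or_nonempty (T.app γ) with h | h
  · refine Or.inl ⟨h, ?_⟩
    unfold pick
    rw [dif_neg]
    rintro ⟨_, g, hg, _⟩
    simpa [h] using hg c
  · obtain ⟨g, h1, h2, -⟩ := pick_spec (finite_app γ) h (hB γ h)
    exact Or.inr ⟨g c, h2 c, h1 c⟩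

/-- A simulation is a stretch of a genuine computation in which no external head turns, hence `d`
and `κ` are unchanged. If it is not blocked, it has halted or exhausted the choices; the second case
disappears once the sequence is as long as a longest run. -/
theorem simulate_reach {w : List S}
    (hB : ∀ γ : TMConfig t u Q S, (T.app γ).Nonempty → (T.app γ).ncard ∣ B)
    {κ : Fin t → ℕ} (cs : List (Fin B)) : ∀ {τ : ℕ} {γ : TMConfig t u Q S}, T.Reach w τ γ d κ →
    ∃ τ', τ ≤ τ' ∧ T.Reach w τ' (T.simulate d vis cs γ).1 d κ ∧
      (∀ i, ChangedBetween (d i) (γ.pos (Sum.inl i))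
        ((T.simulate d vis cs γ).1.pos (Sum.inl i)) (γ.tape (Sum.inl i))
        ((T.simulate d vis cs γ).1.tape (Sum.inl i))) ∧
      ((T.simulate d vis cs γ).2 = none →
        T.app (T.simulate d vis cs γ).1 = ∅ ∨ τ' = τ + cs.length) ∧
      ∀ δ i, (T.simulate d vis cs γ).2 = some (δ, i) →
        δ ∈ T.app (T.simulate d vis cs γ).1 ∧ Blocked d vis (T.simulate d vis cs γ).1 δ i := by
  have hrefl : ∀ (d : HeadDir) p (τ : ℕ → S), ChangedBetween d p p τ τ := by
    intro d p τ
    cases d <;> simp [ChangedBetween]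
  induction cs with
  | nil =>
    intro τ γ h
    exact ⟨τ, le_rfl, h, fun i => hrefl _ _ _, fun _ => Or.inr rfl, fun δ i h => by
      simp [simulate] at h⟩
  | cons c cs ih =>
    intro τ γ h
    unfold simulate
    rcases pick_app hB γ c with ⟨h1, h2⟩ | ⟨δ, hδ, h2⟩
    · rw [h2]
      exact ⟨τ, le_rfl, h, fun i => hrefl _ _ _, fun _ => Or.inl h1, fun δ i h => by simp at h⟩
    · rw [h2]
      by_cases hex : ∃ i, Blocked d vis γ δ i
      · simp only [dif_pos hex]
        refine ⟨τ, le_rfl, h, fun i => hrefl _ _ _, fun h => by simp at h, fun δ' i h => ?_⟩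
        simp only [Option.some.injEq, Prod.mk.injEq] at h
        rw [← h.1, ← h.2]
        exact ⟨hδ, hex.choose_spec⟩
      · simp only [dif_neg hex]
        have hstep := h.step hδ
        have hd : (fun i => (δ.move (Sum.inl i)).newDir (d i)) = d :=
          funext fun i => (not_blocked_iff hex i).1
        have hκ : (fun i => κ i + if (δ.move (Sum.inl i)).newDir (d i) ≠ d i then 1 else 0) = κ :=
          funext fun i => by simp [(not_blocked_iff hex i).1]
        rw [hd, hκ] at hstep
        obtain ⟨τ', h3, h4, h5, h6, h7⟩ := ih hstep
        refine ⟨τ', by omega, h4, fun i => ?_, fun h => (h6 h).imp_right fun h => ?_, h7⟩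
        · exact ChangedBetween.extend hδ i (not_blocked_iff hex i).1 (h5 i)
        · rw [h, List.length_cons]
          omega

/-! ### Averaging over sequences of choices. -/

/-- The probability of acceptance after a simulation. -/
noncomputable def simulateValue (T : NTM t u Q S) :
    TMConfig t u Q S × Option (TMTransition t u Q S × Fin t) → ℝ≥0∞
  | (γ, none) => T.acceptFrom γ
  | (γ, some (δ, _)) => T.acceptFrom (δ.apply γ)

/-- The acceptance probability is a martingale along the computation, and the simulation stops it at
a bounded time. Choices left over after the stop do not affect the value and contribute only factors
`B`; a blocked transition is already included in the value. -/
theorem sum_simulateValue [NeZero B]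
    (hB : ∀ γ : TMConfig t u Q S, (T.app γ).Nonempty → (T.app γ).ncard ∣ B)
    (ℓ : ℕ) : ∀ γ : TMConfig t u Q S,
    ∑ c : Fin ℓ → Fin B, T.simulateValue (T.simulate d vis (List.ofFn c) γ) =
      (B : ℝ≥0∞) ^ ℓ * T.acceptFrom γ := by
  induction ℓ with
  | zero =>
    intro γ
    simp [simulate, simulateValue]
  | succ ℓ ih =>
    intro γ
    rw [← Fintype.sum_equiv (Fin.consEquiv (fun _ : Fin (ℓ + 1) => Fin B))
      (fun p => T.simulateValue (T.simulate d vis (p.1 :: List.ofFn p.2) γ)) _ (fun p => by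
        simp [Fin.consEquiv, List.ofFn_succ])]
    rw [Fintype.sum_prod_type]
    rcases Set.eq_empty_or_nonempty (T.app γ) with h | h
    · have : ∀ (c : Fin B) (cs : List (Fin B)), T.simulate d vis (c :: cs) γ = (γ, none) := by
        intro c cs
        unfold simulate
        rcases pick_app hB γ c with ⟨_, h2⟩ | ⟨δ, hδ, _⟩
        · rw [h2]
        · simp [h] at hδ
      simp only [this, simulateValue]
      simp only [Finset.sum_const, Finset.card_univ, Fintype.card_fin, Fintype.card_fun,
        nsmul_eq_mul, Nat.cast_pow]
      ring
    · obtain ⟨g, h1, h2, h3⟩ := sum_acceptFrom h (Nat.pos_of_neZero B) (hB γ h)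
      have : ∀ c : Fin B, ∑ cs : Fin ℓ → Fin B,
          T.simulateValue (T.simulate d vis (c :: List.ofFn cs) γ) =
          (B : ℝ≥0∞) ^ ℓ * T.acceptFrom ((g c).apply γ) := by
        intro c
        unfold simulate
        rw [h1 c]
        by_cases hex : ∃ i, Blocked d vis γ (g c) i
        · simp only [dif_pos hex, simulateValue]
          simp
        · simp only [dif_neg hex]
          exact ih _
      simp only [this]
      rw [← Finset.mul_sum, h3]
      ring

end NTM

/-! ## The simulating list machine -/

/-- The state of a simulation that has not halted: the state of the Turing machine, its internal
memory, and information on the external memory. -/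
structure LiveState (t u : ℕ) (Q S : Type*) where
  state : Q
  ipos : Fin u → ℕ
  itape : Fin u → ℕ → S
  info : Fin t → TapeInfo S

/-- The state of a simulation. -/
inductive SimState (t u : ℕ) (Q S : Type*)
  | halted (acc : Bool)
  | live (a : LiveState t u Q S)

/-- The result of a step of the simulation. -/
inductive Outcome (t u : ℕ) (Q S : Type*)
  | halt (acc : Bool)
  | cont (q : Q) (ipos : Fin u → ℕ) (itape : Fin u → ℕ → S) (up : Fin t → TapeUpdate S)

section Machine

variable {t u : ℕ} {Q S : Type*} {B ℓ : ℕ}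

/-- The part of the configuration of the Turing machine that is known from the state of the
simulation and the current blocks. -/
def LiveState.config (a : LiveState t u Q S) (b : Fin t → Block S) : TMConfig t u Q S where
  state := a.state
  pos := Sum.elim (fun i => (a.info i).pos) a.ipos
  tape := Sum.elim (fun i => (a.info i).tape (b i)) a.itape

open Classical in
/-- A step of the simulation. -/
noncomputable def outcome (T : NTM t u Q S) (a : LiveState t u Q S) (b : Fin t → Block S)
    (c : List (Fin B)) : Outcome t u Q S :=
  if h : ∃ i, ¬ (a.info i).Visible (b i) (a.info i).pos then
    Outcome.cont a.state a.ipos a.itape fun j =>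
      if j = h.choose then TapeUpdate.skip (a.info j) (b j) else TapeUpdate.stay (a.info j) (b j)
  else
    match T.simulate (fun i => (a.info i).dir) (fun i => (a.info i).Visible (b i)) c
      (a.config b) with
    | (γ, none) => Outcome.halt (decide (γ.state ∈ T.acc))
    | (γ, some (δ, i)) =>
      Outcome.cont δ.tgt (fun j => (δ.apply γ).pos (Sum.inr j))
        (fun j => (δ.apply γ).tape (Sum.inr j)) fun j =>
          if j = i then
            TapeUpdate.leave (a.info j) (b j) (γ.pos (Sum.inl j)) ((δ.apply γ).tape (Sum.inl j))
              (δ.move (Sum.inl j))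
          else TapeUpdate.split (a.info j) (γ.pos (Sum.inl j)) ((δ.apply γ).tape (Sum.inl j))

variable {A : Type*} (T : NTM t u Q S) (hash : S) (m n H : ℕ) (dec : A → SimState t u Q S)

/-- The block of the `i`-th tape that is represented by a list cell, where `idx` is the number of
input items to the left of the cell. -/
noncomputable def History.block :
    History (InputItem T.blank hash n) (Fin ℓ → Fin B) A t → ℕ → Fin t → Block S
  | input v, idx, _ =>
    { lo := idx * (n + 1)
      -- The last item also carries the blank rest of the tape up to `H`; accordingly its `next`
      -- does not advance, and counters stay below `m`.
      hi := if idx + 1 < m then (idx + 1) * (n + 1) else H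
      sym := fun k =>
        (List.ofFn (fun k => (v k).val) ++ [hash]).getD (k - idx * (n + 1)) T.blank
      next := if idx + 1 < m then idx + 1 else idx }
  | empty, idx, _ => { lo := 0, hi := H, sym := fun _ => T.blank, next := idx }
  | node a x c, idx, i =>
    match dec a with
    | SimState.halted _ => { lo := 0, hi := H, sym := fun _ => T.blank, next := idx }
    | SimState.live a' =>
      match outcome T a' (fun j => History.block (x j) (a'.info j).idx j) (List.ofFn c) with
      | Outcome.halt _ => { lo := 0, hi := H, sym := fun _ => T.blank, next := idx }
      | Outcome.cont _ _ _ up => (up i).written (a'.info i) idx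

/-- The initial state of the simulation. -/
def LiveState.init : LiveState t u Q S where
  state := T.start
  ipos := fun _ => 0
  itape := fun _ _ => T.blank
  info := fun _ => { dir := HeadDir.right, pos := 0, cut := 0, idx := 0, ovr := none }

/-- The list machine that simulates the Turing machine `T`. -/
noncomputable def simMachine [Finite A] [NeZero B] (enc : SimState t u Q S → A) :
    NLM t m (InputItem T.blank hash n) (Fin ℓ → Fin B) A where
  finite_inputs := by
    have := T.finite_alphabet
    infer_instance
  finite_choices := inferInstance
  nonempty_choices := inferInstance
  finite_states := inferInstance
  start := enc (SimState.live (LiveState.init T))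
  final := {a | ∃ x, dec a = SimState.halted x}
  acc := {a | dec a = SimState.halted true}
  acc_subset := fun _ h => ⟨true, h⟩
  trans := fun a cells c =>
    match dec a.1 with
    | SimState.halted x => (a.1, fun _ => (HeadDir.right, false))
    | SimState.live a' =>
      match outcome T a' (fun j =>
          (History.decode (cells j)).block T hash m n H dec (a'.info j).idx j) (List.ofFn c) with
      -- With unchanged directions and no moves, the list machine changes nothing but its state.
      | Outcome.halt x => (enc (SimState.halted x), fun j => ((a'.info j).dir, false))
      | Outcome.cont q ipos itape up =>
        (enc (SimState.live ⟨q, ipos, itape, fun j => (up j).info⟩),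
          fun j => ((up j).info.dir, (up j).pass))

end Machine

/-! ## List operations -/

section ListOps

variable {t : ℕ} {I C A X : Type*}

/-- The position of a list head next to the gap after `l` cells. -/
def headPos (d : HeadDir) (l : ℕ) : ℕ :=
  match d with
  | HeadDir.right => l
  | HeadDir.left => l - 1

variable {γ : LMConfig t I C A} {i : Fin t} {f : X → List (LMSymbol I C A)} {L R : List X}
  {d d' : HeadDir} {pass : Bool} {x y : X}

theorem cell_eq (hlists : γ.lists i = (L.reverse ++ R).map f)
    (hpos : γ.pos i = headPos d L.length) (hx : frontCell d L R = some x) : γ.cell i = f x := by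
  unfold LMConfig.cell
  rw [hlists, hpos]
  cases d
  · simp only [frontCell, List.head?_eq_some_iff] at hx
    obtain ⟨l, rfl⟩ := hx
    simp [headPos]
  · simp only [frontCell, List.head?_eq_some_iff] at hx
    obtain ⟨l, rfl⟩ := hx
    simp [headPos]

/-- A move to the next cell is requested only if the lists after the update still have a current
cell, so the list machine never has to cancel it at the end of a list. -/
theorem adjust_eq (hlists : γ.lists i = (L.reverse ++ R).map f)
    (hpos : γ.pos i = headPos d L.length)
    (hpass : pass = true → d' = d ∧ ∃ z, frontCell d (nextLeft d pass y L) (nextRight d pass y R) =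
      some z) : γ.adjust i (d', pass) = (d', pass) := by
  cases pass with
  | false => cases d' <;> rfl
  | true =>
    obtain ⟨rfl, z, hz⟩ := hpass rfl
    cases d'
    · simp only [frontCell, nextLeft, if_true, List.head?_eq_some_iff] at hz
      obtain ⟨l, hl⟩ := hz
      simp only [LMConfig.adjust]
      rw [if_neg]
      have : L.length - 1 = l.length + 1 := by rw [← List.length_tail, hl, List.length_cons]
      rw [hpos]
      simp only [headPos]
      omega
    · simp only [frontCell, nextRight, if_true, List.head?_eq_some_iff] at hz
      obtain ⟨l, hl⟩ := hz
      simp only [LMConfig.adjust]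
      rw [if_neg]
      have : R.length - 1 = l.length + 1 := by rw [← List.length_tail, hl, List.length_cons]
      rw [hpos, hlists, List.length_map, List.length_append, List.length_reverse]
      simp only [headPos]
      omega

theorem newList_eq (hlists : γ.lists i = (L.reverse ++ R).map f)
    (hpos : γ.pos i = headPos d L.length) (hdir : γ.dir i = d) (hx : frontCell d L R = some x) :
    γ.newList (f y) i (d', pass) =
      ((nextLeft d pass y L).reverse ++ nextRight d pass y R).map f := by
  unfold LMConfig.newList
  rw [hlists, hpos, hdir]
  cases d
  · simp only [frontCell, List.head?_eq_some_iff] at hx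
    obtain ⟨l, rfl⟩ := hx
    have h1 : (l.map f).reverse.take (l.length + 1) = (l.map f).reverse :=
      List.take_of_length_le (by simp)
    have h2 : (l.map f).reverse.drop (l.length + 1) = [] := List.drop_of_length_le (by simp)
    cases pass <;>
      simp [headPos, nextLeft, nextRight, List.take_append, List.drop_append, h1, h2]
  · simp only [frontCell, List.head?_eq_some_iff] at hx
    obtain ⟨l, rfl⟩ := hx
    cases pass <;>
      simp [headPos, nextLeft, nextRight, List.drop_append]

theorem newPos_eq (hx : frontCell d L R = some x) (hpass : pass = true → d' = d) :
    LMConfig.newPos (headPos d L.length) (d', pass) =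
      headPos d' (nextLeft d pass y L).length := by
  cases d
  · simp only [frontCell, List.head?_eq_some_iff] at hx
    obtain ⟨l, rfl⟩ := hx
    cases pass
    · cases d' <;> simp [LMConfig.newPos, headPos, nextLeft]
    · rw [hpass rfl]
      simp [LMConfig.newPos, headPos, nextLeft]
  · cases pass
    · cases d' <;> simp [LMConfig.newPos, headPos, nextLeft]
    · rw [hpass rfl]
      simp [LMConfig.newPos, headPos, nextLeft]

end ListOps

/-! ## The simulation relation -/

theorem RightOK.le_bound {S X : Type*} {blk : X → ℕ → Block S} {H : ℕ} {τ : ℕ → S} {l : List X}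
    {s idx : ℕ} (h : RightOK blk H τ l s idx) : s ≤ H := by
  induction l generalizing s idx with
  | nil => exact Nat.le_of_eq h
  | cons x l ih => exact h.2.1.trans (ih h.2.2.2)

section Simulation

variable {t u : ℕ} {Q S : Type*} {B ℓ : ℕ} {A : Type*} {T : NTM t u Q S} {hash : S} {m n H : ℕ}
  {dec : A → SimState t u Q S}

theorem History.next_lt (x : History (InputItem T.blank hash n) (Fin ℓ → Fin B) A t) {idx : ℕ}
    (h : idx < m) (i : Fin t) : (x.block T hash m n H dec idx i).next < m := by
  cases x with
  | input v =>
    simp only [History.block]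
    split_ifs with h' <;> assumption
  | empty => exact h
  | node a x c =>
    simp only [History.block]
    split
    · exact h
    · split
      · exact h
      · exact h

/-- The states that occur in simulations. -/
def SimState.Bounded (blank : S) (σ H m : ℕ) : SimState t u Q S → Prop
  | halted _ => True
  | live a => (∀ j, a.ipos j < σ) ∧ (∀ j k, σ ≤ k → a.itape j k = blank) ∧
      ∀ i, (a.info i).pos ≤ H ∧ (a.info i).cut ≤ H ∧ (a.info i).idx < m

/-- The list machine configuration `μ` represents the configuration `γ` with head
directions `d`. -/
structure Simulates (T : NTM t u Q S) (hash : S) (m n H : ℕ) (dec : A → SimState t u Q S)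
    (μ : LMConfig t (InputItem T.blank hash n) (Fin ℓ → Fin B) A) (γ : TMConfig t u Q S)
    (d : Fin t → HeadDir) (a : LiveState t u Q S)
    (L R : Fin t → List (History (InputItem T.blank hash n) (Fin ℓ → Fin B) A t)) : Prop where
  dec_state : dec μ.state = SimState.live a
  state : a.state = γ.state
  ipos : ∀ j, a.ipos j = γ.pos (Sum.inr j)
  itape : ∀ j, a.itape j = γ.tape (Sum.inr j)
  rep : ∀ i, TapeRep (fun x idx => x.block T hash m n H dec idx i) H (a.info i) (L i) (R i)
    (γ.pos (Sum.inl i)) (γ.tape (Sum.inl i))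
  idx : ∀ i, (a.info i).idx < m
  dir : ∀ i, (a.info i).dir = d i
  lists : ∀ i, μ.lists i = ((L i).reverse ++ R i).map History.encode
  mdir : ∀ i, μ.dir i = d i
  mpos : ∀ i, μ.pos i = headPos (d i) (L i).length

theorem TapeRep.cut_le {X : Type*} {blk : X → ℕ → Block S} {H : ℕ} {f : TapeInfo S}
    {L R : List X} {p : ℕ} {τ : ℕ → S} (h : TapeRep blk H f L R p τ) : f.cut ≤ H := by
  obtain ⟨τ₀, -, h2, -⟩ := h.rep
  exact h2.le_bound

variable {μ : LMConfig t (InputItem T.blank hash n) (Fin ℓ → Fin B) A} {γ : TMConfig t u Q S}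
  {d : Fin t → HeadDir} {a : LiveState t u Q S}
  {L R : Fin t → List (History (InputItem T.blank hash n) (Fin ℓ → Fin B) A t)}

theorem Simulates.exists_front (h : Simulates T hash m n H dec μ γ d a L R) :
    ∃ x : Fin t → History (InputItem T.blank hash n) (Fin ℓ → Fin B) A t,
      ∀ i, frontCell (d i) (L i) (R i) = some (x i) := by
  have : ∀ i, ∃ x, frontCell (d i) (L i) (R i) = some x := fun i => by
    rw [← h.dir i]
    exact (h.rep i).exists_frontCell
  exact ⟨fun i => (this i).choose, fun i => (this i).choose_spec⟩

/-- The blocks at the current list positions. -/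
noncomputable def frontBlock (T : NTM t u Q S) (hash : S) (m n H : ℕ)
    (dec : A → SimState t u Q S) (a : LiveState t u Q S)
    (x : Fin t → History (InputItem T.blank hash n) (Fin ℓ → Fin B) A t) (j : Fin t) : Block S :=
  (x j).block T hash m n H dec (a.info j).idx j

variable {x : Fin t → History (InputItem T.blank hash n) (Fin ℓ → Fin B) A t}
  {enc : SimState t u Q S → A}

theorem Simulates.written_eq (h : Simulates T hash m n H dec μ γ d a L R)
    (hx : ∀ i, frontCell (d i) (L i) (R i) = some (x i)) (c : Fin ℓ → Fin B) :
    μ.written c = (History.node μ.state x c).encode := by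
  unfold LMConfig.written
  simp only [History.encode, cell_eq (h.lists _) (h.mpos _) (hx _)]

theorem Simulates.agree (h : Simulates T hash m n H dec μ γ d a L R)
    (hx : ∀ i, frontCell (d i) (L i) (R i) = some (x i)) :
    NTM.Agree (fun i => (a.info i).Visible (frontBlock T hash m n H dec a x i))
      (a.config (frontBlock T hash m n H dec a x)) γ := by
  refine ⟨h.state, funext fun i => ?_, fun j => ?_, fun i k hk => ?_⟩
  · rcases i with i | j
    · exact (h.rep i).pos
    · exact h.ipos j
  · exact h.itape j
  · exact (h.rep i).tape_eq (by rw [h.dir i]; exact hx i) hk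

variable [Finite A] [NeZero B]

theorem Simulates.notMem_final (h : Simulates T hash m n H dec μ γ d a L R) :
    μ.state ∉ (simMachine (ℓ := ℓ) (B := B) T hash m n H dec enc).final := by
  rintro ⟨b, hb⟩
  rw [h.dec_state] at hb
  cases hb

theorem Simulates.trans_eq (h : Simulates T hash m n H dec μ γ d a L R)
    (hx : ∀ i, frontCell (d i) (L i) (R i) = some (x i)) (c : Fin ℓ → Fin B)
    (hf : μ.state ∉ (simMachine (ℓ := ℓ) (B := B) T hash m n H dec enc).final) :
    (simMachine (ℓ := ℓ) (B := B) T hash m n H dec enc).trans ⟨μ.state, hf⟩ μ.cell c =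
      match outcome T a (frontBlock T hash m n H dec a x) (List.ofFn c) with
      | Outcome.halt b => (enc (SimState.halted b), fun j => (d j, false))
      | Outcome.cont q ipos itape up =>
        (enc (SimState.live ⟨q, ipos, itape, fun j => (up j).info⟩),
          fun j => ((up j).info.dir, (up j).pass)) := by
  have : μ.cell = fun j => (x j).encode := funext fun j => cell_eq (h.lists _) (h.mpos _) (hx _)
  simp only [simMachine, h.dec_state, this, History.decode_encode, h.dir]
  rfl

theorem Simulates.succ_halt (h : Simulates T hash m n H dec μ γ d a L R)
    (hx : ∀ i, frontCell (d i) (L i) (R i) = some (x i)) (c : Fin ℓ → Fin B)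
    (hf : μ.state ∉ (simMachine (ℓ := ℓ) (B := B) T hash m n H dec enc).final) {b : Bool}
    (ho : outcome T a (frontBlock T hash m n H dec a x) (List.ofFn c) = Outcome.halt b) :
    (simMachine (ℓ := ℓ) (B := B) T hash m n H dec enc).succ μ hf c =
      { μ with state := enc (SimState.halted b) } := by
  unfold NLM.succ
  rw [h.trans_eq hx c hf, ho]
  have : ∀ i, μ.adjust i (d i, false) = (d i, false) := fun i => by cases d i <;> rfl
  simp [this, h.mdir]

/-- The common part of skipping and simulating steps. In `hrep` the cell `y` is arbitrary with the
prescribed block, so each tape can be treated separately, without reference to the history that is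
actually written. -/
theorem Simulates.succ_cont (h : Simulates T hash m n H dec μ γ d a L R)
    (hx : ∀ i, frontCell (d i) (L i) (R i) = some (x i)) (c : Fin ℓ → Fin B)
    (hf : μ.state ∉ (simMachine (ℓ := ℓ) (B := B) T hash m n H dec enc).final) {q : Q}
    {ipos : Fin u → ℕ} {itape : Fin u → ℕ → S} {up : Fin t → TapeUpdate S}
    (ho : outcome T a (frontBlock T hash m n H dec a x) (List.ofFn c) =
      Outcome.cont q ipos itape up) {σ : ℕ}
    (henc : ∀ s : SimState t u Q S, s.Bounded T.blank σ H m → dec (enc s) = s)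
    {γ' : TMConfig t u Q S} {d' : Fin t → HeadDir}
    (hq : q = γ'.state) (hipos : ∀ j, ipos j = γ'.pos (Sum.inr j))
    (hitape : ∀ j, itape j = γ'.tape (Sum.inr j)) (hσ : ∀ j, γ'.pos (Sum.inr j) < σ)
    (hblank : ∀ j k, σ ≤ k → γ'.tape (Sum.inr j) k = T.blank)
    (hidx : ∀ i, (up i).info.idx < m) (hdir : ∀ i, (up i).info.dir = d' i)
    (hpass : ∀ i, (up i).pass = true → d' i = d i)
    (hmove : ∃ i, (up i).pass = true ∨ d' i ≠ d i)
    (hrep : ∀ i, ∀ y : History (InputItem T.blank hash n) (Fin ℓ → Fin B) A t,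
      (∀ idx, y.block T hash m n H dec idx i = (up i).written (a.info i) idx) →
      TapeRep (fun x idx => x.block T hash m n H dec idx i) H (up i).info
        (nextLeft (d i) (up i).pass y (L i)) (nextRight (d i) (up i).pass y (R i))
        (γ'.pos (Sum.inl i)) (γ'.tape (Sum.inl i))) :
    ∃ y, Simulates T hash m n H dec
      ((simMachine (ℓ := ℓ) (B := B) T hash m n H dec enc).succ μ hf c) γ' d'
      ⟨q, ipos, itape, fun j => (up j).info⟩ (fun i => nextLeft (d i) (up i).pass y (L i))
      (fun i => nextRight (d i) (up i).pass y (R i)) := by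
  set y := History.node μ.state x c with hy
  have hblock : ∀ i idx, y.block T hash m n H dec idx i = (up i).written (a.info i) idx := by
    intro i idx
    simp only [hy, History.block, h.dec_state]
    change (match outcome T a (frontBlock T hash m n H dec a x) (List.ofFn c) with
      | Outcome.halt _ => _
      | Outcome.cont _ _ _ up => (up i).written (a.info i) idx) = _
    rw [ho]
  have hrep' := fun i => hrep i y (hblock i)
  have hadj : ∀ i, μ.adjust i (d' i, (up i).pass) = (d' i, (up i).pass) := by
    intro i
    refine adjust_eq (y := y) (h.lists i) (h.mpos i) fun hp => ⟨hpass i hp, ?_⟩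
    have := (hrep' i).exists_frontCell
    rwa [hdir i, hpass i hp] at this
  have hsucc : (simMachine (ℓ := ℓ) (B := B) T hash m n H dec enc).succ μ hf c =
      { state := enc (SimState.live ⟨q, ipos, itape, fun j => (up j).info⟩)
        pos := fun i => LMConfig.newPos (μ.pos i) (d' i, (up i).pass)
        dir := d'
        lists := fun i => μ.newList (μ.written c) i (d' i, (up i).pass) } := by
    unfold NLM.succ
    rw [h.trans_eq hx c hf, ho]
    simp only [hdir, hadj]
    -- `hmove` rules out the case in which the list machine writes nothing and only changes its
    -- state.
    rw [if_neg]
    intro hall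
    obtain ⟨i, hi⟩ := hmove
    have := hall i
    rw [h.mdir] at this
    rcases hi with hi | hi
    · rw [hi] at this
      exact absurd this.1 (by simp)
    · exact hi this.2
  refine ⟨y, ?_⟩
  rw [hsucc]
  refine ⟨henc _ ⟨fun j => ?_, fun j k hk => ?_, fun i => ⟨?_, ?_, hidx i⟩⟩, hq, hipos, hitape,
    hrep', hidx, hdir, fun i => ?_, fun i => rfl, fun i => ?_⟩
  · exact (hipos j).trans_lt (hσ j)
  · exact (congrFun (hitape j) k).trans (hblank j k hk)
  · rw [(hrep' i).pos]
    exact (hrep' i).lt.le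
  · exact (hrep' i).cut_le
  · rw [h.written_eq hx c]
    exact newList_eq (h.lists i) (h.mpos i) (h.mdir i) (hx i)
  · simp only [h.mpos i]
    exact newPos_eq (hx i) (hpass i)

/-- The number of list cells in front of the list heads. -/
def frontLength (d : Fin t → HeadDir) {X : Type*} (L R : Fin t → List X) : ℕ :=
  ∑ i, match d i with
    | HeadDir.right => (R i).length
    | HeadDir.left => (L i).length

/-- The assumptions on the parameters of the simulation for the input word `w`. -/
structure SimBounds (T : NTM t u Q S) (w : List S) (m H B ℓ σ : ℕ) (dec : A → SimState t u Q S)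
    (enc : SimState t u Q S → A) : Prop where
  dec_enc : ∀ s : SimState t u Q S, s.Bounded T.blank σ H m → dec (enc s) = s
  dvd : ∀ γ : TMConfig t u Q S, (T.app γ).Nonempty → (T.app γ).ncard ∣ B
  pos_lt : ∀ {τ γ d κ}, T.Reach w τ γ d κ → ∀ j, γ.pos (Sum.inr j) < σ
  blank : ∀ {τ γ d κ}, T.Reach w τ γ d κ → ∀ j k, σ ≤ k → γ.tape (Sum.inr j) k = T.blank
  time : ∀ {τ γ d κ}, T.Reach w τ γ d κ → τ + 1 ≤ ℓ
  le : ℓ ≤ H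

/-! ### The two kinds of steps of the list machine. -/

variable {w : List S} {σ τ : ℕ} {κ : Fin t → ℕ}

/-- One list head passes a cell while `T` rests. All new cells are placed behind the heads, so
`frontLength` decreases. -/
theorem Simulates.skip (h : Simulates T hash m n H dec μ γ d a L R)
    (hb : SimBounds T w m H B ℓ σ dec enc) (hr : T.Reach w τ γ d κ)
    (hx : ∀ i, frontCell (d i) (L i) (R i) = some (x i)) (c : Fin ℓ → Fin B)
    (hf : μ.state ∉ (simMachine (ℓ := ℓ) (B := B) T hash m n H dec enc).final)
    (hv : ∃ i, ¬ (a.info i).Visible (frontBlock T hash m n H dec a x i) (a.info i).pos) :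
    ∃ a' L' R', Simulates T hash m n H dec
      ((simMachine (ℓ := ℓ) (B := B) T hash m n H dec enc).succ μ hf c) γ d a' L' R' ∧
      frontLength d L' R' < frontLength d L R := by
  classical
  obtain ⟨i, hi, ho⟩ : ∃ i, ¬ (a.info i).Visible (frontBlock T hash m n H dec a x i)
      (a.info i).pos ∧ outcome T a (frontBlock T hash m n H dec a x) (List.ofFn c) =
      Outcome.cont a.state a.ipos a.itape fun j =>
        if j = i then TapeUpdate.skip (a.info j) (frontBlock T hash m n H dec a x j)
        else TapeUpdate.stay (a.info j) (frontBlock T hash m n H dec a x j) := by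
    refine ⟨hv.choose, hv.choose_spec, ?_⟩
    unfold outcome
    rw [dif_pos hv]
  have hxd : ∀ j, frontCell (a.info j).dir (L j) (R j) = some (x j) := fun j => by
    rw [h.dir]
    exact hx j
  refine (h.succ_cont hx c hf ho hb.dec_enc (d' := d) h.state h.ipos h.itape
    (hb.pos_lt hr) (hb.blank hr) (fun j => ?_) (fun j => ?_) (fun j _ => rfl)
    ⟨i, Or.inl (by simp [TapeUpdate.skip])⟩ (fun j y hy => ?_)).elim fun y hy => ?_
  rotate_right
  · refine ⟨_, _, _, hy, ?_⟩
    unfold frontLength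
    refine Finset.sum_lt_sum (fun j _ => ?_) ⟨i, Finset.mem_univ _, ?_⟩
    · by_cases hj : j = i
      · subst hj
        cases hd : d j <;> simp [hd, nextLeft, nextRight, TapeUpdate.skip]
      · cases hd : d j <;> simp [hd, hj, nextLeft, nextRight, TapeUpdate.stay]
    · have hxi := hx i
      cases hd : d i
      · simp only [hd, frontCell, List.head?_eq_some_iff] at hxi
        obtain ⟨l, hl⟩ := hxi
        simp [hd, hl, nextLeft, TapeUpdate.skip]
      · simp only [hd, frontCell, List.head?_eq_some_iff] at hxi
        obtain ⟨l, hl⟩ := hxi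
        simp [hd, hl, nextRight, TapeUpdate.skip]
  · split_ifs
    · exact History.next_lt _ (h.idx j) j
    · exact h.idx j
  · split_ifs
    · exact h.dir j
    · exact h.dir j
  · by_cases hj : j = i
    · subst hj
      simp only [if_true] at hy ⊢
      have := (h.rep j).skip (hxd j) (by rw [← (h.rep j).pos]; exact hi) hy
      rwa [h.dir j] at this
    · simp only [if_neg hj] at hy ⊢
      have := (h.rep j).stay (x j) hy
      rwa [h.dir j] at this

/-- The successors of a configuration in which all heads are visible. -/
theorem Simulates.progress (h : Simulates T hash m n H dec μ γ d a L R)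
    (hb : SimBounds T w m H B ℓ σ dec enc) (hr : T.Reach w τ γ d κ)
    (hx : ∀ i, frontCell (d i) (L i) (R i) = some (x i)) (c : Fin ℓ → Fin B)
    (hf : μ.state ∉ (simMachine (ℓ := ℓ) (B := B) T hash m n H dec enc).final)
    (hv : ¬ ∃ i, ¬ (a.info i).Visible (frontBlock T hash m n H dec a x i) (a.info i).pos)
    {vis : Fin t → ℕ → Prop}
    (hvis : vis = fun i => (a.info i).Visible (frontBlock T hash m n H dec a x i)) :
    (∃ τ' γ' d' κ' a' L' R', τ < τ' ∧ T.Reach w τ' γ' d' κ' ∧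
      Simulates T hash m n H dec
        ((simMachine (ℓ := ℓ) (B := B) T hash m n H dec enc).succ μ hf c) γ' d' a' L' R' ∧
      T.acceptFrom γ' = T.simulateValue (T.simulate d vis (List.ofFn c) γ) ∧
      ∀ i, κ i + (if d i ≠ d' i then 1 else 0) ≤ κ' i) ∨
    ∃ b : Bool, (simMachine (ℓ := ℓ) (B := B) T hash m n H dec enc).succ μ hf c =
        { μ with state := enc (SimState.halted b) } ∧
      (if b = true then 1 else 0) = T.simulateValue (T.simulate d vis (List.ofFn c) γ) := by
  classical
  have hxd : ∀ j, frontCell (a.info j).dir (L j) (R j) = some (x j) := fun j => by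
    rw [h.dir]
    exact hx j
  have hdir : (fun i => (a.info i).dir) = d := funext h.dir
  push Not at hv
  have hag := h.agree hx
  rw [← hvis] at hag
  obtain ⟨h1, h2, h3⟩ := NTM.simulate_agree (T := T) (d := d) (List.ofFn c) hag
    (fun i => by rw [hvis]; exact hv i)
  obtain ⟨τ', hτ, hr', hch, hnone, hsome⟩ :=
    NTM.simulate_reach (T := T) (vis := vis) hb.dvd (List.ofFn c) hr
  have ho : outcome T a (frontBlock T hash m n H dec a x) (List.ofFn c) =
      match T.simulate d vis (List.ofFn c) (a.config (frontBlock T hash m n H dec a x)) with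
      | (γ, none) => Outcome.halt (decide (γ.state ∈ T.acc))
      | (γ, some (δ, i)) =>
        Outcome.cont δ.tgt (fun j => (δ.apply γ).pos (Sum.inr j))
          (fun j => (δ.apply γ).tape (Sum.inr j)) fun j =>
            if j = i then
              TapeUpdate.leave (a.info j) (frontBlock T hash m n H dec a x j)
                (γ.pos (Sum.inl j)) ((δ.apply γ).tape (Sum.inl j)) (δ.move (Sum.inl j))
            else TapeUpdate.split (a.info j) (γ.pos (Sum.inl j))
              ((δ.apply γ).tape (Sum.inl j)) := by
    unfold outcome
    rw [dif_neg (by push Not; exact hv), hdir, ← hvis]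
  generalize T.simulate d vis (List.ofFn c) γ = res at *
  generalize T.simulate d vis (List.ofFn c) (a.config (frontBlock T hash m n H dec a x)) = res₀
    at *
  obtain ⟨γr, o⟩ := res
  obtain ⟨γl, o₀⟩ := res₀
  simp only at h1 h2 h3 hr' hch hnone hsome ho
  subst h1
  cases o₀ with
  | none =>
    right
    refine ⟨_, h.succ_halt hx c hf ho, ?_⟩
    -- Exhausting all `ℓ` choices would give a computation longer than `hb.time` allows, so `T` must
    -- have halted.
    have happ : T.app γr = ∅ := by
      rcases hnone rfl with h | h
      · exact h
      · have := hb.time hr'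
        rw [List.length_ofFn] at h
        omega
    simp only [NTM.simulateValue, NTM.acceptFrom_of_app_eq_empty happ, h2.state,
      decide_eq_true_eq]
  | some p =>
    obtain ⟨δ, i⟩ := p
    left
    obtain ⟨hδ, hN, hbl⟩ := hsome δ i rfl
    have hstep := hr'.step hδ
    have hag' := h2.apply δ
    have hpl : ∀ j, γl.pos j = γr.pos j := fun j => congrFun h2.pos j
    have htime := hb.time hstep
    have hle := hb.le
    -- Normalization of `T` guarantees that the blocked transition concerns a single external head;
    -- all other tapes are split in place.
    have hother : ∀ j, j ≠ i → δ.move (Sum.inl j) = TMMove.N := by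
      intro j hj
      by_contra hjN
      exact hj (Sum.inl_injective (T.normalized δ hδ.1 _ _ hjN hN))
    have hσ : ∀ j k, (a.info j).Visible (frontBlock T hash m n H dec a x j) k →
        (δ.apply γl).tape (Sum.inl j) k = (δ.apply γr).tape (Sum.inl j) k := by
      intro j k hk
      refine hag'.external j k ?_
      rw [hvis]
      exact hk
    have hlt : ∀ j, (δ.apply γr).pos (Sum.inl j) < H := fun j => by
      have := hstep.pos_le (Sum.inl j)
      omega
    refine (h.succ_cont hx c hf ho hb.dec_enc (γ' := δ.apply γr)
      (d' := fun j => (δ.move (Sum.inl j)).newDir (d j)) rfl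
      (fun j => congrFun hag'.pos _) (fun j => hag'.internal j) (hb.pos_lt hstep) (hb.blank hstep)
      (fun j => ?_) (fun j => ?_) (fun j => ?_) ⟨i, ?_⟩
      (fun j y hy => ?_)).elim fun y hy => ?_
    rotate_right
    · refine ⟨τ' + 1, _, _, _, _, _, _, by omega, hstep, hy, rfl, fun j => ?_⟩
      simp only [ne_comm, le_refl]
    · split_ifs with hj
      · simp only [TapeUpdate.leave]
        split_ifs
        · exact History.next_lt _ (h.idx j) j
        · exact h.idx j
      · exact h.idx j
    · split_ifs with hj
      · simp only [TapeUpdate.leave, h.dir]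
      · simp only [TapeUpdate.split, h.dir, hother j hj, TMMove.newDir]
    · split_ifs with hj
      · simp only [TapeUpdate.leave, h.dir, decide_eq_true_eq, imp_self]
      · simp [TapeUpdate.split]
    · simp only [if_true, TapeUpdate.leave, h.dir, decide_eq_true_eq]
      exact em _
    · have hvj : (a.info j).Visible (frontBlock T hash m n H dec a x j) (γr.pos (Sum.inl j)) := by
        have := h3 j
        rwa [hvis] at this
      have hcj := hch j
      rw [← h.dir j] at hcj
      by_cases hj : j = i
      · subst hj
        simp only [if_true, hpl] at hy ⊢
        have := (h.rep j).leave (hxd j) hvj (NTM.changedBetween_apply (δ := δ)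
          (d := fun j => (a.info j).dir) j hcj) (hlt j) hN
          (hδ.2.2.2 _) (fun hdd => by
            have := hbl (by rwa [h.dir] at hdd)
            rwa [hvis] at this) (hσ j) hy
        rw [h.dir j] at this
        exact this
      · simp only [if_neg hj, hpl] at hy ⊢
        have hp : (δ.apply γr).pos (Sum.inl j) = γr.pos (Sum.inl j) := by
          simp [TMTransition.apply, hother j hj, NTM.movePos]
        have := (h.rep j).split (hxd j) hvj (NTM.changedBetween_apply (δ := δ)
          (d := fun j => (a.info j).dir) j hcj) (hp ▸ hlt j) (hσ j) hy
        rw [h.dir j] at this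
        rw [hp]
        exact this

end Simulation

/-! ## Correctness of the simulation -/

section Correctness

variable {t u : ℕ} {Q S : Type*} {B ℓ : ℕ} {A : Type*} {T : NTM t u Q S} {hash : S} {m n H : ℕ}
  {dec : A → SimState t u Q S} [Finite A] [NeZero B] {enc : SimState t u Q S → A} {w : List S}
  {σ τ : ℕ} {κ : Fin t → ℕ}
  {μ : LMConfig t (InputItem T.blank hash n) (Fin ℓ → Fin B) A} {γ : TMConfig t u Q S}
  {d : Fin t → HeadDir} {a : LiveState t u Q S}
  {L R : Fin t → List (History (InputItem T.blank hash n) (Fin ℓ → Fin B) A t)}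

/-- Induction along the runs of the simulating machine. -/
theorem Simulates.induct (hb : SimBounds T w m H B ℓ σ dec enc)
    {P : LMConfig t (InputItem T.blank hash n) (Fin ℓ → Fin B) A → TMConfig t u Q S →
      (Fin t → HeadDir) → (Fin t → ℕ) → Prop}
    (step : ∀ μ γ d κ τ (hf : μ.state ∉ (simMachine (ℓ := ℓ) (B := B) T hash m n H dec enc).final),
      (∀ i, μ.dir i = d i) → T.Reach w τ γ d κ →
      ((∀ c, P ((simMachine T hash m n H dec enc).succ μ hf c) γ d κ) ∨
        ∃ vis : Fin t → ℕ → Prop, ∀ c, (∃ γ' d' κ',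
          P ((simMachine T hash m n H dec enc).succ μ hf c) γ' d' κ' ∧
          T.acceptFrom γ' = T.simulateValue (T.simulate d vis (List.ofFn c) γ) ∧
          ∀ i, κ i + (if d i ≠ d' i then 1 else 0) ≤ κ' i) ∨
          ∃ b : Bool, (simMachine T hash m n H dec enc).succ μ hf c =
            { μ with state := enc (SimState.halted b) } ∧
            (if b = true then 1 else 0) =
              T.simulateValue (T.simulate d vis (List.ofFn c) γ)) → P μ γ d κ) :
    ∀ {τ μ γ d κ a L R}, Simulates T hash m n H dec μ γ d a L R → T.Reach w τ γ d κ →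
      P μ γ d κ := by
  -- Lexicographic induction: simulating steps increase `τ`, which stays below `ℓ`, and skips keep
  -- `τ` but decrease `frontLength`.
  have main : ∀ k, ∀ {τ μ γ d κ a L R}, ℓ - τ = k → Simulates T hash m n H dec μ γ d a L R →
      T.Reach w τ γ d κ → P μ γ d κ := by
    intro k
    induction k using Nat.strong_induction_on with
    | _ k ih =>
      intro τ μ γ d κ a L R hk h hr
      obtain ⟨y, hy⟩ : ∃ y, frontLength d L R = y := ⟨_, rfl⟩
      induction y using Nat.strong_induction_on generalizing μ a L R with
      | _ y ih' =>
        have hf := h.notMem_final (enc := enc)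
        obtain ⟨x, hx⟩ := h.exists_front
        refine step μ γ d κ τ hf h.mdir hr ?_
        by_cases hv : ∃ i, ¬ (a.info i).Visible (frontBlock T hash m n H dec a x i) (a.info i).pos
        · left
          intro c
          obtain ⟨a', L', R', h1, h2⟩ := h.skip hb hr hx c hf hv
          exact ih' _ (hy ▸ h2) h1 rfl
        · right
          refine ⟨fun i => (a.info i).Visible (frontBlock T hash m n H dec a x i), fun c => ?_⟩
          rcases h.progress hb hr hx c hf hv rfl with
            ⟨τ', γ', d', κ', a', L', R', h1, h2, h3, h4, h5⟩ | h1
          · have := hb.time h2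
            exact Or.inl ⟨γ', d', κ', ih (ℓ - τ') (by omega) rfl h3 h2, h4, h5⟩
          · exact Or.inr h1
  intro τ μ γ d κ a L R h hr
  exact main _ rfl h hr

theorem halted_mem_final (hb : SimBounds T w m H B ℓ σ dec enc) (b : Bool) :
    enc (SimState.halted b) ∈ (simMachine (ℓ := ℓ) (B := B) T hash m n H dec enc).final :=
  ⟨b, hb.dec_enc _ trivial⟩

theorem halted_mem_acc (hb : SimBounds T w m H B ℓ σ dec enc) (b : Bool) :
    enc (SimState.halted b) ∈ (simMachine (ℓ := ℓ) (B := B) T hash m n H dec enc).acc ↔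
      b = true := by
  change dec (enc (SimState.halted b)) = SimState.halted true ↔ _
  rw [hb.dec_enc (SimState.halted b) trivial]
  simp

/-- Both probabilities obey the same averaging equation: after a skip every successor represents the
same `γ`, and for a simulating step `NTM.sum_simulateValue` computes the average. The equation is
multiplied by the number of choices, which cancels. -/
theorem Simulates.acceptFrom_eq (hb : SimBounds T w m H B ℓ σ dec enc)
    (h : Simulates T hash m n H dec μ γ d a L R) (hr : T.Reach w τ γ d κ) :
    (simMachine T hash m n H dec enc).acceptFrom μ = T.acceptFrom γ := by
  refine Simulates.induct hb (P := fun μ γ _ _ =>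
    (simMachine T hash m n H dec enc).acceptFrom μ = T.acceptFrom γ) ?_ h hr
  intro μ γ d κ τ hf _ hr hstep
  have hsum := NLM.sum_acceptFrom hf
  have hcard : ((Fintype.card (Fin ℓ → Fin B) : ℕ) : ℝ≥0∞) ≠ 0 := by
    exact_mod_cast Fintype.card_ne_zero
  refine (ENNReal.mul_right_inj hcard (ENNReal.natCast_ne_top _)).1 ?_
  rw [← hsum]
  rcases hstep with hstep | ⟨vis, hstep⟩
  · simp only [hstep, Finset.sum_const, Finset.card_univ, nsmul_eq_mul]
  · have : ∀ c : Fin ℓ → Fin B, (simMachine T hash m n H dec enc).acceptFrom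
        ((simMachine T hash m n H dec enc).succ μ hf c) =
        T.simulateValue (T.simulate d vis (List.ofFn c) γ) := by
      intro c
      rcases hstep c with ⟨γ', d', κ', h1, h2, -⟩ | ⟨b, h1, h2⟩
      · rw [h1, h2]
      · rw [h1, ← h2, NLM.acceptFrom_of_final (halted_mem_final hb b)]
        simp only [halted_mem_acc hb]
    simp only [this]
    rw [NTM.sum_simulateValue hb.dvd]
    simp

theorem Simulates.acc (hb : SimBounds T w m H B ℓ σ dec enc)
    (h : Simulates T hash m n H dec μ γ d a L R) (hr : T.Reach w τ γ d κ) :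
    Acc (fun x y => (simMachine T hash m n H dec enc).Step y x) μ := by
  refine Simulates.induct hb (P := fun μ _ _ _ =>
    Acc (fun x y => (simMachine T hash m n H dec enc).Step y x) μ) ?_ h hr
  intro μ γ d κ τ hf _ hr hstep
  refine Acc.intro _ ?_
  rintro _ ⟨c, hf', rfl⟩
  rcases hstep with hstep | ⟨vis, hstep⟩
  · exact hstep c
  · rcases hstep c with ⟨γ', d', κ', h1, -⟩ | ⟨b, h1, -⟩
    · exact h1
    · rw [h1]
      refine Acc.intro _ ?_
      rintro _ ⟨c', hf'', -⟩
      exact absurd (halted_mem_final hb b) hf''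

/-- Every turn of a list head is accompanied by a turn of the corresponding tape head. The induction
also carries the agreement of `μ.dir` with `d`, so that turns of consecutive configurations can be
compared. -/
theorem Simulates.rev_le (hb : SimBounds T w m H B ℓ σ dec enc)
    (h : Simulates T hash m n H dec μ γ d a L R) (hr : T.Reach w τ γ d κ) :
    ∀ ρ, (μ :: ρ).IsChain (simMachine T hash m n H dec enc).Step →
      ∃ τ' γ' d' κ', T.Reach w τ' γ' d' κ' ∧
        ∀ i, κ i + NLM.rev (μ :: ρ) i ≤ κ' i := by
  refine (Simulates.induct hb (P := fun μ _ d κ => (∀ i, μ.dir i = d i) ∧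
    ∀ ρ, (μ :: ρ).IsChain (simMachine T hash m n H dec enc).Step →
      ∃ τ' γ' d' κ', T.Reach w τ' γ' d' κ' ∧
        ∀ i, κ i + NLM.rev (μ :: ρ) i ≤ κ' i) ?_ h hr).2
  intro μ γ d κ τ hf hd hr hstep
  refine ⟨hd, fun ρ hρ => ?_⟩
  cases ρ with
  | nil => exact ⟨_, _, _, _, hr, fun i => by simp [NLM.rev, changeCount]⟩
  | cons μ' ρ =>
    rw [List.isChain_cons_cons] at hρ
    obtain ⟨⟨c, hf', rfl⟩, hρ⟩ := hρ
    have hrev : ∀ i, NLM.rev (μ :: (simMachine T hash m n H dec enc).succ μ hf' c :: ρ) i =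
        (if μ.dir i ≠ ((simMachine T hash m n H dec enc).succ μ hf' c).dir i then 1 else 0) +
          NLM.rev ((simMachine T hash m n H dec enc).succ μ hf' c :: ρ) i := fun i => by
      simp only [NLM.rev, List.map_cons, changeCount]
    rcases hstep with hstep | ⟨vis, hstep⟩
    · obtain ⟨h1, h2⟩ := hstep c
      obtain ⟨τ', γ', d', κ', h3, h4⟩ := h2 ρ hρ
      refine ⟨τ', γ', d', κ', h3, fun i => ?_⟩
      rw [hrev, h1, hd, if_neg (by simp), zero_add]
      exact h4 i
    · rcases hstep c with ⟨γ', d', κ', ⟨h1, h2⟩, -, h0⟩ | ⟨b, h1, -⟩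
      · obtain ⟨τ', γ'', d'', κ'', h3, h4⟩ := h2 ρ hρ
        refine ⟨τ', γ'', d'', κ'', h3, fun i => ?_⟩
        rw [hrev, h1, hd, ← add_assoc]
        exact (Nat.add_le_add_right (h0 i) _).trans (h4 i)
      · have hnil : ρ = [] := by
          cases ρ with
          | nil => rfl
          | cons μ'' ρ =>
            rw [List.isChain_cons_cons, h1] at hρ
            obtain ⟨⟨c', hf'', -⟩, -⟩ := hρ
            exact absurd (halted_mem_final hb b) hf''
        refine ⟨_, _, _, _, hr, fun i => ?_⟩
        rw [hrev, hnil, h1]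
        simp [NLM.rev, changeCount]

end Correctness

/-! ## Initial configurations -/

/-- For the last word the offset may exceed the word length; both sides are then the default `b`.
This serves the block of the last input item, which includes the blank remainder. -/
theorem getD_flatMap {α S : Type*} (f : α → List S) {c : ℕ} (hf : ∀ x, (f x).length = c)
    (l : List α) (b : S) {j o : ℕ} (hj : j < l.length) (ho : o < c ∨ j + 1 = l.length) :
    (l.flatMap f).getD (j * c + o) b = (f l[j]).getD o b := by
  induction l generalizing j with
  | nil => simp at hj
  | cons x l ih =>
    rw [List.flatMap_cons]
    cases j with
    | zero =>
      simp only [Nat.zero_mul, Nat.zero_add, List.getElem_cons_zero]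
      rcases ho with ho | ho
      · rw [List.getD_append _ _ _ _ (by rw [hf]; exact ho)]
      · have : l = [] := by
          rw [← List.length_eq_zero_iff]
          simpa using ho.symm
        simp [this]
    | succ j =>
      rw [List.getD_append_right _ _ _ _ (by rw [hf]; nlinarith)]
      have e : (j + 1) * c + o - (f x).length = j * c + o := by
        rw [hf, Nat.succ_mul]
        omega
      rw [e, List.getElem_cons_succ]
      exact ih (by simpa using hj) (ho.imp_right fun h => by simpa using h)

section Init

variable {t u : ℕ} {Q S : Type*} {B ℓ : ℕ} {A : Type*} {T : NTM t u Q S} {hash : S} {m n H : ℕ}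
  {dec : A → SimState t u Q S} {enc : SimState t u Q S → A} {σ : ℕ}

theorem inputWord_getD (v : Fin m → InputItem T.blank hash n) (j : Fin m) {k : ℕ}
    (hk : j.val * (n + 1) ≤ k) (hk' : j.val + 1 < m → k < (j.val + 1) * (n + 1)) :
    (inputWord v).getD k T.blank =
      (List.ofFn (fun k => (v j k).val) ++ [hash]).getD (k - j.val * (n + 1)) T.blank := by
  obtain ⟨o, rfl⟩ := Nat.exists_eq_add_of_le hk
  have hj := j.2
  unfold inputWord
  rw [getD_flatMap (c := n + 1) _ (by simp) _ _ (by simp)]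
  · simp
  · by_cases h : j.val + 1 < m
    · have := hk' h
      rw [Nat.succ_mul] at this
      left
      omega
    · right
      simp only [List.length_ofFn]
      omega

theorem inputWord_length (v : Fin m → InputItem T.blank hash n) :
    (inputWord v).length = m * (n + 1) := by
  simp [inputWord, List.length_flatMap, Function.comp_def]

theorem isInput_inputWord (h : hash ≠ T.blank) (v : Fin m → InputItem T.blank hash n) :
    T.IsInput (inputWord v) := by
  unfold NTM.IsInput inputWord
  simp only [List.mem_flatMap, List.mem_append, List.mem_ofFn, List.mem_singleton, not_exists,
    not_and, not_or]
  rintro x -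
  exact ⟨fun k hk => (x k).2.1 hk, fun hk => h hk.symm⟩

/-- Induction from the last item backwards, `k` being the number of items after the `j`-th. The
counter threaded through `RightOK` is the number of the item. -/
theorem rightOK_inputs (v : Fin m → InputItem T.blank hash n) (i : Fin t)
    (hH : m * (n + 1) ≤ H) (k : ℕ) : ∀ j : ℕ, j + k + 1 = m →
    RightOK (fun (x : History (InputItem T.blank hash n) (Fin ℓ → Fin B) A t) idx =>
      x.block T hash m n H dec idx i) H (fun k => (inputWord v).getD k T.blank)
      (((List.ofFn v).drop j).map History.input) (j * (n + 1)) j := by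
  induction k with
  | zero =>
    intro j hj
    have hlen : j < (List.ofFn v).length := by
      rw [List.length_ofFn]
      omega
    have hn : (List.ofFn v).drop (j + 1) = [] := List.drop_of_length_le (by
      rw [List.length_ofFn]
      omega)
    rw [List.drop_eq_getElem_cons hlen, hn]
    have hjm : ¬ j + 1 < m := by omega
    refine ⟨?_, ?_, fun k hk hk' => ?_, ?_⟩
    · simp [History.block]
    · simp only [History.block, if_neg hjm]
      refine le_trans ?_ hH
      exact Nat.mul_le_mul_right _ (by omega)
    · simp only [History.block]
      rw [inputWord_getD v ⟨j, by omega⟩ hk (fun h => absurd h hjm)]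
      simp
    · simp [History.block, if_neg hjm, RightOK]
  | succ k ih =>
    intro j hj
    have hlen : j < (List.ofFn v).length := by
      rw [List.length_ofFn]
      omega
    rw [List.drop_eq_getElem_cons hlen]
    have hjm : j + 1 < m := by omega
    refine ⟨?_, ?_, fun k hk hk' => ?_, ?_⟩
    · simp [History.block]
    · simp only [History.block, if_pos hjm]
      exact Nat.mul_le_mul_right _ (by omega)
    · simp only [History.block, if_pos hjm] at hk' ⊢
      rw [inputWord_getD v ⟨j, by omega⟩ hk (fun _ => hk')]
      simp
    · simp only [History.block, if_pos hjm]
      exact ih (j + 1) (by omega)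

theorem simulates_init [Finite A] [NeZero B] (v : Fin m → InputItem T.blank hash n)
    (hb : SimBounds T (inputWord v) m H B ℓ σ dec enc) (hm : 1 ≤ m) (hH : m * (n + 1) ≤ H) :
    Simulates T hash m n H dec ((simMachine (ℓ := ℓ) (B := B) T hash m n H dec enc).init v)
      (T.init (inputWord v)) (fun _ => HeadDir.right) (LiveState.init T) (fun _ => [])
      (fun i => if i.val = 0 then (List.ofFn v).map History.input else [History.empty]) := by
  have hlt : 0 < H := lt_of_lt_of_le (Nat.succ_pos _) ((hb.time NTM.Reach.init).trans hb.le)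
  refine ⟨hb.dec_enc _ ⟨fun j => ?_, fun j k _ => rfl, fun i => ⟨Nat.zero_le _, Nat.zero_le _, hm⟩⟩,
    rfl, fun _ => rfl, fun _ => rfl, fun i => ⟨rfl, hlt, le_rfl, ⟨_, rfl, ?_, fun _ _ => rfl,
      fun _ => rfl⟩, (fun _ h => nomatch h), fun h => absurd rfl h⟩, fun _ => hm, fun _ => rfl,
    fun i => ?_, fun _ => rfl, fun _ => rfl⟩
  · exact lt_of_le_of_lt (Nat.zero_le _) (hb.pos_lt NTM.Reach.init j)
  · by_cases hi : i.val = 0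
    · have := rightOK_inputs (ℓ := ℓ) (B := B) (dec := dec) v i hH (m - 1) 0 (by omega)
      simp only [hi, if_true]
      simpa [NTM.init, hi, LiveState.init] using this
    · simp only [hi, if_false]
      refine ⟨Nat.zero_le _, Nat.zero_le _, fun k _ _ => ?_, rfl⟩
      simp [History.block, NTM.init, hi]
  · by_cases hi : i.val = 0
    · simp [NLM.init, hi, History.encode, Function.comp_def]
    · simp [NLM.init, hi, History.encode]

end Init

/-! ## Finite sets of states -/

section Coding

variable {t u : ℕ} {Q S : Type*} {σ H m : ℕ}

/-- Codes of bounded states of the simulation. -/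
abbrev SimCode (t u : ℕ) (Q S : Type*) (σ H m : ℕ) : Type _ :=
  Bool ⊕ (Q × (Fin u → Fin σ) × (Fin u → Fin σ → S) ×
    (Fin t → Bool × Fin (H + 1) × Fin (H + 1) × Fin m × Option S))

/-- The code of a state. -/
def SimState.toCode [NeZero σ] [NeZero m] : SimState t u Q S → SimCode t u Q S σ H m
  | halted b => Sum.inl b
  | live a => Sum.inr (a.state, fun j => Fin.ofNat σ (a.ipos j), fun j k => a.itape j k,
      fun i => (decide ((a.info i).dir = HeadDir.right), Fin.ofNat (H + 1) (a.info i).pos,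
        Fin.ofNat (H + 1) (a.info i).cut, Fin.ofNat m (a.info i).idx, (a.info i).ovr))

/-- The state with a given code. -/
def SimState.ofCode (blank : S) : SimCode t u Q S σ H m → SimState t u Q S
  | Sum.inl b => halted b
  | Sum.inr (q, p, τ, f) => live
    { state := q
      ipos := fun j => p j
      itape := fun j k => if h : k < σ then τ j ⟨k, h⟩ else blank
      info := fun i =>
        { dir := if (f i).1 then HeadDir.right else HeadDir.left
          pos := (f i).2.1
          cut := (f i).2.2.1
          idx := (f i).2.2.2.1
          ovr := (f i).2.2.2.2 } }

theorem SimState.ofCode_toCode [NeZero σ] [NeZero m] (blank : S) (s : SimState t u Q S)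
    (h : s.Bounded blank σ H m) : ofCode blank (s.toCode : SimCode t u Q S σ H m) = s := by
  cases s with
  | halted b => rfl
  | live a =>
    obtain ⟨q, p, τ, f⟩ := a
    obtain ⟨h1, h2, h3⟩ := h
    simp only at h1 h2 h3
    simp only [toCode, ofCode, live.injEq, LiveState.mk.injEq, true_and]
    refine ⟨funext fun j => Nat.mod_eq_of_lt (h1 j), funext fun j => funext fun k => ?_,
      funext fun i => ?_⟩
    · split_ifs with hk
      · rfl
      · exact (h2 j k (not_lt.1 hk)).symm
    · obtain ⟨h4, h5, h6⟩ := h3 i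
      have e1 : (if decide ((f i).dir = HeadDir.right) = true then HeadDir.right
          else HeadDir.left) = (f i).dir := by
        cases (f i).dir <;> rfl
      have e2 : ((Fin.ofNat (H + 1) (f i).pos : Fin (H + 1)) : ℕ) = (f i).pos :=
        Nat.mod_eq_of_lt (Nat.lt_succ_of_le h4)
      have e3 : ((Fin.ofNat (H + 1) (f i).cut : Fin (H + 1)) : ℕ) = (f i).cut :=
        Nat.mod_eq_of_lt (Nat.lt_succ_of_le h5)
      have e4 : ((Fin.ofNat m (f i).idx : Fin m) : ℕ) = (f i).idx := Nat.mod_eq_of_lt h6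
      simp only [e1, e2, e3, e4]

theorem card_simCode [Fintype Q] [Fintype S] : Nat.card (SimCode t u Q S σ H m) =
    2 + Fintype.card Q * (σ ^ u * ((Fintype.card S ^ σ) ^ u *
      (2 * ((H + 1) * ((H + 1) * (m * (Fintype.card S + 1))))) ^ t)) := by
  classical
  rw [Nat.card_eq_fintype_card]
  simp [Fintype.card_sum, Fintype.card_prod]

end Coding

/-! ## Numerical bounds -/

theorem two_mul_add_three_le {q k u t s : ℕ} (hq : 1 ≤ q) (hk : 1 ≤ k) (ht : 1 ≤ t)
    (hs : 1 ≤ s) :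
    2 * (q * (s ^ u * ((k ^ s) ^ u * k ^ t))) + 3 ≤ 2 ^ ((3 + q + u + k * u + k) * (t * s)) := by
  have h1 : q * (s ^ u * ((k ^ s) ^ u * k ^ t)) ≤ 2 ^ q * ((2 ^ s) ^ u * (((2 ^ k) ^ s) ^ u *
      (2 ^ k) ^ t)) := by
    gcongr <;> exact Nat.lt_two_pow_self.le
  have h2 : 1 ≤ q * (s ^ u * ((k ^ s) ^ u * k ^ t)) := Nat.succ_le_of_lt (by positivity)
  have h3 : 2 * (q * (s ^ u * ((k ^ s) ^ u * k ^ t))) + 3 ≤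
      2 ^ 3 * (2 ^ q * ((2 ^ s) ^ u * (((2 ^ k) ^ s) ^ u * (2 ^ k) ^ t))) := by omega
  refine h3.trans ?_
  simp only [← pow_mul, ← pow_add]
  refine Nat.pow_le_pow_right (by norm_num) ?_
  have e1 : 1 ≤ t * s := Nat.mul_pos ht hs
  have e2 : s ≤ t * s := Nat.le_mul_of_pos_left _ ht
  have e3 : t ≤ t * s := Nat.le_mul_of_pos_right _ hs
  nlinarith [Nat.mul_le_mul_left u e2, Nat.mul_le_mul_left (k * u) e2, Nat.mul_le_mul_left k e3,
    Nat.mul_le_mul_left q e1]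

/-- With `N` the input length, `ℓ ≤ N * 2 ^ ((c + 2) * (t * s * r))`, and `H + 1` has the same form
with `c + 4`. Each tape contributes two factors `H + 1` and one factor `m ≤ N`, hence `N ^ 3`; the
power `t` for all tapes turns `t * s * r` into `t ^ 2 * r * s`. The coefficient `17 + 3 * (q + u + k
* u + k)` is `(2 * c + 9 + k) + (2 + q + u + k * u)`. -/
theorem card_states_le {q k u t s r N m ℓ H : ℕ} (hq : 1 ≤ q) (hk : 1 ≤ k) (ht : 1 ≤ t)
    (hs : 1 ≤ s) (hr : 1 ≤ r) (hm : 1 ≤ m) (hmN : m ≤ N)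
    (hℓ : ℓ ≤ (N + t + 1) * (2 * (q * (s ^ u * ((k ^ s) ^ u * k ^ t))) + 3) ^ r)
    (hH : H = ℓ + N) :
    2 + q * (s ^ u * ((k ^ s) ^ u * (2 * ((H + 1) * ((H + 1) * (m * (k + 1))))) ^ t)) ≤
      2 ^ ((17 + 3 * (q + u + k * u + k)) * t ^ 2 * r * s) * N ^ (3 * t) := by
  set c := 3 + q + u + k * u + k with hc
  have hN : 1 ≤ N := hm.trans hmN
  have e0 : 1 ≤ t * s := Nat.mul_pos ht hs
  have e1 : 1 ≤ t * s * r := Nat.mul_pos e0 hr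
  have et : t ≤ t * s * r := by
    rw [mul_assoc]
    exact Nat.le_mul_of_pos_right _ (Nat.mul_pos hs hr)
  have h1 : ℓ ≤ N * 2 ^ ((c + 2) * (t * s * r)) := by
    refine hℓ.trans ?_
    have h2 : N + t + 1 ≤ N * 2 ^ (2 * t) := by
      have h3 : t + 2 ≤ 2 ^ (2 * t) := by
        have h4 : t + 1 ≤ 2 ^ t := Nat.lt_two_pow_self
        rw [two_mul, pow_add]
        nlinarith
      nlinarith
    calc (N + t + 1) * (2 * (q * (s ^ u * ((k ^ s) ^ u * k ^ t))) + 3) ^ r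
        ≤ N * 2 ^ (2 * t) * (2 ^ (c * (t * s))) ^ r := by
          gcongr
          exact two_mul_add_three_le hq hk ht hs
      _ = N * 2 ^ (2 * t + c * (t * s * r)) := by
          rw [← pow_mul, mul_assoc, ← pow_add]
          ring_nf
      _ ≤ N * 2 ^ ((c + 2) * (t * s * r)) := by
          gcongr
          · norm_num
          · nlinarith
  have h2 : H + 1 ≤ N * 2 ^ ((c + 4) * (t * s * r)) := by
    have h3 : 2 ^ ((c + 2) * (t * s * r)) + 2 ≤ 2 ^ ((c + 4) * (t * s * r)) := by
      have h4 : 2 ^ ((c + 2) * (t * s * r)) * 2 ^ 2 ≤ 2 ^ ((c + 4) * (t * s * r)) := by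
        rw [← pow_add]
        refine Nat.pow_le_pow_right (by norm_num) ?_
        nlinarith
      have h5 : 1 ≤ 2 ^ ((c + 2) * (t * s * r)) := Nat.one_le_two_pow
      omega
    nlinarith
  have h3 : 2 * ((H + 1) * ((H + 1) * (m * (k + 1)))) ≤
      N ^ 3 * 2 ^ ((2 * c + 9 + k) * (t * s * r)) := by
    have hk2 : k + 1 ≤ 2 ^ k := Nat.lt_two_pow_self
    calc 2 * ((H + 1) * ((H + 1) * (m * (k + 1))))
        ≤ 2 ^ 1 * ((N * 2 ^ ((c + 4) * (t * s * r))) * ((N * 2 ^ ((c + 4) * (t * s * r))) *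
          (N * 2 ^ k))) := by
          rw [pow_one]
          gcongr
      _ = N ^ 3 * 2 ^ (1 + (c + 4) * (t * s * r) + (c + 4) * (t * s * r) + k) := by
          rw [pow_add, pow_add, pow_add]
          ring
      _ ≤ N ^ 3 * 2 ^ ((2 * c + 9 + k) * (t * s * r)) := by
          gcongr
          · norm_num
          · nlinarith [Nat.mul_le_mul_left k e1]
  have h4 : q * (s ^ u * ((k ^ s) ^ u * (2 * ((H + 1) * ((H + 1) * (m * (k + 1))))) ^ t)) ≤
      2 ^ q * ((2 ^ s) ^ u * (((2 ^ k) ^ s) ^ u *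
        (N ^ 3 * 2 ^ ((2 * c + 9 + k) * (t * s * r))) ^ t)) := by
    gcongr <;> exact Nat.lt_two_pow_self.le
  have h5 : 1 ≤ q * (s ^ u * ((k ^ s) ^ u * (2 * ((H + 1) * ((H + 1) * (m * (k + 1))))) ^ t)) :=
    Nat.succ_le_of_lt (by positivity)
  calc 2 + q * (s ^ u * ((k ^ s) ^ u * (2 * ((H + 1) * ((H + 1) * (m * (k + 1))))) ^ t))
      ≤ 2 ^ 2 * (2 ^ q * ((2 ^ s) ^ u * (((2 ^ k) ^ s) ^ u *
        (N ^ 3 * 2 ^ ((2 * c + 9 + k) * (t * s * r))) ^ t))) := by omega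
    _ = 2 ^ (2 + q + s * u + k * s * u + (2 * c + 9 + k) * (t * s * r) * t) * N ^ (3 * t) := by
        simp only [mul_pow, ← pow_mul, pow_add]
        ring
    _ ≤ _ := by
        refine Nat.mul_le_mul_right _ (Nat.pow_le_pow_right (by norm_num) ?_)
        have e2 : 1 ≤ t ^ 2 * r * s := Nat.mul_pos (Nat.mul_pos (by positivity) hr) hs
        have e3 : s ≤ t ^ 2 * r * s := Nat.le_mul_of_pos_left _ (Nat.mul_pos (by positivity) hr)
        have e4 : (17 + 3 * (q + u + k * u + k)) * t ^ 2 * r * s =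
            (2 * c + 9 + k) * (t * s * r) * t + (2 + q + u + k * u) * (t ^ 2 * r * s) := by
          rw [hc]
          ring
        rw [e4]
        nlinarith [Nat.mul_le_mul_left u e3, Nat.mul_le_mul_left (k * u) e3,
          Nat.mul_le_mul_left q e2]

/-! ## The simulating list machine -/

section Existence

variable {t u : ℕ} {Q S : Type*} {T : NTM t u Q S} {r s : ℕ → ℕ}

theorem NTM.ncard_app_dvd (γ : TMConfig t u Q S) : (T.app γ).Nonempty →
    (T.app γ).ncard ∣ T.rel.ncard.factorial := fun h =>
  Nat.dvd_factorial ((Set.ncard_pos (NTM.finite_app γ)).2 h)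
    (Set.ncard_le_ncard (NTM.app_subset γ) T.finite_rel)

theorem NTM.IsDeterministic.ncard_app_dvd (hT : T.IsDeterministic) (γ : TMConfig t u Q S)
    (h : (T.app γ).Nonempty) : (T.app γ).ncard ∣ 1 := by
  refine Nat.dvd_one.2 (le_antisymm ?_ ((Set.ncard_pos (NTM.finite_app γ)).2 h))
  refine (Set.ncard_le_one (NTM.finite_app γ)).2 fun δ h1 δ' h2 => ?_
  exact hT δ h1.1 δ' h2.1 (h1.2.1.trans h2.2.1.symm)
    (funext fun i => (h1.2.2.1 i).trans (h2.2.2.1 i).symm)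

/-- The parameters of the simulation are large enough for all inputs of length `N`. -/
theorem exists_simBounds (hT : T.IsBounded r s) {N m B ℓ H : ℕ} [NeZero (s N)] [NeZero m]
    (hdvd : ∀ γ : TMConfig t u Q S, (T.app γ).Nonempty → (T.app γ).ncard ∣ B)
    (hℓ : ∀ w, T.IsInput w → w.length = N → ∀ ρ, T.IsRun w ρ → ρ.length ≤ ℓ) (hH : ℓ ≤ H) :
    ∃ (dec : Fin (Nat.card (SimCode t u Q S (s N) H m)) → SimState t u Q S)
      (enc : SimState t u Q S → Fin (Nat.card (SimCode t u Q S (s N) H m))),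
      ∀ w, T.IsInput w → w.length = N → SimBounds T w m H B ℓ (s N) dec enc := by
  have := T.finite_states
  have := T.finite_alphabet
  let e := Finite.equivFin (SimCode t u Q S (s N) H m)
  refine ⟨fun a => SimState.ofCode T.blank (e.symm a), fun x => e x.toCode, ?_⟩
  rintro w hw rfl
  refine ⟨fun x hx => ?_, hdvd, fun h j => h.pos_lt hT hw j,
    fun h j k hk => h.tape_eq_blank hT hw j hk, fun h => ?_, hH⟩
  · rw [Equiv.symm_apply_apply]
    exact SimState.ofCode_toCode _ _ hx
  · obtain ⟨ρ, h1, h2, -⟩ := h.exists_isRun (hT w hw).1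
    exact h2.trans (hℓ w hw rfl ρ h1)

theorem isBounded_simMachine {hash : S} {m n B ℓ H σ : ℕ} [NeZero B] {A : Type*} [Finite A]
    {dec : A → SimState t u Q S} {enc : SimState t u Q S → A} (hT : T.IsBounded r s)
    (hhash : hash ≠ T.blank) (hm : 1 ≤ m) (hH : m * (n + 1) ≤ H)
    (hb : ∀ w, T.IsInput w → w.length = m * (n + 1) → SimBounds T w m H B ℓ σ dec enc) :
    (simMachine (ℓ := ℓ) (B := B) T hash m n H dec enc).IsBounded (r (m * (n + 1))) t := by
  refine ⟨le_rfl, fun v => ?_⟩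
  have hw := isInput_inputWord hhash v
  have hbv := hb _ hw (inputWord_length v)
  have hsim := simulates_init v hbv hm hH
  refine ⟨?_, ?_⟩
  · rintro ⟨f, hf0, hf⟩
    have hacc := hsim.acc hbv NTM.Reach.init
    rw [← hf0] at hacc
    exact not_acc_iff_exists_descending_chain.2 ⟨f, rfl, hf⟩ hacc
  · rintro ρ ⟨h1, h2, -⟩
    cases ρ with
    | nil => simp at h1
    | cons μ ρ =>
      simp only [List.head?_cons, Option.some.injEq] at h1
      subst h1
      obtain ⟨τ, γ, d, κ, h3, h4⟩ := hsim.rev_le hbv NTM.Reach.init ρ h2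
      have h5 := h3.sum_le hT hw
      rw [inputWord_length] at h5
      refine le_trans ?_ h5
      gcongr with i
      simpa using h4 i

theorem acceptProb_simMachine {hash : S} {m n B ℓ H σ : ℕ} [NeZero B] {A : Type*} [Finite A]
    {dec : A → SimState t u Q S} {enc : SimState t u Q S → A}
    (hm : 1 ≤ m) (hH : m * (n + 1) ≤ H) (v : Fin m → InputItem T.blank hash n)
    (hb : SimBounds T (inputWord v) m H B ℓ σ dec enc) :
    (simMachine (ℓ := ℓ) (B := B) T hash m n H dec enc).acceptProb v =
      T.acceptProb (inputWord v) := by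
  rw [NLM.acceptProb_eq, NTM.acceptProb_eq]
  exact (simulates_init v hb hm hH).acceptFrom_eq hb NTM.Reach.init

/-- The length of a longest run on inputs of length `N`. -/
theorem exists_length_bound (hT : T.IsBounded r s) {N : ℕ} (hs : 1 ≤ s N) :
    ∃ ℓ : ℕ, (∀ w, T.IsInput w → w.length = N → ∀ ρ, T.IsRun w ρ → ρ.length ≤ ℓ) ∧
      (∀ L : ℕ, (∀ w, T.IsInput w → w.length = N → ∀ ρ, T.IsRun w ρ → ρ.length ≤ L) → ℓ ≤ L) ∧
      ℓ ≤ (N + t + 1) * (2 * (Nat.card Q * (s N ^ u *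
        ((Nat.card S ^ s N) ^ u * Nat.card S ^ t))) + 3) ^ r N := by
  classical
  have := T.finite_states
  have := T.finite_alphabet
  have := Fintype.ofFinite Q
  have := Fintype.ofFinite S
  have hex : ∀ w, T.IsInput w → w.length = N → ∀ ρ, T.IsRun w ρ → ρ.length ≤
      (N + t + 1) * (2 * (Nat.card Q * (s N ^ u *
        ((Nat.card S ^ s N) ^ u * Nat.card S ^ t))) + 3) ^ r N := by
    rintro w hw rfl ρ hρ
    have : NeZero (s w.length) := ⟨by omega⟩
    obtain ⟨τ, γ, d, κ, h1, h2⟩ := hρ.exists_reach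
    rw [h2, Nat.card_eq_fintype_card, Nat.card_eq_fintype_card]
    exact h1.lt_length_bound hT hw
  have hne : ∃ L : ℕ, ∀ w, T.IsInput w → w.length = N → ∀ ρ, T.IsRun w ρ → ρ.length ≤ L := ⟨_, hex⟩
  -- The least bound serves two purposes: it lies below every given bound, which limits the choices,
  -- and below the explicit one, which limits the states.
  exact ⟨Nat.find hne, Nat.find_spec hne, fun L hL => Nat.find_min' hne hL, Nat.find_min' hne hex⟩

theorem NTM.IsBounded.one_le (hT : T.IsBounded r s) {hash : S} (hhash : hash ≠ T.blank) (N : ℕ) :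
    1 ≤ r N := by
  have h := (NTM.Reach.init (T := T) (w := List.replicate N hash)).sum_le hT
    (fun h => hhash (List.eq_of_mem_replicate h).symm)
  rw [List.length_replicate] at h
  omega

/-- The list machines that simulate a Turing machine when each choice of the list machine
consists of numbers below `B`. -/
theorem exists_simulation (hT : T.IsBounded r s) {hash : S} {m n B : ℕ} (ht : 1 ≤ t)
    (hhash : hash ≠ T.blank) (hB : B ≠ 0)
    (hdvd : ∀ γ : TMConfig t u Q S, (T.app γ).Nonempty → (T.app γ).ncard ∣ B) (hm : 1 ≤ m)
    (hs : 1 ≤ s (m * (n + 1))) :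
    ∃ (ℓ : ℕ) (A : Type) (M : NLM t m (InputItem T.blank hash n) (Fin ℓ → Fin B) A),
      M.IsBounded (r (m * (n + 1))) t ∧
      (∀ L : ℕ, (∀ w, T.IsInput w → w.length = m * (n + 1) → ∀ ρ, T.IsRun w ρ → ρ.length ≤ L) →
        ℓ ≤ L) ∧
      Nat.card A ≤ 2 ^ ((17 + 3 * (Nat.card Q + u + Nat.card S * u + Nat.card S)) * t ^ 2 *
        r (m * (n + 1)) * s (m * (n + 1))) * (m * (n + 1)) ^ (3 * t) ∧
      ∀ v : Fin m → InputItem T.blank hash n, M.acceptProb v = T.acceptProb (inputWord v) := by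
  have := T.finite_states
  have := T.finite_alphabet
  have := Fintype.ofFinite Q
  have := Fintype.ofFinite S
  have : NeZero B := ⟨hB⟩
  have : NeZero m := ⟨by omega⟩
  have : NeZero (s (m * (n + 1))) := ⟨by omega⟩
  obtain ⟨ℓ, h1, h2, h3⟩ := exists_length_bound hT hs
  -- The range `H` must exceed all head positions, which are below `ℓ`, and contain the whole input.
  obtain ⟨dec, enc, hb⟩ := exists_simBounds (m := m) (B := B) (H := ℓ + m * (n + 1)) hT hdvd h1
    (Nat.le_add_right _ _)
  have hH : m * (n + 1) ≤ ℓ + m * (n + 1) := Nat.le_add_left _ _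
  refine ⟨ℓ, _, simMachine T hash m n (ℓ + m * (n + 1)) dec enc,
    isBounded_simMachine hT hhash hm hH hb, h2, ?_, fun v => acceptProb_simMachine hm hH v
      (hb _ (isInput_inputWord hhash v) (inputWord_length v))⟩
  rw [Nat.card_eq_fintype_card (α := Fin _), Fintype.card_fin, card_simCode,
    ← Nat.card_eq_fintype_card, ← Nat.card_eq_fintype_card]
  refine card_states_le ?_ ?_ ht hs (hT.one_le hhash _) hm ?_ h3 rfl
  · have : Nonempty Q := ⟨T.start⟩
    exact Nat.card_pos
  · have : Nonempty S := ⟨T.blank⟩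
    exact Nat.card_pos
  · exact Nat.le_mul_of_pos_right _ (Nat.succ_pos _)

end Existence

theorem lemma16 :
    ∃ d : ℕ → ℕ → ℕ → ℕ,
      ∀ (t u : ℕ) (Q S : Type*) (T : NTM t u Q S) (hash : S),
        1 ≤ t → hash ≠ T.blank →
        ∃ K : ℕ, ∀ r s : ℕ → ℕ, T.IsBounded r s →
          ∀ m n : ℕ, 1 ≤ m → 1 ≤ s (m * (n + 1)) →
            ∃ (C A : Type) (M : NLM t m (InputItem T.blank hash n) C A),
              M.IsBounded (r (m * (n + 1))) t ∧
              (∀ L : ℕ,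
                (∀ w, T.IsInput w → w.length = m * (n + 1) → ∀ ρ, T.IsRun w ρ → ρ.length ≤ L) →
                Nat.card C ≤ 2 ^ (K * L)) ∧
              (Nat.card A : ℝ) ≤
                (2 : ℝ) ^ ((d u (Nat.card Q) (Nat.card S) : ℝ) * (t : ℝ) ^ 2 *
                    (r (m * (n + 1)) : ℝ) * (s (m * (n + 1)) : ℝ) +
                  3 * (t : ℝ) * Real.logb 2 ((m * (n + 1) : ℕ) : ℝ)) ∧
              (∀ v : Fin m → InputItem T.blank hash n,
                M.acceptProb v = T.acceptProb (inputWord v)) ∧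
              (T.IsDeterministic → M.IsDeterministic) := by
  classical
  refine ⟨fun u q k => 17 + 3 * (q + u + k * u + k), fun t u Q S T hash ht hhash => ?_⟩
  -- The factorial of the number of transitions is divisible by every number of applicable ones. A
  -- deterministic machine never has more than one, so `B = 1` suffices and leaves a single choice
  -- sequence.
  obtain ⟨B, hB, hdvd, hdet⟩ : ∃ B : ℕ, B ≠ 0 ∧
      (∀ γ : TMConfig t u Q S, (T.app γ).Nonempty → (T.app γ).ncard ∣ B) ∧
      (T.IsDeterministic → B = 1) := by
    by_cases h : T.IsDeterministic
    · exact ⟨1, one_ne_zero, h.ncard_app_dvd, fun _ => rfl⟩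
    · exact ⟨_, Nat.factorial_ne_zero _, NTM.ncard_app_dvd, fun h' => absurd h' h⟩
  -- `K = B` works because `B ^ ℓ ≤ 2 ^ (B * ℓ)`; it depends only on `T`.
  refine ⟨B, fun r s hT m n hm hs => ?_⟩
  obtain ⟨ℓ, A, M, h1, h2, h3, h4⟩ := exists_simulation hT ht hhash hB hdvd hm hs
  have hN : 0 < m * (n + 1) := Nat.mul_pos hm (Nat.succ_pos _)
  refine ⟨_, A, M, h1, fun L hL => ?_, ?_, h4, fun h => ?_⟩
  · rw [Nat.card_eq_fintype_card, Fintype.card_fun, Fintype.card_fin, Fintype.card_fin, pow_mul]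
    exact (Nat.pow_le_pow_left Nat.lt_two_pow_self.le ℓ).trans
      (Nat.pow_le_pow_right Nat.one_le_two_pow (h2 L hL))
  · generalize m * (n + 1) = N at *
    have h5 : (2 : ℝ) ^ (3 * (t : ℝ) * Real.logb 2 (N : ℝ)) = (N : ℝ) ^ (3 * t) := by
      rw [mul_comm, Real.rpow_mul two_pos.le, Real.rpow_logb two_pos (by norm_num)
        (by exact_mod_cast hN), ← Real.rpow_natCast]
      push_cast
      rfl
    rw [Real.rpow_add two_pos, h5]
    have h6 := (Nat.cast_le (α := ℝ)).2 h3
    refine h6.trans (le_of_eq ?_)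
    push_cast
    rw [← Real.rpow_natCast 2]
    push_cast
    rfl
  · rw [NLM.IsDeterministic, Nat.card_eq_fintype_card, Fintype.card_fun, Fintype.card_fin,
      Fintype.card_fin, hdet h, one_pow]
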